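/- Let $N_1,N_2\ge 1$ be integers, $N=N_1+N_2$, $\xi=N_1N_2/N^2$. The semiclassical evaluation of the transmission-moment generating function $T(s)=\sum_{n\ge1}s^n\langle\operatorname{Tr}(t^\dagger t)^n\rangle$ is an expansion over genera $g\in\frac12\mathbb Z$, in which genus $g$ contributes at order $N^{1-2g}$ (at fixed $N_1/N_2$); the term of order $N^{-1}$, written $N^{-1}T_2(s)$, is the contribution of genus $1$, defined as follows. *Base structures.* Let $Z_{2m}=\{1,\dots,2m,\overline{2m},\dots,\overline1\}$, $m\geq 1$, $\mathcal T(z)=\overline z$, $\phi=(1\,2\cdots 2m)(\overline{2m}\cdots\overline2\,\overline1)$. A base structure with $m$ edges is a unicellular map with marked and oriented starting edge-side and no vertices of degree $1$ or $2$, i.e. a fixed-point-free involution $\varepsilon$ of $Z_{2m}$ which commutes with $\mathcal T$, has no cycle $(z\,\overline z)$, and for which $\nu=\phi\varepsilon$ has no cycles of length $1$ or $2$. Its vertices are the pairs of mutually reversed cycles of $\nu$; its genus is given by $2g=1+m-\#\text{vertices}$. An edge is unitary if its two sides are run in opposite directions by the boundary walk $1,2,\dots,2m$, and orthogonal otherwise;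 the base structure is unitary (orientable) if all edges are unitary. *Grafting.* Mark the two sides of each end of each edge, one solid and one dashed. Plant lists of plane trees in the corners at the vertices, and on both sides of finitely many inner points (nodes) of the edges, an even positive number of trees at each node; in the trees every internal vertex has even degree $\geq 4$ (root edge included). Along the boundary walk the mark changes at each leaf and nowhere else, in accordance with the given marks, and opposite sides of every edge have different marks. The leaf following a solid (dashed) portion of the boundary is an $o$-leaf ($i$-leaf). *Contribution of a grafted structure.* It is the product of $1/N$ for each edge, $N_1$ for each $i$-leaf, $N_2$ for each $o$-leaf, $-N$ for each internal vertex, and a factor $1-(N/N_c)^{k-1}$ for each vertex of degree $2k$ of which every second edge leads directly to a leaf, all of these being $i$-leaves ($N_c=N_1$) or all $o$-leaves ($N_c=N_2$); the last factor adds the diagrams in which the vertex is untied in the lead. For a base structure $B$ let $W_n(B)$ be the sum of the contributions of its graftings with $2n$ leaves, and let $\hat T_2(s)=N\sum_{n\ge0} s^n\sum_B\frac1{2m(B)}W_n(B)$ and $T_2(s)=s\,\frac{d}{ds}\hat T_2(s)$, where $B$ runs over the unitary base structures of genus $1$ (without time-reversal symmetry, $\hat T_2^{\rm U},T_2^{\rm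 U}$) or over all base structures of genus $1$ (with time-reversal symmetry, $\hat T_2^{\rm O},T_2^{\rm O}$). (The factor $n/(2m)$ in $T_2$ replaces the marked edge-side by a marked leaf $i_1$.) Then: 1. Every base structure of genus $1$ has $2$ or $3$ edges; there are $5$ with $m=2$ and $7$ with $m=3$. Exactly two of them are unitary, $(1\,3)(2\,4)$ and $(1\,4)(2\,5)(3\,6)$ (together with the barred copies of these cycles). 2. For every base structure $B$ and every $n$ only finitely many graftings on $B$ have $2n$ leaves. 3. There is a unique formal power series $h=h(s)$ with $h(0)=0$ and $s\xi h^2+(s-2s\xi-1)h+s\xi=0$. As formal power series in $s$, $$N\sum_{n\ge0}s^nW_n\big((1\,4)(2\,5)(3\,6)\big)=\frac{(2h^3\xi-5h^3+4h^2\xi-10h^2-6h-6\xi)h}{\xi(h-1)(h+1)^3},$$ $$N\sum_{n\ge0}s^nW_n\big((1\,3)(2\,4)\big)=\frac{-2(h^2\xi-2h^2+h\xi-2h-2\xi)h}{\xi(h-1)(h+1)^2},$$ $$\hat T_2^{\rm U}=\frac{h^3(h+2)}{6\xi(h-1)(1+h)^3}-\frac{h^2(h+3)}{6(1+h)^3},\qquad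 \hat T_2^{\rm O}=\frac{h^2(h^2+2h-6)}{6\xi(h-1)(1+h)^3}-\frac{h(h^2+9h-6)}{6(1+h)^3}.$$ 4. For all real $s$ with $|s|<1$ the series $T_2^{\rm U}(s)$ and $T_2^{\rm O}(s)$ (without constant terms) converge, and $$T_2^{\rm U}(s)=-\frac{\xi^2s^2}{(1-s)^{3/2}(1-s+4\xi s)^{5/2}},\qquad T_2^{\rm O}(s)=\frac{\xi s\,[\xi s(4s-3)+1-s^2]}{(1-s)^{3/2}(1-s+4\xi s)^{5/2}}.$$ -/

import Mathlib

namespace Semiclassical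

/-! ### Base structures

A unicellular map with `m` edges has `2 * m` edge-sides, numbered along its boundary walk.
The oriented edge-sides are the pairs `(z, b)`; `(z, false)` is the side `z` run along the
boundary walk, `(z, true)` is the same side run backwards (written with a bar on paper). -/

abbrev Side (m : ℕ) : Type := Fin (2 * m) × Bool

/-- Reversal of an oriented edge-side. -/
def rev {m : ℕ} (x : Side m) : Side m := (x.1, !x.2)

/-- The face permutation `(1 2 … 2m)(2m-bar … 2-bar 1-bar)`. -/
def face (m : ℕ) : Equiv.Perm (Side m) where
  toFun x := if x.2 then ((finRotate (2 * m)).symm x.1, true) else (finRotate (2 * m) x.1, false)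
  invFun x := if x.2 then (finRotate (2 * m) x.1, true) else ((finRotate (2 * m)).symm x.1, false)
  left_inv x := by rcases x with ⟨z, b⟩; cases b <;> simp only [Bool.false_eq_true, if_true, if_false,
    Equiv.symm_apply_apply, Equiv.apply_symm_apply]
  right_inv x := by rcases x with ⟨z, b⟩; cases b <;> simp only [Bool.false_eq_true, if_true, if_false,
    Equiv.symm_apply_apply, Equiv.apply_symm_apply]

/-- A base structure with `m` edges: a (locally orientable) unicellular map in canonical form,
given by the permutation `ε` matching the two sides of every edge, such that no vertex has
degree `1` or `2`. The vertex permutation is `face m * ε`; each vertex is a pair of its cycles. -/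
structure BaseStructure (m : ℕ) where
  ε : Equiv.Perm (Side m)
  pos : 0 < m
  invol : ∀ x, ε (ε x) = x
  ne_self : ∀ x, ε x ≠ x
  ne_rev : ∀ x, ε x ≠ rev x
  comm_rev : ∀ x, ε (rev x) = rev (ε x)
  degree_ne_one : ∀ x, (face m * ε) x ≠ x
  degree_ne_two : ∀ x, (face m * ε) ((face m * ε) x) ≠ x

namespace BaseStructure

variable {m : ℕ} (B : BaseStructure m)

/-- The vertex permutation, whose cycles list the oriented edge-sides leaving a vertex. -/
def ν : Equiv.Perm (Side m) := face m * B.ε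

/-- The base structure is unitary (orientable): no side is matched with a reversed side. -/
def IsUnitary : Prop := ∀ x, (B.ε x).2 = x.2

/-- Corner `z` is the corner of the map passed by the boundary walk between the side `z` and the
next side. The sides leaving the vertex at this corner are `(z, true)` and
`(finRotate _ z, false)`, one for each of the two cycles of `ν` that describe the vertex.
`B.cornersAt z` is the set of all corners around the vertex at which corner `z` lies. -/
def cornersAt (z : Fin (2 * m)) : Finset (Fin (2 * m)) :=
  Finset.univ.filter fun w =>
    B.ν.SameCycle (z, true) (w, true) ∨ B.ν.SameCycle (z, true) (finRotate (2 * m) w, false)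

/-- The vertices, each represented by the set of corners around it. -/
def vertices : Finset (Finset (Fin (2 * m))) := Finset.univ.image B.cornersAt

/-- Twice the genus: `2 g = 1 + (number of edges) - (number of vertices)`. -/
def twoGenus : ℤ := 1 + (m : ℤ) - (B.vertices.card : ℤ)

/-- The edge containing the side `z` is unitary: its two sides are run in opposite directions
by the boundary walk. -/
def unitaryEdge (z : Fin (2 * m)) : Bool := !(B.ε (z, false)).2

/-- The sides that come first among the two sides of their edge. They represent the edges. -/
abbrev Edge : Type := {z : Fin (2 * m) // z < (B.ε (z, false)).1}

end BaseStructure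

/-- The unitary base structure `(1 3)(2 4)`. -/
def unitaryBaseTwo : BaseStructure 2 where
  ε := ⟨fun x => (x.1 + 2, x.2), fun x => (x.1 + 2, x.2), by unfold Function.LeftInverse; decide,
    by unfold Function.RightInverse Function.LeftInverse; decide⟩
  pos := by decide
  invol := by decide
  ne_self := by decide
  ne_rev := by decide
  comm_rev := by decide
  degree_ne_one := by decide
  degree_ne_two := by decide

/-- The unitary base structure `(1 4)(2 5)(3 6)`. -/
def unitaryBaseThree : BaseStructure 3 where
  ε := ⟨fun x => (x.1 + 3, x.2), fun x => (x.1 + 3, x.2), by unfold Function.LeftInverse; decide,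
    by unfold Function.RightInverse Function.LeftInverse; decide⟩
  pos := by decide
  invol := by decide
  ne_self := by decide
  ne_rev := by decide
  comm_rev := by decide
  degree_ne_one := by decide
  degree_ne_two := by decide

/-! ### Marks and trees

Every portion of the boundary of a diagram is marked solid (`true`) or dashed (`false`).
Following the boundary walk, the next leaf after a solid portion is an `o`-leaf (outgoing
channel), the next leaf after a dashed portion is an `i`-leaf (incoming channel), and the mark
changes at each leaf. -/

/-- The mark found after having walked around `k` trees, when it was `a` before. A tree has an odd
number of labelled leaves, so each tree changes the mark. -/
def markAfter (k : ℕ) (a : Bool) : Bool := Bool.not^[k] a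

/-- Plane trees to be planted: the root edge leads to a leaf, or to a vertex from which an odd
number, at least `3`, of further trees emanate (so that its degree is even and greater than `2`),
listed along the boundary walk. -/
inductive PlantedTree : Type
  | leaf : PlantedTree
  | node (k : ℕ) (c : Fin (2 * k + 3) → PlantedTree) : PlantedTree

/-- Number of (labelled) leaves. -/
def PlantedTree.leaves : PlantedTree → ℕ
  | .leaf => 1
  | .node _ c => ∑ j, (c j).leaves

/-- Number of channels in the lead that is reached after a portion with mark `a`:
`o`-leaves run through the `N₂` outgoing channels, `i`-leaves through the `N₁` incoming ones. -/
def channels (N₁ N₂ : ℝ) (a : Bool) : ℝ := if a then N₂ else N₁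

/-- A vertex is cut into sectors by those of its edges that do not belong to planted trees, or
lead to the root (the stubs). Let `l` be the list of trees in a sector and `a` the mark at which
the boundary walk enters the sector. The types of the trees alternate, starting with `a`.
A vertex can be untied in the lead `c` iff every second edge of it leads directly to a leaf of
type `c`; since no stub leads directly to a leaf, this means that in every sector there is an odd
number of trees of which the first, third, … are leaves of type `c`. -/
def SectorUntieable (c a : Bool) (l : List PlantedTree) : Prop :=
  a = c ∧ Odd l.length ∧ ∀ (j : ℕ) (hj : j < l.length), Even j → l[j] = PlantedTree.leaf

open Classical in
/-- Factor of an internal vertex of degree `2 * k` and of its untied versions. The vertex itself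
gives `-N`. If it can be untied in the lead `c`, the untied version lacks this factor and the
factors `1 / N` of `k` edges, and has one factor `N_c` instead of `k` such factors. -/
noncomputable def vertexWeight (N₁ N₂ : ℝ) (k : ℕ) (untieable : Bool → Prop) : ℝ :=
  -(N₁ + N₂) + ∑ c : Bool,
    if untieable c then (N₁ + N₂) ^ k * channels N₁ N₂ c / channels N₁ N₂ c ^ k else 0

/-- Contribution (summed over its untied versions) of a planted tree whose root edge is first met
by the boundary walk on a portion with mark `a`: `1 / N` for every edge, `vertexWeight` for every
internal vertex and the number of channels for every leaf. It is an `o`-tree for `a = true` and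
an `i`-tree for `a = false`. -/
noncomputable def PlantedTree.weight (N₁ N₂ : ℝ) : PlantedTree → Bool → ℝ
  | .leaf, a => 1 / (N₁ + N₂) * channels N₁ N₂ a
  | .node k c, a =>
      1 / (N₁ + N₂) * vertexWeight N₁ N₂ (k + 2) (fun b => SectorUntieable b a (List.ofFn c)) *
        ∏ j, (c j).weight N₁ N₂ (markAfter j a)

/-- Contribution of the trees in a sector which the boundary walk enters with mark `a`. -/
noncomputable def sectorWeight (N₁ N₂ : ℝ) : Bool → List PlantedTree → ℝ
  | _, [] => 1
  | a, t :: l => t.weight N₁ N₂ a * sectorWeight N₁ N₂ (!a) l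

def sectorLeaves (l : List PlantedTree) : ℕ := (l.map PlantedTree.leaves).sum

/-! ### Edges of the base structure -/

/-- A node on an edge of the base structure is a vertex created by planting trees at an inner
point of the edge: `fst` lists the trees on the first side of the edge, `snd` the trees on the
second side, each in the order of the boundary walk. -/
structure EdgeNode where
  fst : List PlantedTree
  snd : List PlantedTree

/-- The node is a vertex of even degree `fst.length + snd.length + 2` greater than `2`. -/
def EdgeNode.Valid (p : EdgeNode) : Prop :=
  Even (p.fst.length + p.snd.length) ∧ 0 < p.fst.length + p.snd.length

def EdgeNode.leaves (p : EdgeNode) : ℕ := sectorLeaves p.fst + sectorLeaves p.snd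

/-- The mark at which the boundary walk enters the node on the second side, if it enters it on the
first side with mark `a`. Opposite sides have opposite marks. On a unitary edge (`u = true`) the
second side is run in the opposite direction, on an orthogonal edge in the same direction. -/
def EdgeNode.sndMark (u : Bool) (a : Bool) (p : EdgeNode) : Bool :=
  if u then !(markAfter p.fst.length a) else !a

noncomputable def EdgeNode.weight (N₁ N₂ : ℝ) (u : Bool) (a : Bool) (p : EdgeNode) : ℝ :=
  vertexWeight N₁ N₂ ((p.fst.length + p.snd.length + 2) / 2)
      (fun c => SectorUntieable c a p.fst ∧ SectorUntieable c (p.sndMark u a) p.snd) *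
    sectorWeight N₁ N₂ a p.fst * sectorWeight N₁ N₂ (p.sndMark u a) p.snd

/-- Contribution of an edge of the base structure with its nodes, listed along the first side,
which starts with mark `a`. The nodes cut it into edges of the diagram, each with factor `1 / N`. -/
noncomputable def edgeWeight (N₁ N₂ : ℝ) (u : Bool) : Bool → List EdgeNode → ℝ
  | _, [] => 1 / (N₁ + N₂)
  | a, p :: l => 1 / (N₁ + N₂) * p.weight N₁ N₂ u a *
      edgeWeight N₁ N₂ u (markAfter p.fst.length a) l

/-! ### Grafted base structures -/

/-- A semiclassical diagram obtained from the base structure `B` by pre-marking the ends of its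
edges and grafting trees on its vertices and edges, in accordance with the marks. -/
structure Grafting {m : ℕ} (B : BaseStructure m) where
  /-- `mark (z, false)` is the mark of side `z` at its start, `mark (z, true)` at its end. -/
  mark : Side m → Bool
  /-- Each edge end is solid on one side and dashed on the other. -/
  mark_opp : ∀ x, mark (rev (B.ε x)) = !(mark x)
  /-- The trees planted on the vertices, in the sector at corner `z`. -/
  corner : Fin (2 * m) → List PlantedTree
  corner_mark : ∀ z, mark (finRotate (2 * m) z, false) =
    markAfter (corner z).length (mark (z, true))
  /-- The nodes on the edges, listed along the first side of the edge. -/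
  edge : B.Edge → List EdgeNode
  edge_valid : ∀ e, ∀ p ∈ edge e, p.Valid
  edge_mark : ∀ e : B.Edge, mark (e.1, true) =
    markAfter ((edge e).map fun p => p.fst.length).sum (mark (e.1, false))

namespace Grafting

variable {m : ℕ} {B : BaseStructure m} (G : Grafting B)

/-- Total number of leaves of the diagram. -/
def leaves : ℕ :=
  ∑ z, sectorLeaves (G.corner z) + ∑ e, ((G.edge e).map EdgeNode.leaves).sum

/-- Half of the degree of a vertex (given by its corners) of the base structure in the diagram. -/
def halfDegree (v : Finset (Fin (2 * m))) : ℕ := (∑ z ∈ v, (1 + (G.corner z).length)) / 2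

/-- The semiclassical contribution of the diagram, including all its untied versions, summed over
the channels: the product of the factors of all its edges, internal vertices and leaves. -/
noncomputable def weight (N₁ N₂ : ℝ) : ℝ :=
  (∏ e : B.Edge, edgeWeight N₁ N₂ (B.unitaryEdge e.1) (G.mark (e.1, false)) (G.edge e)) *
  (∏ z, sectorWeight N₁ N₂ (G.mark (z, true)) (G.corner z)) *
  ∏ v ∈ B.vertices, vertexWeight N₁ N₂ (G.halfDegree v)
    (fun c => ∀ z ∈ v, SectorUntieable c (G.mark (z, true)) (G.corner z))

end Grafting

/-! ### Generating functions -/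

/-- Sum of the contributions of all graftings on `B` that have `2 * n` leaves. -/
noncomputable def contribution (N₁ N₂ : ℝ) {m : ℕ} (B : BaseStructure m) (n : ℕ) : ℝ :=
  ∑ᶠ (G : Grafting B) (_ : G.leaves = 2 * n), G.weight N₁ N₂

/-- The sum over all base structures of genus `twoG / 2` (with `P m B`) of their contributions
with `2 * n` leaves, weighted by `1 / (2 * m)` to unmark the starting edge-side. -/
noncomputable def integratedTerm (N₁ N₂ : ℝ) (P : ∀ m, BaseStructure m → Prop) (twoG : ℤ)
    (n : ℕ) : ℝ :=
  ∑ᶠ (B : Σ m, BaseStructure m) (_ : B.2.twoGenus = twoG ∧ P B.1 B.2),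
    1 / (2 * (B.1 : ℝ)) * contribution N₁ N₂ B.2 n

/-- The term of genus `twoG / 2` of the `n`-th transmission moment without time-reversal symmetry.
The factor `n` counts the choices of the leaf `i₁`. -/
noncomputable def momentTermU (N₁ N₂ : ℝ) (twoG : ℤ) (n : ℕ) : ℝ :=
  n * integratedTerm N₁ N₂ (fun _ B => B.IsUnitary) twoG n

/-- The term of genus `twoG / 2` of the `n`-th transmission moment with time-reversal symmetry. -/
noncomputable def momentTermO (N₁ N₂ : ℝ) (twoG : ℤ) (n : ℕ) : ℝ :=
  n * integratedTerm N₁ N₂ (fun _ _ => True) twoG n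

/-- The quadratic equation `s ξ h² + (s - 2 s ξ - 1) h + s ξ = 0` for the formal power series `h`
in `s` with `h(0) = 0`. -/
def IsTreeSeries (ξ : ℝ) (h : PowerSeries ℝ) : Prop :=
  PowerSeries.constantCoeff h = 0 ∧
    PowerSeries.X * PowerSeries.C ξ * h ^ 2
      + (PowerSeries.X - 2 * PowerSeries.X * PowerSeries.C ξ - 1) * h
      + PowerSeries.X * PowerSeries.C ξ = 0

end Semiclassical

open Semiclassical

/-!
The graftings on a fixed base structure form a combinatorial class whose generating function is
computed exactly; there are only twelve base structures of genus one, and the sum over them is then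
evaluated in closed form.

*Generating functions.* `gf sz w` is the power series in which an object `a` contributes `w a` at
degree `sz a`; here leaves are counted one by one, so the variable is a square root of `s`. Cutting
trees at the root, and sectors and edges at their first tree or node, gives recursions for the
series `treeGF`, `sectorGF`, `untiedGF` and `edgeGF`. The untied vertices make the recursion for
trees collapse to `sectorGF_not_eq`: the sectors with an odd number of trees have the same
generating function as the sectors that can be untied, up to a factor. Hence all of these series are
rational in the two tree series, and the product `h = treeProd` of these two satisfies the quadratic
equation `treeProd_quadratic`.

*One base structure.* Summing over the versions of every vertex (tied, or untied in one of the
leads) makes the weight of a diagram a product over corners and edges. So `gf_grafting` is a sum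
over the marks at the ends of the edges of products of these series. In genus one the powers of `N`,
`1 - h` and `1 + h` in these products depend on the number of edges only; what remains is the finite
sum `reducedSum`, evaluated in `reducedSum_two` and `reducedSum_three`.

*Classification.* A vertex has at least three corners, and there are `2 m` corners. In genus one
there are `m - 1` vertices, so `3 (m - 1) ≤ 2 m`, that is `m ≤ 3`, and all vertices have degree
three if `m = 3`. The base structures that are left are enumerated (`exists_codeTwo`,
`exists_codeThree`).

*Dependence on `s`.* The quadratic equation contains the counting variable of leaves only through
its square, so `treeProd` is obtained from the series `h(s)` by inserting this square for `s`
(`IsTreeSeries.expand_eq`), and the contributions are rational functions of `h(s)`. The equation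
also parametrizes `s` by `h`, namely `s = h / (ξ (1 - h)² + h)`, and `R = 1 - s + 2 s ξ - 2 s ξ h`
satisfies `R² = (1 - s) (1 - s + 4 ξ s)` and `s R h' = h`. With these, `s d/ds` of the integrated
generating functions becomes a polynomial in `s` divided by `R³ (1 - s + 4 ξ s)`
(`mul_derivative_of_parametrization`). Finally `R⁻³ (1 - s + 4 ξ s)⁻¹` is a product of two binomial
series, which converge absolutely for `|s| < 1` because `0 < ξ ≤ 1 / 4`.
-/

namespace Semiclassical

/-! ### Generating functions of weighted classes -/

open PowerSeries in
/-- The generating function `∑ a, w a * X ^ sz a` of a class `α` whose elements have a size `sz`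
and a weight `w`. Coefficients are `finsum`s, so it is meaningful only if `FiniteFibers sz`. -/
noncomputable def gf {α R : Type*} [Semiring R] (sz : α → ℕ) (w : α → R) : R⟦X⟧ :=
  PowerSeries.mk fun n => ∑ᶠ (a : α) (_ : sz a = n), w a

/-- There are only finitely many elements of each size. -/
def FiniteFibers {α : Type*} (sz : α → ℕ) : Prop := ∀ n, {a | sz a = n}.Finite

section GeneratingFunction

variable {α β R : Type*}

lemma FiniteFibers.of_injective {sz : α → ℕ} {sz' : β → ℕ} (h : FiniteFibers sz) (f : β → α)
    (hf : Function.Injective f) (hsz : ∀ b, sz (f b) = sz' b) : FiniteFibers sz' := fun n =>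
  ((h n).preimage hf.injOn).subset fun b hb => by
    simpa [hsz] using hb

lemma FiniteFibers.finite_le {sz : α → ℕ} (h : FiniteFibers sz) (n : ℕ) :
    {a | sz a ≤ n}.Finite := by
  refine ((Set.finite_le_nat n).biUnion fun k _ => h k).subset fun a ha => ?_
  simpa using ha

lemma finiteFibers_of_finite_le {sz : α → ℕ} (h : ∀ n, {a | sz a ≤ n}.Finite) :
    FiniteFibers sz := fun n => (h n).subset fun _ ha => le_of_eq ha

lemma FiniteFibers.prod {sa : α → ℕ} {sb : β → ℕ} (ha : FiniteFibers sa) (hb : FiniteFibers sb) :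
    FiniteFibers (fun x : α × β => sa x.1 + sb x.2) := fun n => by
  refine ((ha.finite_le n).prod (hb.finite_le n)).subset fun x hx => ?_
  simp only [Set.mem_ofPred_eq, Set.mem_prod] at hx ⊢
  omega

lemma FiniteFibers.pi {ι : Type*} [Fintype ι] {sz : α → ℕ} (h : FiniteFibers sz) :
    FiniteFibers (fun f : ι → α => ∑ i, sz (f i)) := fun n => by
  refine (Set.Finite.pi' fun _ : ι => h.finite_le n).subset fun f hf i => ?_
  simp only [Set.mem_ofPred_eq] at hf ⊢
  exact hf ▸ Finset.single_le_sum (f := fun i => sz (f i)) (fun _ _ => Nat.zero_le _)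
    (Finset.mem_univ i)

lemma FiniteFibers.snd {ι : Type*} [Finite ι] {sz : α → ℕ} (h : FiniteFibers sz) :
    FiniteFibers (fun x : ι × α => sz x.2) := fun n => by
  refine ((Set.finite_univ (α := ι)).prod (h n)).subset fun x hx => ?_
  simpa using hx

/-- Every element of the list has positive size, so the lists of size at most `n + 1` are the empty
list and lists with a tail of size at most `n`. -/
lemma finiteFibers_list {s : α → ℕ} {sz : List α → ℕ} (h : FiniteFibers s) (pos : ∀ x, 0 < s x)
    (hsz : ∀ x l, sz (x :: l) = s x + sz l) : FiniteFibers sz := by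
  refine finiteFibers_of_finite_le fun n => ?_
  induction n with
  | zero =>
    refine (Set.finite_singleton []).subset fun l hl => ?_
    cases l with
    | nil => rfl
    | cons x l =>
      have := pos x
      simp only [Set.mem_ofPred_eq, hsz] at hl
      omega
  | succ n ih =>
    refine ((((h.finite_le (n + 1)).prod ih).image fun x => x.1 :: x.2).union
      (Set.finite_singleton [])).subset fun l hl => ?_
    cases l with
    | nil => simp
    | cons x l =>
      have := pos x
      simp only [Set.mem_ofPred_eq, hsz] at hl
      exact Or.inl ⟨(x, l), ⟨by simp only [Set.mem_ofPred_eq]; omega,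
        by simp only [Set.mem_ofPred_eq]; omega⟩, rfl⟩

section Semiring

variable [CommSemiring R]

lemma coeff_gf {sz : α → ℕ} (h : FiniteFibers sz) (w : α → R) (n : ℕ) :
    PowerSeries.coeff n (gf sz w) = ∑ a ∈ (h n).toFinset, w a := by
  rw [gf, PowerSeries.coeff_mk]
  exact finsum_mem_eq_finite_toFinset_sum w (h n)

lemma gf_equiv (e : β ≃ α) (sz : α → ℕ) (w : α → R) :
    gf (fun b => sz (e b)) (fun b => w (e b)) = gf sz w := by
  ext n
  simp only [gf, PowerSeries.coeff_mk]
  exact finsum_comp_equiv e (f := fun a => ∑ᶠ (_ : sz a = n), w a)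

lemma gf_congr {sz sz' : α → ℕ} {w w' : α → R} (h : ∀ a, sz a = sz' a) (hw : ∀ a, w a = w' a) :
    gf sz w = gf sz' w' := by
  rw [funext h, funext hw]

lemma gf_sum_index {ι : Type*} {sz : α → ℕ} (h : FiniteFibers sz) (s : Finset ι)
    (w : ι → α → R) : gf sz (fun a => ∑ i ∈ s, w i a) = ∑ i ∈ s, gf sz (w i) := by
  ext n
  simp only [map_sum, coeff_gf h]
  exact Finset.sum_comm

lemma gf_add {sz : α → ℕ} (h : FiniteFibers sz) (v w : α → R) :
    gf sz (fun a => v a + w a) = gf sz v + gf sz w := by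
  ext n
  simp only [map_add, coeff_gf h, Finset.sum_add_distrib]

lemma gf_const_mul {sz : α → ℕ} (h : FiniteFibers sz) (c : R) (w : α → R) :
    gf sz (fun a => c * w a) = PowerSeries.C c * gf sz w := by
  ext n
  simp only [PowerSeries.coeff_C_mul, coeff_gf h, Finset.mul_sum]

lemma gf_zero (sz : α → ℕ) : gf sz (fun _ => (0 : R)) = 0 := by
  ext n
  simp [gf]

lemma gf_ite_const {sz : α → ℕ} (p : Prop) [Decidable p] (w : α → R) :
    gf sz (fun a => if p then w a else 0) = if p then gf sz w else 0 := by
  split_ifs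
  · rfl
  · exact gf_zero sz

/-- A weight supported at one element. -/
lemma gf_eq_single {sz : α → ℕ} (h : FiniteFibers sz) (a : α) (w : α → R)
    (hw : ∀ b, b ≠ a → w b = 0) : gf sz w = PowerSeries.C (w a) * PowerSeries.X ^ sz a := by
  ext n
  rw [coeff_gf h, PowerSeries.coeff_C_mul, PowerSeries.coeff_X_pow]
  split_ifs with hn
  · rw [mul_one]
    exact Finset.sum_eq_single a (fun b _ hb => hw b hb)
      fun ha => absurd hn.symm (by simpa using ha)
  · rw [mul_zero]
    refine Finset.sum_eq_zero fun b hb => hw b ?_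
    rintro rfl
    exact hn (by simpa using hb : sz b = n).symm

lemma gf_subtype (P : α → Prop) [DecidablePred P] (sz : α → ℕ) (w : α → R) :
    gf (fun a : {a // P a} => sz a) (fun a => w a) = gf sz (fun a => if P a then w a else 0) := by
  ext n
  simp only [gf, PowerSeries.coeff_mk]
  rw [← finsum_mem_univ]
  have := finsum_set_coe_eq_finsum_mem (M := R) {a | P a} (f := fun a => ∑ᶠ (_ : sz a = n), w a)
  rw [finsum_mem_univ]
  refine this.trans (finsum_congr fun a => ?_)
  by_cases hP : P a <;> simp [hP]

lemma gf_sumType {sa : α → ℕ} {sb : β → ℕ} (ha : FiniteFibers sa) (hb : FiniteFibers sb)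
    (w : α ⊕ β → R) :
    gf (Sum.elim sa sb) w = gf sa (fun a => w (Sum.inl a)) + gf sb (fun b => w (Sum.inr b)) := by
  have h : FiniteFibers (Sum.elim sa sb) := fun n => by
    refine (((ha n).image Sum.inl).union ((hb n).image Sum.inr)).subset fun x hx => ?_
    rcases x with a | b
    · exact Or.inl ⟨a, hx, rfl⟩
    · exact Or.inr ⟨b, hx, rfl⟩
  ext n
  rw [map_add, coeff_gf h, coeff_gf ha, coeff_gf hb]
  have : (h n).toFinset = (ha n).toFinset.disjSum (hb n).toFinset := by
    ext x
    rcases x with a | b <;> simp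
  rw [this, Finset.sum_disjSum]

lemma gf_prod {sa : α → ℕ} {sb : β → ℕ} (ha : FiniteFibers sa) (hb : FiniteFibers sb)
    (u : α → R) (v : β → R) :
    gf (fun x : α × β => sa x.1 + sb x.2) (fun x => u x.1 * v x.2) = gf sa u * gf sb v := by
  ext n
  rw [coeff_gf (ha.prod hb), PowerSeries.coeff_mul]
  simp only [coeff_gf ha, coeff_gf hb, Finset.sum_mul_sum, ← Finset.sum_product']
  rw [Finset.sum_sigma']
  refine Finset.sum_bij' (fun x _ => ⟨(sa x.1, sb x.2), x⟩) (fun y _ => y.2) ?_ ?_ ?_ ?_ ?_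
  · intro x hx
    simpa using hx
  · rintro ⟨⟨i, j⟩, x⟩ hx
    simp only [Finset.mem_sigma, Finset.HasAntidiagonal.mem_antidiagonal, Finset.mem_product,
      Set.Finite.mem_toFinset, Set.mem_ofPred_eq] at hx ⊢
    omega
  · intro x _
    rfl
  · rintro ⟨⟨i, j⟩, x⟩ hx
    simp only [Finset.mem_sigma, Finset.HasAntidiagonal.mem_antidiagonal, Finset.mem_product,
      Set.Finite.mem_toFinset, Set.mem_ofPred_eq] at hx
    obtain ⟨-, rfl, rfl⟩ := hx
    rfl
  · intro x _
    rfl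

lemma gf_fin_pi {sz : α → ℕ} (h : FiniteFibers sz) (n : ℕ) (w : Fin n → α → R) :
    gf (fun f : Fin n → α => ∑ i, sz (f i)) (fun f => ∏ i, w i (f i)) = ∏ i, gf sz (w i) := by
  induction n with
  | zero =>
    rw [gf_eq_single h.pi default _ fun b hb => absurd (Subsingleton.elim b default) hb]
    simp
  | succ n ih =>
    rw [Fin.prod_univ_succ, ← ih, ← gf_prod h h.pi, ← gf_equiv (Fin.consEquiv fun _ => α)]
    refine gf_congr (fun x => ?_) (fun x => ?_)
    · simp [Fin.sum_univ_succ, Fin.consEquiv]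
    · simp [Fin.prod_univ_succ, Fin.consEquiv]

lemma gf_pi {ι : Type*} [Fintype ι] {sz : α → ℕ} (h : FiniteFibers sz) (w : ι → α → R) :
    gf (fun f : ι → α => ∑ i, sz (f i)) (fun f => ∏ i, w i (f i)) = ∏ i, gf sz (w i) := by
  let e := Fintype.equivFin ι
  rw [← e.symm.prod_comp, ← gf_fin_pi h, ← gf_equiv (e.arrowCongr (Equiv.refl α))]
  refine gf_congr (fun x => ?_) (fun x => ?_)
  · rw [← e.symm.sum_comp]; simp
  · rw [← e.symm.prod_comp]; simp

lemma gf_fintype_prod {ι : Type*} [Fintype ι] {sz : α → ℕ} (h : FiniteFibers sz)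
    (w : ι → α → R) :
    gf (fun x : ι × α => sz x.2) (fun x => w x.1 x.2) = ∑ i, gf sz (w i) := by
  ext n
  rw [map_sum, coeff_gf h.snd]
  simp only [coeff_gf h, ← Finset.sum_product']
  refine Finset.sum_congr ?_ fun _ _ => rfl
  ext x
  simp

/-- Decomposition of lists into head and tail, where the weight of a list is a sum over states `i`
of the weight of its head times the weight of its tail. -/
lemma gf_list {ι : Type*} [Fintype ι] {s : α → ℕ} {sz : List α → ℕ} (h : FiniteFibers s)
    (hl : FiniteFibers sz) (nil : sz [] = 0) (cons : ∀ x l, sz (x :: l) = s x + sz l)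
    (w : List α → R) (u : ι → α → R) (v : ι → List α → R)
    (hw : ∀ x l, w (x :: l) = ∑ i, u i x * v i l) :
    gf sz w = PowerSeries.C (w []) + ∑ i, gf s (u i) * gf sz (v i) := by
  let e : Unit ⊕ (α × List α) ≃ List α :=
    { toFun := Sum.elim (fun _ => []) fun x => x.1 :: x.2
      invFun := fun l => match l with
        | [] => Sum.inl ()
        | x :: l => Sum.inr (x, l)
      left_inv := by rintro (_ | _) <;> rfl
      right_inv := by rintro (_ | _) <;> rfl }
  have hu : FiniteFibers (fun _ : Unit => 0) := fun n => Set.toFinite _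
  rw [← gf_equiv e]
  have : (fun b => sz (e b)) = Sum.elim (fun _ => 0) fun x => s x.1 + sz x.2 := by
    funext b
    rcases b with b | b
    · exact nil
    · exact cons _ _
  rw [this, gf_sumType hu (h.prod hl)]
  congr 1
  · rw [gf_eq_single hu () _ fun b hb => absurd rfl hb]
    simp [e]
  · rw [Finset.sum_congr rfl fun i _ => (gf_prod h hl (u i) (v i)).symm,
      ← gf_sum_index (h.prod hl)]
    exact gf_congr (fun _ => rfl) fun x => hw _ _

end Semiring

end GeneratingFunction

/-! ### Trees and sectors -/

lemma PlantedTree.leaves_pos : ∀ t : PlantedTree, 0 < t.leaves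
  | .leaf => by simp [PlantedTree.leaves]
  | .node k c => by
    rw [PlantedTree.leaves]
    exact Finset.sum_pos (fun j _ => (c j).leaves_pos) ⟨0, Finset.mem_univ _⟩

lemma PlantedTree.le_leaves_node (k : ℕ) (c : Fin (2 * k + 3) → PlantedTree) :
    2 * k + 3 ≤ (PlantedTree.node k c).leaves := by
  rw [PlantedTree.leaves]
  calc 2 * k + 3 = ∑ _j : Fin (2 * k + 3), 1 := by simp
    _ ≤ _ := Finset.sum_le_sum fun j _ => (c j).leaves_pos

lemma PlantedTree.leaves_child_lt {k : ℕ} (c : Fin (2 * k + 3) → PlantedTree)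
    (j : Fin (2 * k + 3)) : (c j).leaves < (PlantedTree.node k c).leaves := by
  obtain ⟨i, hi⟩ : ∃ i, i ≠ j := exists_ne j
  rw [PlantedTree.leaves]
  have := Finset.add_le_sum (f := fun j => (c j).leaves) (s := Finset.univ)
    (fun _ _ => Nat.zero_le _) (Finset.mem_univ i) (Finset.mem_univ j) hi
  have := (c i).leaves_pos
  omega

lemma finiteFibers_leaves : FiniteFibers PlantedTree.leaves := by
  refine finiteFibers_of_finite_le fun n => ?_
  induction n with
  | zero =>
    refine Set.finite_empty.subset fun t ht => ?_
    have := t.leaves_pos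
    simp only [Set.mem_ofPred_eq] at ht
    omega
  | succ n ih =>
    refine ((Set.finite_singleton PlantedTree.leaf).union
      ((Set.finite_le_nat n).biUnion fun k _ =>
        (Set.Finite.pi' fun _ : Fin (2 * k + 3) => ih).image (PlantedTree.node k))).subset ?_
    rintro (_ | ⟨k, c⟩) ht
    · exact Or.inl rfl
    · refine Or.inr ?_
      simp only [Set.mem_ofPred_eq] at ht
      refine Set.mem_biUnion (x := k) ?_ ⟨c, fun j => ?_, rfl⟩
      · have := PlantedTree.le_leaves_node k c
        simp only [Set.mem_ofPred_eq]
        omega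
      · have := PlantedTree.leaves_child_lt c j
        simp only [Set.mem_ofPred_eq]
        omega

@[simp] lemma sectorLeaves_nil : sectorLeaves [] = 0 := rfl

@[simp] lemma sectorLeaves_cons (t : PlantedTree) (l : List PlantedTree) :
    sectorLeaves (t :: l) = t.leaves + sectorLeaves l := by
  simp [sectorLeaves]

lemma finiteFibers_sectorLeaves : FiniteFibers sectorLeaves :=
  finiteFibers_list finiteFibers_leaves PlantedTree.leaves_pos sectorLeaves_cons

lemma sectorLeaves_pos {l : List PlantedTree} (hl : 0 < l.length) : 0 < sectorLeaves l := by
  cases l with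
  | nil => simp at hl
  | cons t l =>
    have := t.leaves_pos
    rw [sectorLeaves_cons]
    omega

lemma sectorLeaves_ofFn {n : ℕ} (c : Fin n → PlantedTree) :
    sectorLeaves (List.ofFn c) = ∑ j, (c j).leaves := by
  simp [sectorLeaves, List.map_ofFn, List.sum_ofFn]

@[simp] lemma markAfter_zero (a : Bool) : markAfter 0 a = a := rfl

lemma markAfter_succ (k : ℕ) (a : Bool) : markAfter (k + 1) a = markAfter k (!a) := rfl

lemma markAfter_succ' (k : ℕ) (a : Bool) : markAfter (k + 1) a = !(markAfter k a) :=
  Function.iterate_succ_apply' _ _ _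

lemma markAfter_add (j k : ℕ) (a : Bool) : markAfter (j + k) a = markAfter k (markAfter j a) := by
  rw [add_comm]
  exact Function.iterate_add_apply _ _ _ _

lemma markAfter_eq (k : ℕ) (a : Bool) : markAfter k a = if Even k then a else !a := by
  induction k with
  | zero => simp
  | succ k ih =>
    rw [markAfter_succ', ih]
    by_cases hk : Even k <;> simp [hk, Nat.even_add_one]

lemma sectorWeight_ofFn (N₁ N₂ : ℝ) {n : ℕ} (c : Fin n → PlantedTree) (a : Bool) :
    sectorWeight N₁ N₂ a (List.ofFn c) = ∏ j, (c j).weight N₁ N₂ (markAfter j a) := by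
  induction n generalizing a with
  | zero => simp [sectorWeight]
  | succ n ih =>
    rw [List.ofFn_succ, sectorWeight, ih, Fin.prod_univ_succ]
    simp [markAfter_succ]

/-- The share of the channels of the lead `a`. -/
noncomputable def share (N₁ N₂ : ℝ) (a : Bool) : ℝ := channels N₁ N₂ a / (N₁ + N₂)

/-- Generating function of planted trees (in a variable counting leaves) met on mark `a`. -/
noncomputable def treeGF (N₁ N₂ : ℝ) (a : Bool) : PowerSeries ℝ :=
  gf PlantedTree.leaves fun t => t.weight N₁ N₂ a

/-- Generating function of the sectors entered with mark `a` and left with mark `b`. -/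
noncomputable def sectorGF (N₁ N₂ : ℝ) (a b : Bool) : PowerSeries ℝ :=
  gf sectorLeaves fun l => if markAfter l.length a = b then sectorWeight N₁ N₂ a l else 0

open Classical in
/-- Generating function of the sectors entered with mark `a` that can be untied in the lead `a`.
The factor `share ^ ((length + 1) / 2)` is the one by which untying divides the weight. -/
noncomputable def untiedGF (N₁ N₂ : ℝ) (a : Bool) : PowerSeries ℝ :=
  gf sectorLeaves fun l => if SectorUntieable a a l then
    sectorWeight N₁ N₂ a l / share N₁ N₂ a ^ ((l.length + 1) / 2) else 0

/-- A sector is empty or consists of a tree and a sector that is entered with the other mark. -/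
lemma sectorGF_eq (N₁ N₂ : ℝ) (a b : Bool) :
    sectorGF N₁ N₂ a b =
      (if a = b then 1 else 0) + treeGF N₁ N₂ a * sectorGF N₁ N₂ (!a) b := by
  rw [sectorGF, gf_list (ι := Unit) finiteFibers_leaves finiteFibers_sectorLeaves rfl
    sectorLeaves_cons _ (fun _ t => t.weight N₁ N₂ a)
    (fun _ l => if markAfter l.length (!a) = b then sectorWeight N₁ N₂ (!a) l else 0)]
  · congr 1
    · by_cases h : a = b <;> simp [h, sectorWeight]
    · simp [treeGF, sectorGF]
  · intro t l
    simp only [List.length_cons, markAfter_succ, sectorWeight, Finset.univ_unique,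
      Finset.sum_singleton, mul_ite, mul_zero]
    rfl

lemma sectorUntieable_cons_cons {a : Bool} {t t' : PlantedTree} {l : List PlantedTree} :
    SectorUntieable a a (t :: t' :: l) ↔ t = PlantedTree.leaf ∧ SectorUntieable a a l := by
  simp only [SectorUntieable, true_and, List.length_cons]
  constructor
  · rintro ⟨h, h'⟩
    refine ⟨h' 0 (by omega) (by simp), ?_, fun j hj hj' => ?_⟩
    · rw [Nat.odd_iff] at h ⊢; omega
    · exact h' (j + 2) (by omega) (by simpa [Nat.even_add_one] using hj')
  · rintro ⟨rfl, h, h'⟩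
    refine ⟨?_, fun j hj hj' => ?_⟩
    · rw [Nat.odd_iff] at h ⊢; omega
    · match j with
      | 0 => rfl
      | 1 => simp at hj'
      | j + 2 => exact h' j (by omega) (by simpa [Nat.even_add_one] using hj')

lemma sectorUntieable_singleton {a : Bool} {t : PlantedTree} :
    SectorUntieable a a [t] ↔ t = PlantedTree.leaf := by
  simp only [SectorUntieable, true_and, List.length_singleton]
  constructor
  · rintro ⟨-, h⟩
    exact h 0 (by omega) (by simp)
  · rintro rfl
    refine ⟨by simp, fun j hj _ => ?_⟩
    obtain rfl : j = 0 := by omega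
    rfl

lemma not_sectorUntieable_nil {a c : Bool} : ¬ SectorUntieable c a [] := by
  simp [SectorUntieable]

lemma channels_pos {N₁ N₂ : ℝ} (h₁ : 0 < N₁) (h₂ : 0 < N₂) (a : Bool) :
    0 < channels N₁ N₂ a := by
  cases a <;> simpa [channels]

lemma share_pos {N₁ N₂ : ℝ} (h₁ : 0 < N₁) (h₂ : 0 < N₂) (a : Bool) : 0 < share N₁ N₂ a :=
  div_pos (channels_pos h₁ h₂ a) (by positivity)

lemma PlantedTree.weight_leaf (N₁ N₂ : ℝ) (a : Bool) :
    PlantedTree.leaf.weight N₁ N₂ a = share N₁ N₂ a := by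
  rw [PlantedTree.weight, share]; ring

open Classical in
/-- A sector that can be untied is a leaf, followed by nothing or by an arbitrary tree and a sector
that can be untied. The factor `X` is the leaf: its weight is cancelled by its share. -/
lemma untiedGF_eq {N₁ N₂ : ℝ} (h₁ : 0 < N₁) (h₂ : 0 < N₂) (a : Bool) :
    untiedGF N₁ N₂ a =
      PowerSeries.X * (1 + treeGF N₁ N₂ (!a) * untiedGF N₁ N₂ a) := by
  have hp := (share_pos h₁ h₂ a).ne'
  conv_lhs => rw [untiedGF]
  rw [gf_list (ι := Unit) finiteFibers_leaves finiteFibers_sectorLeaves rfl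
    sectorLeaves_cons _ (fun _ t => if t = PlantedTree.leaf then 1 else 0)
    (fun _ l => if SectorUntieable a a (PlantedTree.leaf :: l) then
      sectorWeight N₁ N₂ (!a) l / share N₁ N₂ a ^ (l.length / 2) else 0)]
  · have hX : gf PlantedTree.leaves (fun t => if t = PlantedTree.leaf then (1 : ℝ) else 0)
        = PowerSeries.X := by
      rw [gf_eq_single finiteFibers_leaves PlantedTree.leaf _ fun t ht => by simp [ht]]
      simp [PlantedTree.leaves]
    have hV : gf sectorLeaves (fun l => if SectorUntieable a a (PlantedTree.leaf :: l) then
          sectorWeight N₁ N₂ (!a) l / share N₁ N₂ a ^ (l.length / 2) else 0) =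
        1 + treeGF N₁ N₂ (!a) * untiedGF N₁ N₂ a := by
      rw [gf_list (ι := Unit) finiteFibers_leaves finiteFibers_sectorLeaves rfl
        sectorLeaves_cons _ (fun _ t => t.weight N₁ N₂ (!a))
        (fun _ l => if SectorUntieable a a l then
          sectorWeight N₁ N₂ a l / share N₁ N₂ a ^ ((l.length + 1) / 2) else 0)]
      · simp [sectorUntieable_singleton, sectorWeight, treeGF, untiedGF]
      · intro t l
        simp [sectorUntieable_cons_cons, sectorWeight, mul_div_assoc]
    simp only [hX, hV, not_sectorUntieable_nil, if_false, map_zero, zero_add, Finset.univ_unique,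
      Finset.sum_singleton]
  · intro t l
    by_cases ht : t = PlantedTree.leaf
    · subst ht
      have hlen : (l.length + 1 + 1) / 2 = l.length / 2 + 1 := by omega
      simp only [sectorWeight, List.length_cons, hlen, PlantedTree.weight_leaf,
        Finset.univ_unique, Finset.sum_singleton, if_true, one_mul]
      refine if_congr Iff.rfl ?_ rfl
      rw [pow_succ]
      field_simp
    · have : ¬ SectorUntieable a a (t :: l) := fun h => ht (h.2.2 0 (by simp) (by simp))
      simp [ht, this]

/-- A planted tree is a leaf or a list of an odd number, at least three, of planted trees. -/
noncomputable def plantedTreeEquiv :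
    Unit ⊕ {l : List PlantedTree // Odd l.length ∧ 3 ≤ l.length} ≃ PlantedTree where
  toFun := Sum.elim (fun _ => .leaf) fun l => .node ((l.1.length - 3) / 2) fun j =>
    l.1[j.1]'(by have := Nat.odd_iff.1 l.2.1; have := l.2.2; have := j.2; omega)
  invFun
    | .leaf => .inl ()
    | .node k c => .inr ⟨List.ofFn c, by simp [parity_simps], by simp⟩
  left_inv := by
    rintro (_ | ⟨l, hl, hl'⟩)
    · rfl
    · simp only [Sum.elim_inr, Sum.inr.injEq, Subtype.mk.injEq]
      refine List.ext_getElem ?_ fun i _ _ => ?_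
      · rw [List.length_ofFn]
        have := Nat.odd_iff.1 hl
        omega
      · simp only [List.getElem_ofFn]
  right_inv := by
    rintro (_ | ⟨k, c⟩)
    · rfl
    · have aux : ∀ (k' : ℕ) (hk : k' = k) (c' : Fin (2 * k' + 3) → PlantedTree),
          (∀ j, c' j = c (Fin.cast (by rw [hk]) j)) →
          PlantedTree.node k' c' = PlantedTree.node k c := by
        rintro k' rfl c' hc
        congr 1
        funext j
        exact hc j
      refine aux _ (by simp) _ fun j => ?_
      simp only [List.getElem_ofFn]
      rfl

open Classical in
/-- The vertex weight in terms of shares: in the lead `c`, untying a vertex of degree `2 k` replaces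
`k` leaves `c`, which carry the factor `share c` each, by a single sum over the channels. -/
lemma vertexWeight_eq {N₁ N₂ : ℝ} (h₁ : 0 < N₁) (h₂ : 0 < N₂) (k : ℕ) (u : Bool → Prop) :
    vertexWeight N₁ N₂ k u = -(N₁ + N₂) + ∑ c : Bool,
      if u c then channels N₁ N₂ c / share N₁ N₂ c ^ k else 0 := by
  rw [vertexWeight]
  congr 1
  refine Finset.sum_congr rfl fun c _ => if_congr Iff.rfl ?_ rfl
  have := (channels_pos h₁ h₂ c).ne'
  have : N₁ + N₂ ≠ 0 := by positivity
  rw [share, div_pow]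
  field_simp

/-- The recursion for planted trees. The branches of a vertex form a sector of odd length at least
three, whose weight is called `w` in the proof: `treeGF` is the leaf plus the sum of `w` over these
sectors. The sum of `w` over the sectors of length one is the leaf minus `treeGF`, so the sum over
all sectors of odd length vanishes. -/
lemma sectorGF_not_eq {N₁ N₂ : ℝ} (h₁ : 0 < N₁) (h₂ : 0 < N₂) (a : Bool) :
    sectorGF N₁ N₂ a (!a) = PowerSeries.C (share N₁ N₂ a) * untiedGF N₁ N₂ a := by
  classical
  have hN : N₁ + N₂ ≠ 0 := by positivity
  have hfib := finiteFibers_sectorLeaves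
  have hu : FiniteFibers (fun _ : Unit => 1) := fun n => Set.toFinite _
  let w : List PlantedTree → ℝ := fun l =>
    -(if markAfter l.length a = !a then sectorWeight N₁ N₂ a l else 0) + share N₁ N₂ a *
      (if SectorUntieable a a l then
        sectorWeight N₁ N₂ a l / share N₁ N₂ a ^ ((l.length + 1) / 2) else 0)
  have hw : gf sectorLeaves w =
      -sectorGF N₁ N₂ a (!a) + PowerSeries.C (share N₁ N₂ a) * untiedGF N₁ N₂ a := by
    rw [gf_add hfib, gf_const_mul hfib]
    have := gf_const_mul hfib (-1 : ℝ)
      (fun l => if markAfter l.length a = !a then sectorWeight N₁ N₂ a l else 0)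
    simp only [neg_mul, one_mul, map_neg, map_one] at this
    rw [this]
    rfl
  -- decomposition of a tree at its root
  have htree : treeGF N₁ N₂ a = PowerSeries.C (share N₁ N₂ a) * PowerSeries.X +
      gf sectorLeaves (fun l => if Odd l.length ∧ 3 ≤ l.length then w l else 0) := by
    rw [treeGF, ← gf_equiv plantedTreeEquiv,
      ← gf_subtype (fun l : List PlantedTree => Odd l.length ∧ 3 ≤ l.length),
      gf_congr (sz' := Sum.elim (fun _ => 1) fun l => sectorLeaves l.1)
        (w' := fun x => (plantedTreeEquiv x).weight N₁ N₂ a) ?_ fun _ => rfl,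
      gf_sumType hu (hfib.of_injective _ Subtype.val_injective fun _ => rfl)]
    · congr 1
      · rw [gf_eq_single hu () _ fun b hb => absurd rfl hb]
        simp [plantedTreeEquiv, PlantedTree.weight_leaf]
      · refine gf_congr (fun _ => rfl) ?_
        rintro ⟨l, hl⟩
        obtain ⟨t, ht⟩ : ∃ t, plantedTreeEquiv.symm t = Sum.inr ⟨l, hl⟩ :=
          ⟨_, Equiv.symm_apply_apply _ _⟩
        rw [← ht, Equiv.apply_symm_apply]
        cases t with
        | leaf => simp [plantedTreeEquiv] at ht
        | node k c =>
          simp only [plantedTreeEquiv, Equiv.coe_fn_symm_mk, Sum.inr.injEq, Subtype.mk.injEq] at ht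
          subst ht
          rw [PlantedTree.weight, vertexWeight_eq h₁ h₂, ← sectorWeight_ofFn]
          have hk : (2 * k + 3 + 1) / 2 = k + 2 := by omega
          have hodd : ¬ Even (2 * k + 3) := by simp [parity_simps]
          rw [Finset.sum_eq_single a (fun c' _ hc' => if_neg fun h => hc' h.1.symm) (by simp)]
          simp only [w, List.length_ofFn, hk, markAfter_eq, hodd, if_false, if_true]
          split_ifs
          · rw [share]; field_simp
          · field_simp; ring
    · rintro (_ | ⟨l, hl⟩)
      · simp [plantedTreeEquiv, PlantedTree.leaves]
      · simp only [plantedTreeEquiv, Equiv.coe_fn_mk, Sum.elim_inr]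
        rw [PlantedTree.leaves, ← sectorLeaves_ofFn]
        congr 1
        refine List.ext_getElem ?_ fun i _ _ => ?_
        · rw [List.length_ofFn]
          have := Nat.odd_iff.1 hl.1
          omega
        · simp only [List.getElem_ofFn]
  -- sectors that consist of one tree
  have hone : gf sectorLeaves (fun l => if l.length = 1 then w l else 0) =
      -treeGF N₁ N₂ a + PowerSeries.C (share N₁ N₂ a) * PowerSeries.X := by
    have hp := (share_pos h₁ h₂ a).ne'
    rw [gf_list (ι := Unit) finiteFibers_leaves hfib rfl sectorLeaves_cons _
      (fun _ t => -1 * t.weight N₁ N₂ a + if t = PlantedTree.leaf then share N₁ N₂ a else 0)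
      (fun _ l => if l = [] then 1 else 0)]
    · have hnil : gf sectorLeaves (fun l => if l = [] then (1 : ℝ) else 0) = 1 := by
        rw [gf_eq_single hfib [] _ fun t ht => by simp [ht]]
        simp
      simp only [List.length_nil, hnil]
      rw [Finset.univ_unique, Finset.sum_singleton, gf_add finiteFibers_leaves,
        gf_const_mul finiteFibers_leaves, gf_eq_single finiteFibers_leaves PlantedTree.leaf
          (fun t => if t = PlantedTree.leaf then share N₁ N₂ a else 0) fun t ht => by simp [ht]]
      simp [PlantedTree.leaves, treeGF]
    · intro t l
      cases l with
      | nil =>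
        simp only [w, List.length_singleton, if_true, sectorUntieable_singleton, sectorWeight]
        by_cases ht : t = PlantedTree.leaf
        · subst ht
          simp [PlantedTree.weight_leaf, hp, markAfter_eq]
        · simp [ht, markAfter_eq]
      | cons t' l => simp
  -- `w` vanishes on sectors of even length
  have hsplit : gf sectorLeaves w = gf sectorLeaves (fun l => if l.length = 1 then w l else 0) +
      gf sectorLeaves (fun l => if Odd l.length ∧ 3 ≤ l.length then w l else 0) := by
    rw [← gf_add hfib]
    refine gf_congr (fun _ => rfl) fun l => ?_
    by_cases h1 : l.length = 1
    · simp [h1]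
    · by_cases hodd : Odd l.length
      · have : 3 ≤ l.length := by rw [Nat.odd_iff] at hodd; omega
        simp [h1, hodd, this]
      · have h0 : ¬ SectorUntieable a a l := fun h => hodd h.2.1
        simp [h1, hodd, w, h0, markAfter_eq]
  linear_combination -hw.symm.trans (hsplit.trans (congrArg₂ (· + ·) hone
    (eq_sub_of_add_eq' htree.symm)))

/-! ### Nodes and edges -/

/-- Nodes that are vertices of even degree greater than two. -/
abbrev ValidNode : Type := {p : EdgeNode // p.Valid}

/-- A node is a pair of sectors, one on each side of the edge. -/
def edgeNodeEquiv : List PlantedTree × List PlantedTree ≃ EdgeNode where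
  toFun x := ⟨x.1, x.2⟩
  invFun p := (p.fst, p.snd)

lemma finiteFibers_edgeNode : FiniteFibers EdgeNode.leaves :=
  (finiteFibers_sectorLeaves.prod finiteFibers_sectorLeaves).of_injective edgeNodeEquiv.symm
    edgeNodeEquiv.symm.injective fun _ => rfl

lemma finiteFibers_validNode : FiniteFibers (fun p : ValidNode => p.1.leaves) :=
  finiteFibers_edgeNode.of_injective _ Subtype.val_injective fun _ => rfl

lemma validNode_leaves_pos (p : ValidNode) : 0 < p.1.leaves := by
  have h := p.2.2
  rw [EdgeNode.leaves]
  rcases Nat.eq_zero_or_pos p.1.fst.length with h0 | h0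
  · have := sectorLeaves_pos (l := p.1.snd) (by omega)
    omega
  · have := sectorLeaves_pos h0
    omega

/-- Number of leaves on the nodes of an edge. -/
def nodesLeaves (l : List ValidNode) : ℕ := (l.map fun p => p.1.leaves).sum

lemma nodesLeaves_cons (p : ValidNode) (l : List ValidNode) :
    nodesLeaves (p :: l) = p.1.leaves + nodesLeaves l := by
  simp [nodesLeaves]

lemma finiteFibers_nodesLeaves : FiniteFibers nodesLeaves :=
  finiteFibers_list finiteFibers_validNode validNode_leaves_pos nodesLeaves_cons

/-- Generating function of the nodes on an edge where the mark of the first side changes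
from `a` to `b`. -/
noncomputable def nodeGF (N₁ N₂ : ℝ) (u a b : Bool) : PowerSeries ℝ :=
  gf (fun p : ValidNode => p.1.leaves) fun p =>
    if markAfter p.1.fst.length a = b then p.1.weight N₁ N₂ u a else 0

/-- Generating function of the edges with nodes where the mark of the first side changes
from `a` to `b`. -/
noncomputable def edgeGF (N₁ N₂ : ℝ) (u a b : Bool) : PowerSeries ℝ :=
  gf nodesLeaves fun l =>
    if markAfter (l.map fun p => p.1.fst.length).sum a = b then
      edgeWeight N₁ N₂ u a (l.map Subtype.val) else 0

/-- An edge has no node, or a first node, after which the mark is `c`, and a remaining edge. -/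
lemma edgeGF_eq (N₁ N₂ : ℝ) (u a b : Bool) :
    edgeGF N₁ N₂ u a b = PowerSeries.C (N₁ + N₂)⁻¹ *
      ((if a = b then 1 else 0) + ∑ c, nodeGF N₁ N₂ u a c * edgeGF N₁ N₂ u c b) := by
  conv_lhs => rw [edgeGF]
  rw [gf_list finiteFibers_validNode finiteFibers_nodesLeaves rfl nodesLeaves_cons _
    (fun (c : Bool) p => (N₁ + N₂)⁻¹ *
      if markAfter p.1.fst.length a = c then p.1.weight N₁ N₂ u a else 0)
    (fun c l => if markAfter (l.map fun p => p.1.fst.length).sum c = b then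
      edgeWeight N₁ N₂ u c (l.map Subtype.val) else 0)]
  · simp only [gf_const_mul finiteFibers_validNode, mul_add, Finset.mul_sum, ← mul_assoc]
    congr 1
    by_cases h : a = b <;> simp [h, edgeWeight]
  · intro p l
    rw [Finset.sum_eq_single (markAfter p.1.fst.length a) (fun c _ hc => by simp [hc.symm])
      (by simp)]
    simp [edgeWeight, markAfter_add]

/-- A sum over nodes is a sum over the pairs of their sectors, if the weight is extended by zero to
the pairs that are excluded. -/
lemma nodeGF_eq_gf_prod {N₁ N₂ : ℝ} (u a b : Bool) (w : List PlantedTree → List PlantedTree → ℝ)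
    (hw : ∀ l l', (⟨l, l'⟩ : EdgeNode).Valid → markAfter l.length a = b →
      (⟨l, l'⟩ : EdgeNode).weight N₁ N₂ u a = w l l')
    (hw' : ∀ l l', ¬ ((⟨l, l'⟩ : EdgeNode).Valid ∧ markAfter l.length a = b) → w l l' = 0) :
    nodeGF N₁ N₂ u a b =
      gf (fun x : List PlantedTree × List PlantedTree => sectorLeaves x.1 + sectorLeaves x.2)
        fun x => w x.1 x.2 := by
  classical
  rw [nodeGF, gf_subtype _ EdgeNode.leaves
    (fun p => if markAfter p.fst.length a = b then p.weight N₁ N₂ u a else 0),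
    ← gf_equiv edgeNodeEquiv]
  refine gf_congr (fun _ => rfl) fun ⟨l, l'⟩ => ?_
  rw [← ite_and]
  split_ifs with h
  · exact hw l l' h.1 h.2
  · exact (hw' l l' h).symm

lemma EdgeNode.weight_eq_of_not {N₁ N₂ : ℝ} {u a : Bool} {p : EdgeNode}
    (h : ∀ c, ¬ (SectorUntieable c a p.fst ∧ SectorUntieable c (p.sndMark u a) p.snd)) :
    p.weight N₁ N₂ u a = -(N₁ + N₂) * (sectorWeight N₁ N₂ a p.fst *
      sectorWeight N₁ N₂ (p.sndMark u a) p.snd) := by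
  simp only [EdgeNode.weight, vertexWeight, h, if_false, Finset.sum_const_zero, add_zero, mul_assoc]

lemma markAfter_eq_self {k : ℕ} {a : Bool} : markAfter k a = a ↔ Even k := by
  rw [markAfter_eq]; split_ifs with h <;> simp [h]

lemma markAfter_eq_not {k : ℕ} {a : Bool} : markAfter k a = !a ↔ Odd k := by
  rw [markAfter_eq]; split_ifs with h <;> simp [h, ← Nat.not_even_iff_odd]

/-- A node with an even number of trees on both sides cannot be untied. The `1` subtracted accounts
for the pair of empty sectors, which is no node. -/
lemma nodeGF_self (N₁ N₂ : ℝ) (u a : Bool) :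
    nodeGF N₁ N₂ u a a =
      -PowerSeries.C (N₁ + N₂) * (sectorGF N₁ N₂ a a * sectorGF N₁ N₂ (!a) (!a) - 1) := by
  have hfib := finiteFibers_sectorLeaves
  have h2 := hfib.prod hfib
  rw [nodeGF_eq_gf_prod u a a (fun l l' => -(N₁ + N₂) *
    ((if markAfter l.length a = a then sectorWeight N₁ N₂ a l else 0) *
      (if markAfter l'.length (!a) = !a then sectorWeight N₁ N₂ (!a) l' else 0)) + (N₁ + N₂) *
    ((if l = [] then 1 else 0) * (if l' = [] then 1 else 0)))]
  · have hnil : gf sectorLeaves (fun l => if l = [] then (1 : ℝ) else 0) = 1 := by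
      rw [gf_eq_single hfib [] _ fun t ht => by simp [ht]]
      simp
    rw [gf_add h2, gf_const_mul h2, gf_const_mul h2, gf_prod hfib hfib
      (fun l => if markAfter l.length a = a then sectorWeight N₁ N₂ a l else 0)
      (fun l' => if markAfter l'.length (!a) = !a then sectorWeight N₁ N₂ (!a) l' else 0),
      gf_prod hfib hfib (fun l => if l = [] then (1 : ℝ) else 0)
      (fun l => if l = [] then (1 : ℝ) else 0), hnil]
    simp only [map_neg, sectorGF]
    ring
  · intro l l' hv h
    have hl : Even l.length := markAfter_eq_self.1 h
    have hl' : Even l'.length := (Nat.even_add.1 hv.1).1 hl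
    have hne : ¬ (l = [] ∧ l' = []) := by
      rintro ⟨rfl, rfl⟩
      simpa using hv.2
    rw [EdgeNode.weight_eq_of_not fun c hc => Nat.not_even_iff_odd.2 hc.1.2.1 hl]
    have : (⟨l, l'⟩ : EdgeNode).sndMark u a = !a := by
      cases u <;> simp [EdgeNode.sndMark, markAfter_eq_self.2 hl]
    rw [this]
    rw [ite_zero_mul_ite_zero, ite_zero_mul_ite_zero, if_neg hne]
    simp [markAfter_eq_self, hl, hl']
  · intro l l' h
    rw [ite_zero_mul_ite_zero, ite_zero_mul_ite_zero]
    by_cases h0 : l = [] ∧ l' = []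
    · obtain ⟨rfl, rfl⟩ := h0
      simp [sectorWeight]
    · have : ¬ (markAfter l.length a = a ∧ markAfter l'.length (!a) = !a) := by
        rintro ⟨h1, h2⟩
        refine h ⟨⟨(markAfter_eq_self.1 h1).add (markAfter_eq_self.1 h2), ?_⟩, h1⟩
        by_contra h3
        simp only [add_pos_iff, List.length_pos_iff, not_or, not_not] at h3
        exact h0 h3
      simp [h0, this]

/-- On a unitary edge both sectors of a node with odd numbers of trees are entered with the same
mark, and the node can be untied if both sectors can. -/
lemma nodeGF_unitary_not {N₁ N₂ : ℝ} (h₁ : 0 < N₁) (h₂ : 0 < N₂) (a : Bool) :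
    nodeGF N₁ N₂ true a (!a) = -PowerSeries.C (N₁ + N₂) * sectorGF N₁ N₂ a (!a) ^ 2 +
      PowerSeries.C (channels N₁ N₂ a) * untiedGF N₁ N₂ a ^ 2 := by
  classical
  have hfib := finiteFibers_sectorLeaves
  have h2 := hfib.prod hfib
  let v : List PlantedTree → ℝ := fun l =>
    if markAfter l.length a = !a then sectorWeight N₁ N₂ a l else 0
  let w : List PlantedTree → ℝ := fun l => if SectorUntieable a a l then
    sectorWeight N₁ N₂ a l / share N₁ N₂ a ^ ((l.length + 1) / 2) else 0
  rw [nodeGF_eq_gf_prod true a (!a) (fun l l' =>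
    -(N₁ + N₂) * (v l * v l') + channels N₁ N₂ a * (w l * w l'))]
  · rw [gf_add h2, gf_const_mul h2, gf_const_mul h2, gf_prod hfib hfib v v, gf_prod hfib hfib w w]
    simp only [map_neg, sectorGF, untiedGF, v, w]
    ring
  · intro l l' hv h
    have hl : Odd l.length := markAfter_eq_not.1 h
    have hl' : Odd l'.length := (Nat.even_add'.1 hv.1).1 hl
    have hm : (⟨l, l'⟩ : EdgeNode).sndMark true a = a := by simp [EdgeNode.sndMark, h]
    have hk : (l.length + l'.length + 2) / 2 = (l.length + 1) / 2 + (l'.length + 1) / 2 := by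
      rw [Nat.odd_iff] at hl hl'
      omega
    rw [EdgeNode.weight, vertexWeight_eq h₁ h₂, hm, hk]
    rw [Fintype.sum_eq_single a]
    · simp only [v, w, markAfter_eq_not, hl, hl', if_true]
      by_cases hu : SectorUntieable a a l <;> by_cases hu' : SectorUntieable a a l' <;>
        simp only [hu, hu', and_self, and_false, false_and, if_true, if_false, pow_add] <;>
        ring
    · exact fun c' hc' => if_neg fun hu => hc' hu.1.1.symm
  · intro l l' h
    by_cases hl : Odd l.length
    · have hl' : ¬ Odd l'.length := fun hl' => h ⟨⟨hl.add_odd hl', by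
        have := hl.pos
        show 0 < l.length + l'.length
        omega⟩, markAfter_eq_not.2 hl⟩
      have hw : w l' = 0 := if_neg fun hu => hl' hu.2.1
      have hv : v l' = 0 := if_neg fun hu => hl' (markAfter_eq_not.1 hu)
      simp [hw, hv]
    · have hw : w l = 0 := if_neg fun hu => hl hu.2.1
      have hv : v l = 0 := if_neg fun hu => hl (markAfter_eq_not.1 hu)
      simp [hw, hv]

/-- On an orthogonal edge the two sectors of a node are entered with different marks, so it cannot
be untied. -/
lemma nodeGF_orthogonal_not (N₁ N₂ : ℝ) (a : Bool) :
    nodeGF N₁ N₂ false a (!a) =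
      -PowerSeries.C (N₁ + N₂) * (sectorGF N₁ N₂ a (!a) * sectorGF N₁ N₂ (!a) a) := by
  have hfib := finiteFibers_sectorLeaves
  have h2 := hfib.prod hfib
  let v : Bool → List PlantedTree → ℝ := fun a l =>
    if markAfter l.length a = !a then sectorWeight N₁ N₂ a l else 0
  have hS : sectorGF N₁ N₂ (!a) a = gf sectorLeaves (v (!a)) := by
    simp [sectorGF, v]
  rw [nodeGF_eq_gf_prod false a (!a) (fun l l' => -(N₁ + N₂) * (v a l * v (!a) l')), hS]
  · rw [gf_const_mul h2, gf_prod hfib hfib (v a) (v !a)]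
    simp only [map_neg, sectorGF, v]
  · intro l l' hv h
    have hl : Odd l.length := markAfter_eq_not.1 h
    have hl' : Odd l'.length := (Nat.even_add'.1 hv.1).1 hl
    have hm : (⟨l, l'⟩ : EdgeNode).sndMark false a = !a := by simp [EdgeNode.sndMark]
    rw [EdgeNode.weight_eq_of_not, hm]
    · simp only [v, markAfter_eq_not, hl, hl', if_true]
    · rintro c ⟨hc, hc'⟩
      rw [hm] at hc'
      exact Bool.not_ne_self a (hc'.1.trans hc.1.symm)
  · intro l l' h
    by_cases hl : Odd l.length
    · have hl' : ¬ Odd l'.length := fun hl' => h ⟨⟨hl.add_odd hl', by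
        have := hl.pos
        show 0 < l.length + l'.length
        omega⟩, markAfter_eq_not.2 hl⟩
      have hv : v (!a) l' = 0 := if_neg fun hu => hl' (markAfter_eq_not.1 hu)
      simp [hv]
    · have hv : v a l = 0 := if_neg fun hu => hl (markAfter_eq_not.1 hu)
      simp [hv]

/-! ### Vertices of a base structure -/

namespace BaseStructure

variable {m : ℕ} (B : BaseStructure m)

/-- The other oriented edge-side that leaves the vertex at the same corner. It exchanges the two
cycles of `ν` that describe a vertex, and reverses their direction. -/
def cornerSwap (x : Side m) : Side m := face m (rev x)

lemma rev_rev (x : Side m) : rev (rev x) = x := by simp [rev]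

lemma rev_face_rev (x : Side m) : rev (face m (rev x)) = (face m).symm x := by
  rcases x with ⟨z, _ | _⟩ <;> simp [rev, face]

lemma cornerSwap_true (z : Fin (2 * m)) :
    cornerSwap (z, true) = (finRotate (2 * m) z, false) := by
  simp [cornerSwap, rev, face]

lemma cornerSwap_cornerSwap (x : Side m) : cornerSwap (cornerSwap x) = x := by
  rw [cornerSwap, cornerSwap, rev_face_rev, Equiv.apply_symm_apply]

lemma cornerSwap_ne (x : Side m) : cornerSwap x ≠ x := by
  rcases x with ⟨z, _ | _⟩ <;> simp [cornerSwap, rev, face]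

lemma ν_cornerSwap_ν (x : Side m) : B.ν (cornerSwap (B.ν x)) = cornerSwap x := by
  simp only [ν, Equiv.Perm.mul_apply, cornerSwap]
  have h : rev (face m (B.ε x)) = (face m).symm (B.ε (rev x)) := by
    rw [← rev_face_rev, ← B.comm_rev, rev_rev]
  rw [h, Equiv.apply_symm_apply, B.invol]

lemma cornerSwap_ν (x : Side m) : cornerSwap (B.ν x) = B.ν⁻¹ (cornerSwap x) := by
  rw [← B.ν_cornerSwap_ν x]; simp

lemma cornerSwap_ν_pow (k : ℕ) (x : Side m) :
    cornerSwap ((B.ν ^ k) x) = (B.ν⁻¹ ^ k) (cornerSwap x) := by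
  induction k with
  | zero => rfl
  | succ k ih => rw [pow_succ', Equiv.Perm.mul_apply, cornerSwap_ν, ih, pow_succ',
      Equiv.Perm.mul_apply]

lemma sameCycle_cornerSwap {x y : Side m} (h : B.ν.SameCycle x y) :
    B.ν.SameCycle (cornerSwap x) (cornerSwap y) := by
  obtain ⟨k, -, rfl⟩ := h.exists_pow_eq'
  rw [cornerSwap_ν_pow]
  exact ⟨-k, by simp⟩

/-- The two cycles of `ν` that describe a vertex are different. -/
lemma not_sameCycle_cornerSwap (x : Side m) : ¬ B.ν.SameCycle x (cornerSwap x) := by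
  intro h
  obtain ⟨k, -, hk⟩ := h.exists_pow_eq'
  -- halfway between a side and its swap there is a side that the swap fixes or moves by one step
  obtain ⟨j, rfl | rfl⟩ := Nat.even_or_odd' k
  · refine cornerSwap_ne ((B.ν ^ j) x) ?_
    rw [cornerSwap_ν_pow, ← hk, two_mul, pow_add, Equiv.Perm.mul_apply, inv_pow]
    simp
  · have : cornerSwap ((B.ν ^ j) x) = B.ν ((B.ν ^ j) x) := by
      rw [cornerSwap_ν_pow, ← hk, two_mul, add_assoc, pow_add, Equiv.Perm.mul_apply, inv_pow,
        ← Equiv.Perm.mul_apply B.ν, ← pow_succ']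
      simp
    simp only [cornerSwap, ν, Equiv.Perm.mul_apply, EmbeddingLike.apply_eq_iff_eq] at this
    exact B.ne_rev _ this.symm

lemma mem_cornersAt {z w : Fin (2 * m)} : w ∈ B.cornersAt z ↔
    B.ν.SameCycle (z, true) (w, true) ∨ B.ν.SameCycle (z, true) (cornerSwap (w, true)) := by
  simp [cornersAt, cornerSwap_true]

lemma self_mem_cornersAt (z : Fin (2 * m)) : z ∈ B.cornersAt z :=
  B.mem_cornersAt.2 (Or.inl (Equiv.Perm.SameCycle.refl _ _))

/-- Lying at the same vertex is an equivalence relation of corners. -/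
lemma cornersAt_eq_of_mem {z w : Fin (2 * m)} (h : w ∈ B.cornersAt z) :
    B.cornersAt w = B.cornersAt z := by
  ext y
  simp only [mem_cornersAt] at *
  rcases h with h | h
  · exact or_congr ⟨h.trans, h.symm.trans⟩ ⟨h.trans, h.symm.trans⟩
  · have h' := B.sameCycle_cornerSwap h
    rw [cornerSwap_cornerSwap] at h'
    rw [or_comm]
    refine or_congr ⟨fun g => h.trans ?_, fun g => h'.symm.trans ?_⟩
      ⟨fun g => h.trans ?_, fun g => h'.symm.trans ?_⟩
    · simpa only [cornerSwap_cornerSwap] using B.sameCycle_cornerSwap g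
    · simpa only [cornerSwap_cornerSwap] using B.sameCycle_cornerSwap g
    · simpa only [cornerSwap_cornerSwap] using B.sameCycle_cornerSwap g
    · simpa only [cornerSwap_cornerSwap] using B.sameCycle_cornerSwap g

lemma mem_vertices {v : Finset (Fin (2 * m))} : v ∈ B.vertices ↔ ∃ z, B.cornersAt z = v := by
  simp [vertices]

lemma filter_cornersAt_eq {v : Finset (Fin (2 * m))} (hv : v ∈ B.vertices) :
    (Finset.univ.filter fun z => B.cornersAt z = v) = v := by
  obtain ⟨y, rfl⟩ := B.mem_vertices.1 hv
  ext z
  simp only [Finset.mem_filter, Finset.mem_univ, true_and]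
  exact ⟨fun h => h ▸ B.self_mem_cornersAt z, B.cornersAt_eq_of_mem⟩

/-- Every corner lies at exactly one vertex. -/
lemma prod_vertices_prod {M : Type*} [CommMonoid M] (f : Fin (2 * m) → M) :
    ∏ v ∈ B.vertices, ∏ z ∈ v, f z = ∏ z, f z := by
  rw [← Finset.prod_fiberwise_of_maps_to (s := Finset.univ) (t := B.vertices) (g := B.cornersAt)
    fun z _ => B.mem_vertices.2 ⟨z, rfl⟩]
  exact Finset.prod_congr rfl fun v hv => by rw [B.filter_cornersAt_eq hv]

lemma sum_card_vertices : ∑ v ∈ B.vertices, v.card = 2 * m := by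
  have h := Finset.card_eq_sum_card_fiberwise (s := Finset.univ) (t := B.vertices)
    (f := B.cornersAt) fun z _ => B.mem_vertices.2 ⟨z, rfl⟩
  rw [Finset.card_univ, Fintype.card_fin] at h
  refine Eq.trans ?_ h.symm
  exact Finset.sum_congr rfl fun v hv => by rw [B.filter_cornersAt_eq hv]

/-- Expansion of a product over the vertices of sums over states of products over their corners. -/
lemma prod_vertices_sum {R K : Type*} [CommSemiring R] [Fintype K] [DecidableEq K] (c : K → R)
    (f : Fin (2 * m) → K → R) :
    ∏ v ∈ B.vertices, ∑ κ, c κ * ∏ z ∈ v, f z κ =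
      ∑ κ : B.vertices → K, (∏ v, c (κ v)) *
        ∏ z, f z (κ ⟨B.cornersAt z, B.mem_vertices.2 ⟨z, rfl⟩⟩) := by
  rw [← Finset.prod_coe_sort, Finset.prod_univ_sum, Fintype.piFinset_univ]
  refine Finset.sum_congr rfl fun κ _ => ?_
  rw [Finset.prod_mul_distrib]
  congr 1
  rw [← B.prod_vertices_prod, ← Finset.prod_coe_sort B.vertices fun v =>
    ∏ z ∈ v, f z (κ ⟨B.cornersAt z, B.mem_vertices.2 ⟨z, rfl⟩⟩)]
  refine Fintype.prod_congr _ _ fun v => ?_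
  refine Finset.prod_congr rfl fun z hz => ?_
  have : B.cornersAt z = v := by
    rw [← B.filter_cornersAt_eq v.2] at hz
    simpa using hz
  simp only [this]

end BaseStructure

/-! ### The generating function of the graftings on a base structure -/

section Grafting

variable {m : ℕ} (B : BaseStructure m)

/-- The data of a grafting, before the conditions on the marks are imposed. -/
abbrev GraftingData : Type :=
  (Side m → Bool) × ((Fin (2 * m) → List PlantedTree) × (B.Edge → List ValidNode))

/-- The marks are opposite on the two sides of every edge end, and change along corners and edges as
the trees planted there require. -/
def GraftingData.IsGrafting {B : BaseStructure m} (x : GraftingData B) : Prop :=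
  (∀ y, x.1 (rev (B.ε y)) = !(x.1 y)) ∧
  (∀ z, markAfter (x.2.1 z).length (x.1 (z, true)) = x.1 (finRotate (2 * m) z, false)) ∧
  (∀ e : B.Edge, markAfter ((x.2.2 e).map fun p => p.1.fst.length).sum (x.1 (e.1, false)) =
    x.1 (e.1, true))

/-- Number of leaves; it does not depend on the marks. -/
def GraftingData.leaves {B : BaseStructure m}
    (x : (Fin (2 * m) → List PlantedTree) × (B.Edge → List ValidNode)) : ℕ :=
  ∑ z, sectorLeaves (x.1 z) + ∑ e, nodesLeaves (x.2 e)

/-- Graftings are the data that satisfy the conditions on the marks. -/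
noncomputable def graftingEquiv : {x : GraftingData B // x.IsGrafting} ≃ Grafting B :=
  Equiv.ofBijective (fun x =>
    { mark := x.1.1
      mark_opp := x.2.1
      corner := x.1.2.1
      corner_mark := fun z => (x.2.2.1 z).symm
      edge := fun e => (x.1.2.2 e).map Subtype.val
      edge_valid := fun e p hp => by
        obtain ⟨q, -, rfl⟩ := List.mem_map.1 hp
        exact q.2
      edge_mark := fun e => by rw [← x.2.2.2 e, List.map_map]; rfl }) <| by
    constructor
    · rintro ⟨⟨a, b, c⟩, hx⟩ ⟨⟨a', b', c'⟩, hx'⟩ h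
      simp only [Grafting.mk.injEq] at h
      obtain ⟨rfl, rfl, h⟩ := h
      obtain rfl : c = c' := funext fun e =>
        List.map_injective_iff.2 Subtype.val_injective (congrFun h e)
      rfl
    · rintro ⟨a, ha, b, hb, c, hc, hc'⟩
      have : ∀ e, ∃ l : List ValidNode, l.map Subtype.val = c e := fun e =>
        ⟨(c e).pmap Subtype.mk (hc e), by simp [List.map_pmap]⟩
      choose l hl using this
      refine ⟨⟨(a, b, l), ha, fun z => (hb z).symm, fun e => ?_⟩, ?_⟩
      · simp only [hc' e, ← hl e, List.map_map]; rfl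
      · simp [hl]

lemma graftingEquiv_leaves (x : {x : GraftingData B // x.IsGrafting}) :
    (graftingEquiv B x).leaves = GraftingData.leaves x.1.2 := by
  simp [graftingEquiv, Grafting.leaves, GraftingData.leaves, nodesLeaves]

lemma finiteFibers_graftingData : FiniteFibers (GraftingData.leaves (B := B)) :=
  finiteFibers_sectorLeaves.pi.prod finiteFibers_nodesLeaves.pi

lemma finiteFibers_grafting : FiniteFibers (Grafting.leaves (B := B)) :=
  (finiteFibers_graftingData B).snd.of_injective
    (fun G => ((graftingEquiv B).symm G).1)
    (Subtype.val_injective.comp (graftingEquiv B).symm.injective) fun G => by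
      rw [← graftingEquiv_leaves, Equiv.apply_symm_apply]

open Classical in
/-- Weight of a sector entered with mark `a` and left with mark `b`, at a vertex that is tied
(`none`) or untied in the lead `c` (`some c`). -/
noncomputable def cornerWeight (N₁ N₂ : ℝ) (a b : Bool) : Option Bool → List PlantedTree → ℝ
  | none, l => if markAfter l.length a = b then sectorWeight N₁ N₂ a l else 0
  | some c, l => if markAfter l.length a = b ∧ SectorUntieable c a l then
      sectorWeight N₁ N₂ a l / share N₁ N₂ c ^ ((l.length + 1) / 2) else 0

/-- Factor of a vertex that is tied (`none`) or untied in the lead `c` (`some c`). -/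
noncomputable def vertexFactor (N₁ N₂ : ℝ) : Option Bool → ℝ
  | none => -(N₁ + N₂)
  | some c => channels N₁ N₂ c

/-- Generating function of the sectors with weight `cornerWeight`. -/
noncomputable def cornerGF (N₁ N₂ : ℝ) (a b : Bool) : Option Bool → PowerSeries ℝ
  | none => sectorGF N₁ N₂ a b
  | some c => if a = c ∧ b = !c then untiedGF N₁ N₂ c else 0

lemma gf_cornerWeight (N₁ N₂ : ℝ) (a b : Bool) (κ : Option Bool) :
    gf sectorLeaves (cornerWeight N₁ N₂ a b κ) = cornerGF N₁ N₂ a b κ := by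
  classical
  rcases κ with _ | c
  · rfl
  · rw [cornerGF, untiedGF, ← gf_ite_const]
    refine gf_congr (fun _ => rfl) fun l => ?_
    rw [← ite_and, cornerWeight]
    by_cases hu : SectorUntieable c a l
    · obtain rfl := hu.1
      have : b = !a ↔ markAfter l.length a = b := by
        rw [markAfter_eq_not.2 hu.2.1, eq_comm]
      simp only [hu, this, and_true, true_and]
    · have : ¬ ((a = c ∧ b = !c) ∧ SectorUntieable c c l) := fun h => hu (h.1.1.symm ▸ h.2)
      simp only [hu, this, and_false, if_false]

/-- The weight of a vertex and its trees is a sum over the versions of the vertex of products over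
its corners. The half degree is the sum of `(length + 1) / 2` over the sectors, since these have odd
length if the vertex can be untied. -/
lemma prod_cornerWeight_mul_vertexWeight {N₁ N₂ : ℝ} (h₁ : 0 < N₁) (h₂ : 0 < N₂)
    (a b : Fin (2 * m) → Bool) (l : Fin (2 * m) → List PlantedTree) (v : Finset (Fin (2 * m))) :
    (∏ z ∈ v, cornerWeight N₁ N₂ (a z) (b z) none (l z)) *
      vertexWeight N₁ N₂ ((∑ z ∈ v, (1 + (l z).length)) / 2)
        (fun c => ∀ z ∈ v, SectorUntieable c (a z) (l z)) =
    ∑ κ, vertexFactor N₁ N₂ κ * ∏ z ∈ v, cornerWeight N₁ N₂ (a z) (b z) κ (l z) := by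
  classical
  rw [vertexWeight_eq h₁ h₂, Fintype.sum_option, mul_add, Finset.mul_sum]
  congr 1
  · rw [mul_comm]; rfl
  · refine Finset.sum_congr rfl fun c _ => ?_
    split_ifs with h
    · have hk : (∑ z ∈ v, (1 + (l z).length)) / 2 = ∑ z ∈ v, ((l z).length + 1) / 2 := by
        refine Nat.div_eq_of_eq_mul_left (by norm_num) ?_
        rw [Finset.sum_mul]
        refine Finset.sum_congr rfl fun z hz => ?_
        have := Nat.odd_iff.1 (h z hz).2.1
        omega
      rw [hk, ← Finset.prod_pow_eq_pow_sum, vertexFactor, mul_div_left_comm,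
        ← Finset.prod_div_distrib]
      congr 1
      refine Finset.prod_congr rfl fun z hz => ?_
      simp only [cornerWeight, h z hz, and_true]
      split_ifs <;> simp
    · push Not at h
      obtain ⟨z, hz, hz'⟩ := h
      rw [mul_zero, Finset.prod_eq_zero hz, mul_zero]
      simp [cornerWeight, hz']

/-- The generating function of the trees on the vertices, if the marks at both ends of all corners
are given. -/
lemma gf_corners {N₁ N₂ : ℝ} (h₁ : 0 < N₁) (h₂ : 0 < N₂) (a b : Fin (2 * m) → Bool) :
    gf (fun l : Fin (2 * m) → List PlantedTree => ∑ z, sectorLeaves (l z)) (fun l =>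
      (∏ z, cornerWeight N₁ N₂ (a z) (b z) none (l z)) *
      ∏ v ∈ B.vertices, vertexWeight N₁ N₂ ((∑ z ∈ v, (1 + (l z).length)) / 2)
        (fun c => ∀ z ∈ v, SectorUntieable c (a z) (l z))) =
    ∏ v ∈ B.vertices, ∑ κ, PowerSeries.C (vertexFactor N₁ N₂ κ) *
      ∏ z ∈ v, cornerGF N₁ N₂ (a z) (b z) κ := by
  have hfib : FiniteFibers fun l : Fin (2 * m) → List PlantedTree => ∑ z, sectorLeaves (l z) :=
    finiteFibers_sectorLeaves.pi
  rw [gf_congr (fun _ => rfl) fun l => by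
    rw [← B.prod_vertices_prod, ← Finset.prod_mul_distrib, Finset.prod_congr rfl fun v _ =>
      prod_cornerWeight_mul_vertexWeight h₁ h₂ a b l v, B.prod_vertices_sum _
      fun z κ => cornerWeight N₁ N₂ (a z) (b z) κ (l z)]]
  rw [gf_sum_index hfib, B.prod_vertices_sum]
  refine Finset.sum_congr rfl fun κ _ => ?_
  rw [gf_const_mul hfib, map_prod]
  congr 1
  rw [gf_pi finiteFibers_sectorLeaves fun z l => cornerWeight N₁ N₂ (a z) (b z)
    (κ ⟨B.cornersAt z, B.mem_vertices.2 ⟨z, rfl⟩⟩) l]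
  exact Finset.prod_congr rfl fun z _ => gf_cornerWeight _ _ _ _ _

/-- The generating function of the graftings on a base structure is a sum over the marks at the
ends of the edges of a product over edges and vertices. -/
theorem gf_grafting {N₁ N₂ : ℝ} (h₁ : 0 < N₁) (h₂ : 0 < N₂) :
    gf (Grafting.leaves (B := B)) (fun G => G.weight N₁ N₂) =
      ∑ mk : Side m → Bool, if ∀ y, mk (rev (B.ε y)) = !(mk y) then
        (∏ e : B.Edge, edgeGF N₁ N₂ (B.unitaryEdge e.1) (mk (e.1, false)) (mk (e.1, true))) *
        ∏ v ∈ B.vertices, ∑ κ, PowerSeries.C (vertexFactor N₁ N₂ κ) *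
          ∏ z ∈ v, cornerGF N₁ N₂ (mk (z, true)) (mk (finRotate (2 * m) z, false)) κ
      else 0 := by
  classical
  let wc : (Side m → Bool) → (Fin (2 * m) → List PlantedTree) → ℝ := fun mk l =>
      (∏ z, cornerWeight N₁ N₂ (mk (z, true)) (mk (finRotate (2 * m) z, false)) none (l z)) *
      ∏ v ∈ B.vertices, vertexWeight N₁ N₂ ((∑ z ∈ v, (1 + (l z).length)) / 2)
        (fun c => ∀ z ∈ v, SectorUntieable c (mk (z, true)) (l z))
  let we : (Side m → Bool) → B.Edge → List ValidNode → ℝ := fun mk e l =>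
    if markAfter (l.map fun p => p.1.fst.length).sum (mk (e.1, false)) = mk (e.1, true) then
      edgeWeight N₁ N₂ (B.unitaryEdge e.1) (mk (e.1, false)) (l.map Subtype.val) else 0
  let w : GraftingData B → ℝ := fun x => (∏ e, edgeWeight N₁ N₂ (B.unitaryEdge e.1)
      (x.1 (e.1, false)) ((x.2.2 e).map Subtype.val)) *
    (∏ z, sectorWeight N₁ N₂ (x.1 (z, true)) (x.2.1 z)) *
    ∏ v ∈ B.vertices, vertexWeight N₁ N₂ ((∑ z ∈ v, (1 + (x.2.1 z).length)) / 2)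
      (fun c => ∀ z ∈ v, SectorUntieable c (x.1 (z, true)) (x.2.1 z))
  have hw : ∀ x : GraftingData B, (if x.IsGrafting then w x else 0) =
      if ∀ y, x.1 (rev (B.ε y)) = !(x.1 y) then wc x.1 x.2.1 * ∏ e, we x.1 e (x.2.2 e) else 0 := by
    rintro ⟨mk, l, le⟩
    simp only [GraftingData.IsGrafting, wc, we, w, cornerWeight, Finset.prod_ite_zero,
      Finset.mem_univ, true_implies]
    by_cases hA : ∀ y, mk (rev (B.ε y)) = !(mk y)
    · simp only [hA, implies_true, true_and, if_true, ite_and]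
      split_ifs <;> ring
    · simp only [hA, false_and, if_false]
  have hweight : gf (fun x => (graftingEquiv B x).leaves)
      (fun x => (graftingEquiv B x).weight N₁ N₂) =
        gf (fun x : {x : GraftingData B // x.IsGrafting} => GraftingData.leaves x.1.2)
          (fun x => w x.1) :=
    gf_congr (graftingEquiv_leaves B) fun x => by
      simp [graftingEquiv, Grafting.weight, Grafting.halfDegree, w]
  rw [← gf_equiv (graftingEquiv B), hweight, gf_subtype (fun x : GraftingData B => x.IsGrafting)
      (fun x => GraftingData.leaves x.2), gf_congr (fun _ => rfl) hw,
    gf_fintype_prod (finiteFibers_graftingData B) (fun mk x =>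
      if ∀ y, mk (rev (B.ε y)) = !(mk y) then wc mk x.1 * ∏ e, we mk e (x.2 e) else 0)]
  refine Finset.sum_congr rfl fun mk _ => ?_
  rw [gf_ite_const]
  refine if_congr Iff.rfl ?_ rfl
  rw [← gf_corners B h₁ h₂ (fun z => mk (z, true)) (fun z => mk (finRotate (2 * m) z, false))]
  refine Eq.trans ?_ (mul_comm _ _)
  have : ∏ e : B.Edge, edgeGF N₁ N₂ (B.unitaryEdge e.1) (mk (e.1, false)) (mk (e.1, true)) =
      gf (fun l : B.Edge → List ValidNode => ∑ e, nodesLeaves (l e))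
        (fun l => ∏ e, we mk e (l e)) := (gf_pi finiteFibers_nodesLeaves (we mk)).symm
  rw [this]
  exact gf_prod finiteFibers_sectorLeaves.pi finiteFibers_nodesLeaves.pi (wc mk)
    (fun l : B.Edge → List ValidNode => ∏ e, we mk e (l e))

end Grafting

/-! ### Base structures of genus one -/

namespace BaseStructure

section

variable {m : ℕ} (B : BaseStructure m)

/-- The corner at which an oriented edge-side leaves its vertex. -/
def cornerOf (x : Side m) : Fin (2 * m) := if x.2 then x.1 else (finRotate (2 * m)).symm x.1

lemma eq_or_eq_cornerSwap_of_cornerOf_eq {x y : Side m} (h : cornerOf x = cornerOf y) :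
    x = y ∨ x = cornerSwap y := by
  rcases x with ⟨z, _ | _⟩ <;> rcases y with ⟨w, _ | _⟩ <;>
    simp only [cornerOf, Bool.false_eq_true, if_true, if_false, EmbeddingLike.apply_eq_iff_eq] at h
  · exact Or.inl (by rw [h])
  · exact Or.inr (by rw [cornerSwap_true, ← h, Equiv.apply_symm_apply])
  · exact Or.inr (by rw [h, ← cornerSwap_cornerSwap (_, true), cornerSwap_true,
      Equiv.apply_symm_apply])
  · exact Or.inl (by rw [h])

lemma cornerOf_mem_cornersAt {z : Fin (2 * m)} {x : Side m} (h : B.ν.SameCycle (z, true) x) :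
    cornerOf x ∈ B.cornersAt z := by
  rw [mem_cornersAt, cornerSwap_true]
  rcases x with ⟨w, _ | _⟩
  · right
    simpa only [cornerOf, Bool.false_eq_true, if_false, Equiv.apply_symm_apply] using h
  · left
    simpa only [cornerOf, if_true] using h

/-- Distinct sides in one cycle of `ν` leave the vertex at distinct corners. -/
lemma cornerOf_injOn (z : Fin (2 * m)) :
    Set.InjOn cornerOf {x | B.ν.SameCycle (z, true) x} := fun x hx y hy h => by
  rcases eq_or_eq_cornerSwap_of_cornerOf_eq h with h | h
  · exact h
  · exact absurd (hy.symm.trans (h ▸ hx)) (B.not_sameCycle_cornerSwap y)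

/-- The degree of a vertex is at least the number of known elements of its cycle. -/
lemma card_le_card_cornersAt (z : Fin (2 * m)) (s : Finset (Side m))
    (hs : ∀ x ∈ s, B.ν.SameCycle (z, true) x) : s.card ≤ (B.cornersAt z).card := by
  rw [← Finset.card_image_of_injOn (f := cornerOf) ((B.cornerOf_injOn z).mono hs)]
  refine Finset.card_le_card fun w hw => ?_
  obtain ⟨x, hx, rfl⟩ := Finset.mem_image.1 hw
  exact B.cornerOf_mem_cornersAt (hs x hx)

lemma ν_ne (x : Side m) : B.ν x ≠ x := B.degree_ne_one x

lemma ν_ν_ne (x : Side m) : B.ν (B.ν x) ≠ x := B.degree_ne_two x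

lemma three_le_card_cornersAt (z : Fin (2 * m)) : 3 ≤ (B.cornersAt z).card := by
  have h0 : B.ν.SameCycle (z, true) (z, true) := Equiv.Perm.SameCycle.refl _ _
  have h1 := Equiv.Perm.sameCycle_apply_right.2 h0
  have h2 := Equiv.Perm.sameCycle_apply_right.2 h1
  have := B.card_le_card_cornersAt z {(z, true), B.ν (z, true), B.ν (B.ν (z, true))}
    (by simp [h0])
  rwa [Finset.card_eq_three.2 ⟨_, _, _, (B.ν_ne _).symm, (B.ν_ν_ne _).symm, (B.ν_ne _).symm, rfl⟩]
    at this

/-- A vertex with three corners is a cycle of length three of `ν`. -/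
lemma ν_pow_three_of_card_cornersAt {z : Fin (2 * m)} (h : (B.cornersAt z).card = 3) :
    B.ν (B.ν (B.ν (z, true))) = (z, true) := by
  by_contra hne
  have h0 : B.ν.SameCycle (z, true) (z, true) := Equiv.Perm.SameCycle.refl _ _
  have := B.card_le_card_cornersAt z
    {B.ν (B.ν (B.ν (z, true))), (z, true), B.ν (z, true), B.ν (B.ν (z, true))} (by simp [h0])
  rw [Finset.card_insert_of_notMem, h, Finset.card_eq_three.2
    ⟨_, _, _, (B.ν_ne _).symm, (B.ν_ν_ne _).symm, (B.ν_ne _).symm, rfl⟩] at this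
  · omega
  · simp [hne, ν_ne, ν_ν_ne]

lemma three_le_card_of_mem_vertices {v : Finset (Fin (2 * m))} (hv : v ∈ B.vertices) :
    3 ≤ v.card := by
  obtain ⟨z, rfl⟩ := B.mem_vertices.1 hv
  exact B.three_le_card_cornersAt z

lemma three_mul_card_vertices_le : 3 * B.vertices.card ≤ 2 * m := by
  refine le_of_le_of_eq ?_ B.sum_card_vertices
  rw [mul_comm, ← smul_eq_mul]
  exact Finset.card_nsmul_le_sum _ _ _ fun v hv => B.three_le_card_of_mem_vertices hv

lemma card_vertices_pos : 0 < B.vertices.card :=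
  Finset.card_pos.2 ⟨_, B.mem_vertices.2 ⟨⟨0, by have := B.pos; omega⟩, rfl⟩⟩

lemma twoGenus_eq_two_iff : B.twoGenus = 2 ↔ B.vertices.card + 1 = m := by
  rw [twoGenus]; omega

/-- There are `m - 1` vertices, each with three or more of the `2 m` corners. -/
lemma edges_of_twoGenus (h : B.twoGenus = 2) : m = 2 ∨ m = 3 := by
  rw [twoGenus_eq_two_iff] at h
  have := B.three_mul_card_vertices_le
  have := B.card_vertices_pos
  omega

/-- A base structure is determined by the partners of the sides run forwards. -/
lemma ext_ε {B B' : BaseStructure m} (h : ∀ z, B.ε (z, false) = B'.ε (z, false)) : B = B' := by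
  have : B.ε = B'.ε := by
    ext1 ⟨z, b⟩
    cases b
    · exact h z
    · have h1 := B.comm_rev (z, false)
      have h2 := B'.comm_rev (z, false)
      simp only [rev, Bool.not_false] at h1 h2
      rw [h1, h2, h]
  cases B
  cases B'
  congr

lemma ε_true (z : Fin (2 * m)) : B.ε (z, true) = rev (B.ε (z, false)) := B.comm_rev (z, false)

lemma ε_fst_ne (z : Fin (2 * m)) : (B.ε (z, false)).1 ≠ z := by
  intro h
  rcases hx : B.ε (z, false) with ⟨w, _ | _⟩
  · exact B.ne_self (z, false) (by rw [hx] at h ⊢; exact congrArg (·, false) h)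
  · exact B.ne_rev (z, false) (by rw [hx] at h ⊢; exact congrArg (·, true) h)

lemma ε_partner (z : Fin (2 * m)) :
    B.ε ((B.ε (z, false)).1, false) = (z, (B.ε (z, false)).2) := by
  rcases hx : B.ε (z, false) with ⟨w, _ | _⟩
  · show B.ε (w, false) = _
    rw [← hx, B.invol, hx]
  · show B.ε (w, false) = _
    have : ((w, false) : Side m) = rev (w, true) := rfl
    rw [this, B.comm_rev, ← hx, B.invol, hx]
    rfl

end

/-- The involution of the oriented edge-sides given by the partners of the sides run forwards. -/
def codeMap {m : ℕ} (c : Fin (2 * m) → Side m) (x : Side m) : Side m :=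
  ((c x.1).1, xor (c x.1).2 x.2)

/-- The partners `c z` of the sides `(z, false)` define a base structure. -/
def IsCode {m : ℕ} (c : Fin (2 * m) → Side m) : Prop :=
  0 < m ∧ (∀ z, (c z).1 ≠ z) ∧ (∀ z, c (c z).1 = (z, (c z).2)) ∧
    (∀ x, face m (codeMap c x) ≠ x) ∧
    ∀ x, face m (codeMap c (face m (codeMap c x))) ≠ x

instance {m : ℕ} (c : Fin (2 * m) → Side m) : Decidable (IsCode c) := by
  unfold IsCode
  infer_instance

/-- The base structure in which side `z` is matched with `c z`. -/
def ofCode {m : ℕ} (c : Fin (2 * m) → Side m) (hc : IsCode c) : BaseStructure m :=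
  have h : ∀ x, codeMap c (codeMap c x) = x := fun x => by
    rcases x with ⟨z, b⟩
    simp only [codeMap, hc.2.2.1]
    cases (c z).2 <;> cases b <;> rfl
  { ε := ⟨codeMap c, codeMap c, h, h⟩
    pos := hc.1
    invol := h
    ne_self := fun x hx => hc.2.1 x.1 (by have := congrArg Prod.fst hx; exact this)
    ne_rev := fun x hx => hc.2.1 x.1 (by have := congrArg Prod.fst hx; exact this)
    comm_rev := fun x => by simp [codeMap, rev]
    degree_ne_one := hc.2.2.2.1
    degree_ne_two := hc.2.2.2.2 }

/-- The base structures with two edges: partners of the sides `0, 1, 2, 3`, where `true` marks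
orthogonal edges. -/
def codeTwo : Fin 5 → Fin (2 * 2) → Side 2 := ![
  ![(2, false), (3, false), (0, false), (1, false)],
  ![(1, true), (0, true), (3, true), (2, true)],
  ![(3, true), (2, true), (1, true), (0, true)],
  ![(2, false), (3, true), (0, false), (1, true)],
  ![(2, true), (3, false), (0, true), (1, false)]]

/-- The base structures with three edges and two vertices: partners of the sides `0, …, 5`, where
`true` marks orthogonal edges. -/
def codeThree : Fin 7 → Fin (2 * 3) → Side 3 := ![
  ![(3, false), (4, false), (5, false), (0, false), (1, false), (2, false)],
  ![(2, true), (4, false), (0, true), (5, true), (1, false), (3, true)],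
  ![(3, false), (5, true), (4, true), (0, false), (2, true), (1, true)],
  ![(4, true), (3, true), (5, false), (1, true), (0, true), (2, false)],
  ![(1, true), (0, true), (5, false), (4, true), (3, true), (2, false)],
  ![(3, false), (2, true), (1, true), (0, false), (5, true), (4, true)],
  ![(5, true), (4, false), (3, true), (2, true), (1, false), (0, true)]]

lemma isCode_codeTwo (i : Fin 5) : IsCode (codeTwo i) := by
  revert i; decide

lemma isCode_codeThree (i : Fin 7) : IsCode (codeThree i) := by
  revert i; decide

/-- The base structures of genus one with two edges; the one with index `0` is unitary. -/
def genusOneTwo (i : Fin 5) : BaseStructure 2 := ofCode (codeTwo i) (isCode_codeTwo i)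

/-- The base structures of genus one with three edges; the one with index `0` is unitary. -/
def genusOneThree (i : Fin 7) : BaseStructure 3 := ofCode (codeThree i) (isCode_codeThree i)

lemma codeMap_ε {m : ℕ} (B : BaseStructure m) :
    codeMap (fun z => B.ε (z, false)) = B.ε := by
  funext ⟨z, b⟩
  cases b
  · simp [codeMap]
  · simp [codeMap, ε_true, rev]

lemma ν_eq_face_codeMap {m : ℕ} (B : BaseStructure m) (x : Side m) :
    B.ν x = face m (codeMap (fun z => B.ε (z, false)) x) := by
  rw [codeMap_ε]; rfl

lemma ε_fst_eq_iff {m : ℕ} (B : BaseStructure m) (i j : Fin (2 * m)) :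
    (B.ε (i, false)).1 = j ↔ (B.ε (j, false)).1 = i := by
  constructor <;> rintro rfl <;> rw [B.ε_partner]

lemma ε_snd_eq {m : ℕ} (B : BaseStructure m) (i j : Fin (2 * m)) (h : (B.ε (i, false)).1 = j) :
    (B.ε (j, false)).2 = (B.ε (i, false)).2 := by
  rw [← h, B.ε_partner]

set_option synthInstance.maxSize 10000 in
set_option synthInstance.maxHeartbeats 200000 in
set_option maxRecDepth 100000 in
/-- There are five ways of matching four sides without vertices of degree one or two. Side `i` is
matched with side `pᵢ`, by an orthogonal edge if `bᵢ` is true. Every condition follows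
directly after the quantifiers it depends on, which prunes the enumeration. -/
lemma exists_codeTwo :
    ∀ p0 : Fin 4, p0 ≠ 0 →
    ∀ p1 : Fin 4, p1 ≠ 1 → (p0 = 1 ↔ p1 = 0) →
    ∀ p2 : Fin 4, p2 ≠ 2 → (p0 = 2 ↔ p2 = 0) → (p1 = 2 ↔ p2 = 1) →
    ∀ p3 : Fin 4, p3 ≠ 3 → (p0 = 3 ↔ p3 = 0) → (p1 = 3 ↔ p3 = 1) → (p2 = 3 ↔ p3 = 2) →
    ∀ b0 : Bool,
    ∀ b1 : Bool, (p0 = 1 → b1 = b0) →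
    ∀ b2 : Bool, (p0 = 2 → b2 = b0) → (p1 = 2 → b2 = b1) →
    ∀ b3 : Bool, (p0 = 3 → b3 = b0) → (p1 = 3 → b3 = b1) → (p2 = 3 → b3 = b2) →
    ∀ c : Fin (2 * 2) → Side 2, c = ![(p0, b0), (p1, b1), (p2, b2), (p3, b3)] →
    (∀ x, face 2 (codeMap c x) ≠ x) → (∀ x, face 2 (codeMap c (face 2 (codeMap c x))) ≠ x) →
    ∃ i, c = codeTwo i := by
  simp only [forall_eq]
  decide +kernel

set_option synthInstance.maxSize 10000 in
set_option synthInstance.maxHeartbeats 200000 in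
set_option maxRecDepth 100000 in
/-- There are seven ways of matching six sides such that all vertices have degree three; see
`exists_codeTwo` for the order of the quantifiers. -/
lemma exists_codeThree :
    ∀ p0 : Fin 6, p0 ≠ 0 →
    ∀ p1 : Fin 6, p1 ≠ 1 → (p0 = 1 ↔ p1 = 0) →
    ∀ p2 : Fin 6, p2 ≠ 2 → (p0 = 2 ↔ p2 = 0) → (p1 = 2 ↔ p2 = 1) →
    ∀ p3 : Fin 6, p3 ≠ 3 → (p0 = 3 ↔ p3 = 0) → (p1 = 3 ↔ p3 = 1) → (p2 = 3 ↔ p3 = 2) →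
    ∀ p4 : Fin 6, p4 ≠ 4 → (p0 = 4 ↔ p4 = 0) → (p1 = 4 ↔ p4 = 1) → (p2 = 4 ↔ p4 = 2) →
      (p3 = 4 ↔ p4 = 3) →
    ∀ p5 : Fin 6, p5 ≠ 5 → (p0 = 5 ↔ p5 = 0) → (p1 = 5 ↔ p5 = 1) → (p2 = 5 ↔ p5 = 2) →
      (p3 = 5 ↔ p5 = 3) → (p4 = 5 ↔ p5 = 4) →
    ∀ b0 : Bool,
    ∀ b1 : Bool, (p0 = 1 → b1 = b0) →
    ∀ b2 : Bool, (p0 = 2 → b2 = b0) → (p1 = 2 → b2 = b1) →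
    ∀ b3 : Bool, (p0 = 3 → b3 = b0) → (p1 = 3 → b3 = b1) → (p2 = 3 → b3 = b2) →
    ∀ b4 : Bool, (p0 = 4 → b4 = b0) → (p1 = 4 → b4 = b1) → (p2 = 4 → b4 = b2) →
      (p3 = 4 → b4 = b3) →
    ∀ b5 : Bool, (p0 = 5 → b5 = b0) → (p1 = 5 → b5 = b1) → (p2 = 5 → b5 = b2) →
      (p3 = 5 → b5 = b3) → (p4 = 5 → b5 = b4) →
    ∀ c : Fin (2 * 3) → Side 3,
    c = ![(p0, b0), (p1, b1), (p2, b2), (p3, b3), (p4, b4), (p5, b5)] →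
    (∀ z, face 3 (codeMap c (z, true)) ≠ (z, true)) →
    (∀ z, face 3 (codeMap c (face 3 (codeMap c (face 3 (codeMap c (z, true)))))) = (z, true)) →
    ∃ i, c = codeThree i := by
  simp only [forall_eq]
  decide +kernel

/-- All base structures with two edges have genus one. -/
lemma exists_eq_genusOneTwo (B : BaseStructure 2) : ∃ i, B = genusOneTwo i := by
  have h := exists_codeTwo _ (B.ε_fst_ne 0) _ (B.ε_fst_ne 1) (B.ε_fst_eq_iff _ _) _
    (B.ε_fst_ne 2) (B.ε_fst_eq_iff _ _) (B.ε_fst_eq_iff _ _) _ (B.ε_fst_ne 3)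
    (B.ε_fst_eq_iff _ _) (B.ε_fst_eq_iff _ _) (B.ε_fst_eq_iff _ _) _ _ (B.ε_snd_eq _ _) _
    (B.ε_snd_eq _ _) (B.ε_snd_eq _ _) _ (B.ε_snd_eq _ _) (B.ε_snd_eq _ _) (B.ε_snd_eq _ _)
    (fun z => B.ε (z, false)) (by funext z; fin_cases z <;> rfl)
    (fun x => by rw [← ν_eq_face_codeMap]; exact B.ν_ne x)
    (fun x => by rw [← ν_eq_face_codeMap, ← ν_eq_face_codeMap]; exact B.ν_ν_ne x)
  obtain ⟨i, hi⟩ := h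
  exact ⟨i, ext_ε fun z => (congrFun hi z).trans (by simp [genusOneTwo, ofCode, codeMap])⟩

/-- There are two vertices with at least three of the six corners each, so each has three. -/
lemma exists_eq_genusOneThree (B : BaseStructure 3) (hB : B.twoGenus = 2) :
    ∃ i, B = genusOneThree i := by
  have hV : B.vertices.card = 2 := by
    have := B.twoGenus_eq_two_iff.1 hB
    omega
  have hcard : ∀ z, (B.cornersAt z).card = 3 := fun z => by
    have hz := B.mem_vertices.2 ⟨z, rfl⟩
    have h1 := Finset.add_sum_erase _ Finset.card hz
    have h2 := Finset.card_nsmul_le_sum (B.vertices.erase (B.cornersAt z))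
      (fun v => v.card) 3
      fun v hv => B.three_le_card_of_mem_vertices (Finset.mem_of_mem_erase hv)
    rw [Finset.card_erase_of_mem hz, hV, smul_eq_mul] at h2
    rw [B.sum_card_vertices] at h1
    have := B.three_le_card_cornersAt z
    omega
  have h := exists_codeThree _ (B.ε_fst_ne 0) _ (B.ε_fst_ne 1) (B.ε_fst_eq_iff _ _) _
    (B.ε_fst_ne 2) (B.ε_fst_eq_iff _ _) (B.ε_fst_eq_iff _ _) _ (B.ε_fst_ne 3)
    (B.ε_fst_eq_iff _ _) (B.ε_fst_eq_iff _ _) (B.ε_fst_eq_iff _ _) _ (B.ε_fst_ne 4)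
    (B.ε_fst_eq_iff _ _) (B.ε_fst_eq_iff _ _) (B.ε_fst_eq_iff _ _) (B.ε_fst_eq_iff _ _) _
    (B.ε_fst_ne 5) (B.ε_fst_eq_iff _ _) (B.ε_fst_eq_iff _ _) (B.ε_fst_eq_iff _ _)
    (B.ε_fst_eq_iff _ _) (B.ε_fst_eq_iff _ _) _ _ (B.ε_snd_eq _ _) _
    (B.ε_snd_eq _ _) (B.ε_snd_eq _ _) _ (B.ε_snd_eq _ _) (B.ε_snd_eq _ _) (B.ε_snd_eq _ _) _
    (B.ε_snd_eq _ _) (B.ε_snd_eq _ _) (B.ε_snd_eq _ _) (B.ε_snd_eq _ _) _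
    (B.ε_snd_eq _ _) (B.ε_snd_eq _ _) (B.ε_snd_eq _ _) (B.ε_snd_eq _ _) (B.ε_snd_eq _ _)
    (fun z => B.ε (z, false)) (by funext z; fin_cases z <;> rfl)
    (fun z => by rw [← ν_eq_face_codeMap]; exact B.ν_ne _)
    (fun z => by
      rw [← ν_eq_face_codeMap, ← ν_eq_face_codeMap, ← ν_eq_face_codeMap]
      exact B.ν_pow_three_of_card_cornersAt (hcard z))
  obtain ⟨i, hi⟩ := h
  exact ⟨i, ext_ε fun z => (congrFun hi z).trans (by simp [genusOneThree, ofCode, codeMap])⟩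

lemma genusOneTwo_injective : Function.Injective genusOneTwo := fun i j h => by
  have : ∀ z, codeTwo i z = codeTwo j z := fun z => by
    have := congrArg (fun B : BaseStructure 2 => B.ε (z, false)) h
    simpa [genusOneTwo, ofCode, codeMap] using this
  clear h
  revert i j
  decide +kernel

lemma genusOneThree_injective : Function.Injective genusOneThree := fun i j h => by
  have : ∀ z, codeThree i z = codeThree j z := fun z => by
    have := congrArg (fun B : BaseStructure 3 => B.ε (z, false)) h
    simpa [genusOneThree, ofCode, codeMap] using this
  clear h
  revert i j
  decide +kernel

lemma vertices_genusOneTwo (i : Fin 5) : (genusOneTwo i).vertices = {{0, 1, 2, 3}} := by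
  revert i; decide +kernel

/-- The corners around the two vertices of the base structures with three edges. -/
def cornersThree : Fin 7 → Finset (Finset (Fin (2 * 3))) := ![
  {{0, 2, 4}, {1, 3, 5}}, {{0, 2, 4}, {1, 3, 5}}, {{0, 2, 4}, {1, 3, 5}}, {{0, 2, 4}, {1, 3, 5}},
  {{0, 1, 5}, {2, 3, 4}}, {{0, 1, 2}, {3, 4, 5}}, {{0, 4, 5}, {1, 2, 3}}]

lemma vertices_genusOneThree (i : Fin 7) : (genusOneThree i).vertices = cornersThree i := by
  revert i; decide +kernel

lemma twoGenus_genusOneTwo (i : Fin 5) : (genusOneTwo i).twoGenus = 2 := by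
  rw [twoGenus, vertices_genusOneTwo]; rfl

lemma twoGenus_genusOneThree (i : Fin 7) : (genusOneThree i).twoGenus = 2 := by
  rw [twoGenus, vertices_genusOneThree]; revert i; decide

lemma setOf_twoGenus_two : {B : BaseStructure 2 | B.twoGenus = 2} = Set.range genusOneTwo := by
  ext B
  constructor
  · intro _
    obtain ⟨i, rfl⟩ := B.exists_eq_genusOneTwo
    exact ⟨i, rfl⟩
  · rintro ⟨i, rfl⟩
    exact twoGenus_genusOneTwo i

lemma setOf_twoGenus_three :
    {B : BaseStructure 3 | B.twoGenus = 2} = Set.range genusOneThree := by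
  ext B
  constructor
  · intro hB
    obtain ⟨i, rfl⟩ := B.exists_eq_genusOneThree hB
    exact ⟨i, rfl⟩
  · rintro ⟨i, rfl⟩
    exact twoGenus_genusOneThree i

lemma ncard_twoGenus_two : {B : BaseStructure 2 | B.twoGenus = 2}.ncard = 5 := by
  rw [setOf_twoGenus_two, ← Set.image_univ, Set.ncard_image_of_injective _ genusOneTwo_injective]
  simp

lemma ncard_twoGenus_three : {B : BaseStructure 3 | B.twoGenus = 2}.ncard = 7 := by
  rw [setOf_twoGenus_three, ← Set.image_univ,
    Set.ncard_image_of_injective _ genusOneThree_injective]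
  simp

lemma genusOneTwo_zero : genusOneTwo 0 = unitaryBaseTwo :=
  ext_ε (by decide)

lemma genusOneThree_zero : genusOneThree 0 = unitaryBaseThree :=
  ext_ε (by decide)

lemma isUnitary_genusOneTwo (i : Fin 5) : (genusOneTwo i).IsUnitary ↔ i = 0 := by
  unfold IsUnitary
  revert i; decide +kernel

lemma isUnitary_genusOneThree (i : Fin 7) : (genusOneThree i).IsUnitary ↔ i = 0 := by
  unfold IsUnitary
  revert i; decide +kernel

lemma setOf_unitary_two :
    {B : BaseStructure 2 | B.twoGenus = 2 ∧ B.IsUnitary} = {unitaryBaseTwo} := by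
  ext B
  simp only [Set.mem_ofPred_eq, Set.mem_singleton_iff, ← genusOneTwo_zero]
  constructor
  · rintro ⟨-, hu⟩
    obtain ⟨i, rfl⟩ := B.exists_eq_genusOneTwo
    rw [(isUnitary_genusOneTwo i).1 hu]
  · rintro rfl
    exact ⟨twoGenus_genusOneTwo 0, (isUnitary_genusOneTwo 0).2 rfl⟩

lemma setOf_unitary_three :
    {B : BaseStructure 3 | B.twoGenus = 2 ∧ B.IsUnitary} = {unitaryBaseThree} := by
  ext B
  simp only [Set.mem_ofPred_eq, Set.mem_singleton_iff, ← genusOneThree_zero]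
  constructor
  · rintro ⟨hB, hu⟩
    obtain ⟨i, rfl⟩ := B.exists_eq_genusOneThree hB
    rw [(isUnitary_genusOneThree i).1 hu]
  · rintro rfl
    exact ⟨twoGenus_genusOneThree 0, (isUnitary_genusOneThree 0).2 rfl⟩

end BaseStructure

/-! ### Solution of the recursions -/

section Relations

variable {N₁ N₂ : ℝ}

/-- The product `h` of the generating functions of `o`-trees and `i`-trees. -/
noncomputable def treeProd (N₁ N₂ : ℝ) : PowerSeries ℝ := treeGF N₁ N₂ true * treeGF N₁ N₂ false

lemma treeGF_mul_treeGF_not (a : Bool) :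
    treeGF N₁ N₂ a * treeGF N₁ N₂ (!a) = treeProd N₁ N₂ := by
  cases a
  · exact mul_comm _ _
  · rfl

lemma sectorGF_self_mul (a : Bool) : sectorGF N₁ N₂ a a * (1 - treeProd N₁ N₂) = 1 := by
  have h1 := sectorGF_eq N₁ N₂ a a
  have h2 := sectorGF_eq N₁ N₂ (!a) a
  simp only [Bool.not_not, if_true, Bool.not_eq_self, if_false, zero_add] at h1 h2
  linear_combination h1 + treeGF N₁ N₂ a * h2 +
    sectorGF N₁ N₂ a a * treeGF_mul_treeGF_not (N₁ := N₁) (N₂ := N₂) a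

lemma sectorGF_not_mul (a : Bool) :
    sectorGF N₁ N₂ a (!a) * (1 - treeProd N₁ N₂) = treeGF N₁ N₂ a := by
  have h1 := sectorGF_eq N₁ N₂ a (!a)
  simp only [Bool.eq_not_self, if_false, zero_add] at h1
  linear_combination (1 - treeProd N₁ N₂) * h1 + treeGF N₁ N₂ a * sectorGF_self_mul (!a)

lemma share_add_share (h₁ : 0 < N₁) (h₂ : 0 < N₂) (a : Bool) :
    share N₁ N₂ a + share N₁ N₂ (!a) = 1 := by
  have : N₁ + N₂ ≠ 0 := by positivity
  cases a <;> simp only [share, channels, Bool.not_true, Bool.not_false, if_true, if_false,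
    Bool.false_eq_true] <;> field_simp
  ring

/-- The tree generating functions are `T a = X * (h + share a * (1 - h))`. -/
lemma treeGF_eq (h₁ : 0 < N₁) (h₂ : 0 < N₂) (a : Bool) : treeGF N₁ N₂ a = PowerSeries.X *
    (treeProd N₁ N₂ + PowerSeries.C (share N₁ N₂ a) * (1 - treeProd N₁ N₂)) := by
  have h3 := sectorGF_not_eq h₁ h₂ a
  have h4 := untiedGF_eq h₁ h₂ a
  have h5 := sectorGF_not_mul (N₁ := N₁) (N₂ := N₂) a
  linear_combination (PowerSeries.X * treeGF N₁ N₂ (!a) - 1) * h5 +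
    (1 - treeProd N₁ N₂) * (1 - PowerSeries.X * treeGF N₁ N₂ (!a)) * h3 +
    (1 - treeProd N₁ N₂) * PowerSeries.C (share N₁ N₂ a) * h4 +
    PowerSeries.X * treeGF_mul_treeGF_not (N₁ := N₁) (N₂ := N₂) a

lemma treeGF_add_treeGF (h₁ : 0 < N₁) (h₂ : 0 < N₂) (a : Bool) :
    treeGF N₁ N₂ a + treeGF N₁ N₂ (!a) = PowerSeries.X * (1 + treeProd N₁ N₂) := by
  have h := congrArg (PowerSeries.C (R := ℝ)) (share_add_share h₁ h₂ a)
  rw [map_add, map_one] at h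
  linear_combination treeGF_eq h₁ h₂ a + treeGF_eq h₁ h₂ (!a) +
    PowerSeries.X * (1 - treeProd N₁ N₂) * h

lemma constantCoeff_treeProd (h₁ : 0 < N₁) (h₂ : 0 < N₂) :
    PowerSeries.constantCoeff (treeProd N₁ N₂) = 0 := by
  rw [treeProd, treeGF_eq h₁ h₂]
  simp

/-- The weight of a change of the mark along an edge, relative to the case without change. -/
noncomputable def markChange (N₁ N₂ : ℝ) (u a : Bool) : PowerSeries ℝ :=
  if u then PowerSeries.C (share N₁ N₂ (!a) / share N₁ N₂ a) * treeGF N₁ N₂ a ^ 2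
  else -treeProd N₁ N₂

lemma markChange_mul (h₁ : 0 < N₁) (h₂ : 0 < N₂) (u a : Bool) :
    markChange N₁ N₂ u a * markChange N₁ N₂ u (!a) = treeProd N₁ N₂ ^ 2 := by
  cases u
  · simp only [markChange, Bool.false_eq_true, if_false]; ring
  · have : PowerSeries.C (share N₁ N₂ (!a) / share N₁ N₂ a) *
        PowerSeries.C (share N₁ N₂ a / share N₁ N₂ (!a)) = 1 := by
      rw [← map_mul, ← map_one PowerSeries.C]
      congr 1
      have := (share_pos h₁ h₂ a).ne'
      have := (share_pos h₁ h₂ (!a)).ne'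
      field_simp
    simp only [markChange, if_true, Bool.not_not]
    rw [← treeGF_mul_treeGF_not a]
    linear_combination (treeGF N₁ N₂ a * treeGF N₁ N₂ (!a)) ^ 2 * this

lemma nodeGF_self_mul (u a : Bool) : nodeGF N₁ N₂ u a a * (1 - treeProd N₁ N₂) ^ 2 =
    PowerSeries.C (N₁ + N₂) * ((1 - treeProd N₁ N₂) ^ 2 - 1) := by
  linear_combination (1 - treeProd N₁ N₂) ^ 2 * nodeGF_self N₁ N₂ u a -
    PowerSeries.C (N₁ + N₂) * (sectorGF N₁ N₂ (!a) (!a) * (1 - treeProd N₁ N₂)) *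
      sectorGF_self_mul (N₁ := N₁) (N₂ := N₂) a -
    PowerSeries.C (N₁ + N₂) * sectorGF_self_mul (N₁ := N₁) (N₂ := N₂) (!a)

lemma C_share_mul_untiedGF (h₁ : 0 < N₁) (h₂ : 0 < N₂) (a : Bool) :
    PowerSeries.C (share N₁ N₂ a) * untiedGF N₁ N₂ a * (1 - treeProd N₁ N₂) =
      treeGF N₁ N₂ a := by
  rw [← sectorGF_not_eq h₁ h₂, sectorGF_not_mul]

lemma untiedGF_mul (h₁ : 0 < N₁) (h₂ : 0 < N₂) (a : Bool) :
    untiedGF N₁ N₂ a * (1 - treeProd N₁ N₂) =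
      PowerSeries.C (share N₁ N₂ a)⁻¹ * treeGF N₁ N₂ a := by
  have : PowerSeries.C (share N₁ N₂ a)⁻¹ * PowerSeries.C (share N₁ N₂ a) = 1 := by
    rw [← map_mul, inv_mul_cancel₀ (share_pos h₁ h₂ a).ne', map_one]
  linear_combination PowerSeries.C (share N₁ N₂ a)⁻¹ * C_share_mul_untiedGF h₁ h₂ a -
    untiedGF N₁ N₂ a * (1 - treeProd N₁ N₂) * this

/-- A change of the mark by a node; for unitary edges the tied and the untied nodes combine to
`share (!a) / share a = 1 / share a - 1`. -/
lemma nodeGF_not_mul (h₁ : 0 < N₁) (h₂ : 0 < N₂) (u a : Bool) :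
    nodeGF N₁ N₂ u a (!a) * (1 - treeProd N₁ N₂) ^ 2 =
      PowerSeries.C (N₁ + N₂) * markChange N₁ N₂ u a := by
  have hS := sectorGF_not_mul (N₁ := N₁) (N₂ := N₂) a
  cases u
  · have hS' := sectorGF_not_mul (N₁ := N₁) (N₂ := N₂) (!a)
    rw [Bool.not_not] at hS'
    simp only [nodeGF_orthogonal_not, markChange, Bool.false_eq_true, if_false]
    linear_combination -PowerSeries.C (N₁ + N₂) *
      (sectorGF N₁ N₂ (!a) a * (1 - treeProd N₁ N₂) * hS + treeGF N₁ N₂ a * hS' +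
        treeGF_mul_treeGF_not a)
  · have hU := untiedGF_mul h₁ h₂ a
    have hC : PowerSeries.C (channels N₁ N₂ a) * PowerSeries.C (share N₁ N₂ a)⁻¹ ^ 2 =
        PowerSeries.C (N₁ + N₂) * (PowerSeries.C (share N₁ N₂ (!a) / share N₁ N₂ a) + 1) := by
      rw [← map_pow, ← map_mul, ← map_one PowerSeries.C, ← map_add, ← map_mul]
      congr 1
      have h0 := (share_pos h₁ h₂ a).ne'
      have h1 : channels N₁ N₂ a = (N₁ + N₂) * share N₁ N₂ a := by
        rw [share]
        have : N₁ + N₂ ≠ 0 := by positivity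
        field_simp
      rw [h1]
      field_simp
      linear_combination -share_add_share h₁ h₂ a
    rw [nodeGF_unitary_not h₁ h₂]
    simp only [markChange, if_true]
    generalize treeProd N₁ N₂ = h at *
    linear_combination -PowerSeries.C (N₁ + N₂) *
        (sectorGF N₁ N₂ a (!a) * (1 - h) + treeGF N₁ N₂ a) * hS +
      PowerSeries.C (channels N₁ N₂ a) *
        (untiedGF N₁ N₂ a * (1 - h) + PowerSeries.C (share N₁ N₂ a)⁻¹ * treeGF N₁ N₂ a) * hU +
      treeGF N₁ N₂ a ^ 2 * hC

/-- Elimination of the nodes that do not change the mark. -/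
lemma edgeGF_rec (h₁ : 0 < N₁) (h₂ : 0 < N₂) (u a b : Bool) :
    PowerSeries.C (N₁ + N₂) * edgeGF N₁ N₂ u a b =
      (if a = b then (1 - treeProd N₁ N₂) ^ 2 else 0) +
      markChange N₁ N₂ u a * (PowerSeries.C (N₁ + N₂) * edgeGF N₁ N₂ u (!a) b) := by
  have hN : PowerSeries.C (N₁ + N₂) * PowerSeries.C (N₁ + N₂)⁻¹ = 1 := by
    rw [← map_mul, mul_inv_cancel₀ (by positivity), map_one]
  have h := edgeGF_eq N₁ N₂ u a b
  have hsum : ∑ c, nodeGF N₁ N₂ u a c * edgeGF N₁ N₂ u c b =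
      nodeGF N₁ N₂ u a a * edgeGF N₁ N₂ u a b +
        nodeGF N₁ N₂ u a (!a) * edgeGF N₁ N₂ u (!a) b := by
    cases a
    · simp [add_comm]
    · simp
  rw [hsum] at h
  have h1 := nodeGF_self_mul (N₁ := N₁) (N₂ := N₂) u a
  have h2 := nodeGF_not_mul h₁ h₂ u a
  have hite : (if a = b then (1 - treeProd N₁ N₂) ^ 2 else 0) =
      (1 - treeProd N₁ N₂) ^ 2 * if a = b then 1 else 0 := by simp
  rw [hite]
  generalize treeProd N₁ N₂ = x at *
  linear_combination (1 - x) ^ 2 * PowerSeries.C (N₁ + N₂) * h +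
    (1 - x) ^ 2 * ((if a = b then 1 else 0) + (nodeGF N₁ N₂ u a a * edgeGF N₁ N₂ u a b +
        nodeGF N₁ N₂ u a (!a) * edgeGF N₁ N₂ u (!a) b)) * hN +
    edgeGF N₁ N₂ u a b * h1 + edgeGF N₁ N₂ u (!a) b * h2

lemma one_add_treeProd_ne (h₁ : 0 < N₁) (h₂ : 0 < N₂) : 1 + treeProd N₁ N₂ ≠ 0 := fun h => by
  have := congrArg PowerSeries.constantCoeff h
  simp [constantCoeff_treeProd h₁ h₂] at this

lemma one_sub_treeProd_ne (h₁ : 0 < N₁) (h₂ : 0 < N₂) : 1 - treeProd N₁ N₂ ≠ 0 := fun h => by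
  have := congrArg PowerSeries.constantCoeff h
  simp [constantCoeff_treeProd h₁ h₂] at this

/-- Along an edge the mark changes any number of times; two changes give the factor `h ^ 2`, and
`(1 - h ^ 2)⁻¹` combines with the factor `(1 - h) ^ 2` of the recursion. -/
lemma edgeGF_mul (h₁ : 0 < N₁) (h₂ : 0 < N₂) (u a b : Bool) :
    PowerSeries.C (N₁ + N₂) * edgeGF N₁ N₂ u a b * (1 + treeProd N₁ N₂) =
      (1 - treeProd N₁ N₂) * if a = b then 1 else markChange N₁ N₂ u a := by
  have h1 := edgeGF_rec h₁ h₂ u a b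
  have h2 := edgeGF_rec h₁ h₂ u (!a) b
  have h3 := markChange_mul h₁ h₂ u a
  refine mul_left_cancel₀ (one_sub_treeProd_ne h₁ h₂) ?_
  rw [Bool.not_not] at h2
  generalize treeProd N₁ N₂ = x at *
  by_cases hab : a = b
  · subst hab
    simp only [if_true, Bool.not_eq_self, if_false, zero_add] at h1 h2 ⊢
    linear_combination h1 + markChange N₁ N₂ u a * h2 +
      PowerSeries.C (N₁ + N₂) * edgeGF N₁ N₂ u a a * h3
  · obtain rfl : b = !a := by revert hab; cases a <;> cases b <;> simp
    simp only [if_true, Bool.eq_not_self, if_false, zero_add] at h1 h2 ⊢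
    linear_combination h1 + markChange N₁ N₂ u a * h2 +
      PowerSeries.C (N₁ + N₂) * edgeGF N₁ N₂ u a (!a) * h3

end Relations

/-! ### Reduction to a sum over the marks of the first sides of the edges -/

section Marks

variable {m : ℕ} {B : BaseStructure m}

/-- The edges of `B` are numbered: `s (i, false)` and `s (i, true)` are the first and the second
side of edge `i`, and `u i` tells whether it is unitary. -/
structure BaseStructure.EdgeNumbering (B : BaseStructure m) (s : Fin m × Bool ≃ Fin (2 * m))
    (u : Fin m → Bool) : Prop where
  lt : ∀ i, s (i, false) < s (i, true)
  ε_first : ∀ i, B.ε (s (i, false), false) = (s (i, true), !(u i))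

variable {s : Fin m × Bool ≃ Fin (2 * m)} {u : Fin m → Bool}

lemma BaseStructure.EdgeNumbering.ε_first' (h : B.EdgeNumbering s u) (i : Fin m) (b : Bool) :
    B.ε (s (i, false), b) = (s (i, true), xor b !(u i)) := by
  cases b
  · simpa using h.ε_first i
  · rw [B.ε_true, h.ε_first]; simp [rev]

lemma BaseStructure.EdgeNumbering.ε_second (h : B.EdgeNumbering s u) (i : Fin m) (b : Bool) :
    B.ε (s (i, true), b) = (s (i, false), xor b !(u i)) := by
  have h1 := B.invol (s (i, false), xor b !(u i))
  rw [h.ε_first'] at h1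
  cases b <;> cases hu : u i <;> simpa [hu] using h1

/-- The marks of all sides, if `g i false` and `g i true` are the marks of the first side of edge
`i` at its start and end. -/
def markOf (s : Fin m × Bool ≃ Fin (2 * m)) (u : Fin m → Bool) (g : Fin m → Bool → Bool)
    (x : Side m) : Bool :=
  if (s.symm x.1).2 then !(g (s.symm x.1).1 (xor x.2 (u (s.symm x.1).1)))
  else g (s.symm x.1).1 x.2

lemma markOf_first (g : Fin m → Bool → Bool) (i : Fin m) (b : Bool) :
    markOf s u g (s (i, false), b) = g i b := by
  simp [markOf]

lemma markOf_second (g : Fin m → Bool → Bool) (i : Fin m) (b : Bool) :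
    markOf s u g (s (i, true), b) = !(g i (xor b (u i))) := by
  simp [markOf]

/-- The marks of the first sides determine those of the second sides. -/
lemma BaseStructure.EdgeNumbering.sum_marks (h : B.EdgeNumbering s u) {M : Type*}
    [AddCommMonoid M] (F : (Side m → Bool) → M) :
    (∑ mk : Side m → Bool, if ∀ y, mk (rev (B.ε y)) = !(mk y) then F mk else 0) =
      ∑ g : Fin m → Bool → Bool, F (markOf s u g) := by
  rw [← Finset.sum_filter]
  refine Finset.sum_bij' (fun mk _ i b => mk (s (i, false), b)) (fun g _ => markOf s u g)
    (fun _ _ => Finset.mem_univ _) ?_ ?_ ?_ ?_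
  · intro g _
    simp only [Finset.mem_filter, Finset.mem_univ, true_and]
    rintro ⟨z, b⟩
    obtain ⟨⟨i, c⟩, rfl⟩ := s.surjective z
    cases c
    · rw [h.ε_first', rev, markOf_second, markOf_first]
      cases u i <;> simp
    · rw [h.ε_second, rev, markOf_second, markOf_first]
      cases u i <;> simp
  · intro mk hmk
    simp only [Finset.mem_filter, Finset.mem_univ, true_and] at hmk
    funext ⟨z, b⟩
    obtain ⟨⟨i, c⟩, rfl⟩ := s.surjective z
    cases c
    · rw [markOf_first]
    · rw [markOf_second, ← hmk, h.ε_first', rev]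
      cases u i <;> simp
  · intro g _
    funext i b
    exact markOf_first g i b
  · intro mk hmk
    simp only [Finset.mem_filter, Finset.mem_univ, true_and] at hmk
    congr 1
    funext ⟨z, b⟩
    obtain ⟨⟨i, c⟩, rfl⟩ := s.surjective z
    cases c
    · rw [markOf_first]
    · rw [markOf_second, ← hmk, h.ε_first', rev]
      cases u i <;> simp

lemma BaseStructure.EdgeNumbering.prod_edges (h : B.EdgeNumbering s u) {M : Type*}
    [CommMonoid M] (F : Fin (2 * m) → M) :
    ∏ e : B.Edge, F e.1 = ∏ i, F (s (i, false)) := by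
  symm
  refine Fintype.prod_bijective (fun i => ⟨s (i, false), by rw [h.ε_first]; exact h.lt i⟩)
    ⟨fun i j hij => ?_, fun ⟨z, hz⟩ => ?_⟩ _ _ fun _ => rfl
  · simpa using hij
  · obtain ⟨⟨i, c⟩, rfl⟩ := s.surjective z
    cases c
    · exact ⟨i, rfl⟩
    · rw [h.ε_second] at hz
      exact absurd (h.lt i) (lt_asymm hz)

lemma BaseStructure.EdgeNumbering.unitaryEdge (h : B.EdgeNumbering s u) (i : Fin m) :
    B.unitaryEdge (s (i, false)) = u i := by
  rw [BaseStructure.unitaryEdge, h.ε_first]; simp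

end Marks

/-! The factors of edges and corners, divided by their values in the case that the mark does not
change, and the resulting factors of vertices. They depend on the values `f` of the tree generating
functions, the shares `p` of the channels and the weights `q` of changes of the mark on edges. -/

section Reduced

variable {R : Type*} [CommRing R] (f p p' : Bool → R) (q : Bool → Bool → R)

/-- Factor of an edge whose first side has mark `a` at its start and `b` at its end. -/
def reducedEdge (u a b : Bool) : R := if a = b then 1 else q u a

/-- Factor of a corner entered with mark `a` and left with mark `b`, at a tied vertex. -/
def reducedCorner (a b : Bool) : R := if a = b then 1 else f a

/-- Factor of a corner at a vertex untied in the lead `c`. -/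
def untiedCorner (c a b : Bool) : R := if a = c ∧ b = !c then p' c * f c else 0

/-- Factor of a vertex with corners `v`, if corner `z` has the marks `k (z, true)` and
`k (z + 1, false)`. Here `p' c` is the inverse of `p c`. -/
def reducedVertex {m : ℕ} (k : Side m → Bool) (v : List (Fin (2 * m))) : R :=
  -(v.map fun z => reducedCorner f (k (z, true)) (k (finRotate (2 * m) z, false))).prod +
    ∑ c, p c *
      (v.map fun z => untiedCorner f p' c (k (z, true)) (k (finRotate (2 * m) z, false))).prod

/-- The sum over the marks of the products of the reduced factors of edges and vertices. -/
def reducedSum {m : ℕ} (s : Fin m × Bool ≃ Fin (2 * m)) (u : Fin m → Bool)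
    (V : List (List (Fin (2 * m)))) : R :=
  ∑ g : Fin m → Bool → Bool, (∏ i, reducedEdge q (u i) (g i false) (g i true)) *
    (V.map fun v => reducedVertex f p p' (markOf s u g) v).prod

end Reduced

section GenusOne

variable {N₁ N₂ : ℝ} {m : ℕ} {B : BaseStructure m} {s : Fin m × Bool ≃ Fin (2 * m)}
  {u : Fin m → Bool}

lemma sectorGF_mul (a b : Bool) : sectorGF N₁ N₂ a b * (1 - treeProd N₁ N₂) =
    reducedCorner (treeGF N₁ N₂) a b := by
  by_cases hab : a = b
  · subst hab
    simp [reducedCorner, sectorGF_self_mul]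
  · obtain rfl : b = !a := by revert hab; cases a <;> cases b <;> simp
    simp [reducedCorner, sectorGF_not_mul]

/-- Every corner of a vertex, tied or untied, brings a factor `(1 - h)⁻¹`. -/
lemma vertex_mul (h₁ : 0 < N₁) (h₂ : 0 < N₂) (k : Side m → Bool) {v : List (Fin (2 * m))}
    (hv : v.Nodup) :
    (∑ κ, PowerSeries.C (vertexFactor N₁ N₂ κ) *
        ∏ z ∈ v.toFinset, cornerGF N₁ N₂ (k (z, true)) (k (finRotate (2 * m) z, false)) κ) *
      (1 - treeProd N₁ N₂) ^ v.toFinset.card =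
    PowerSeries.C (N₁ + N₂) * reducedVertex (treeGF N₁ N₂)
      (fun a => PowerSeries.C (share N₁ N₂ a)) (fun a => PowerSeries.C (share N₁ N₂ a)⁻¹) k v := by
  simp only [reducedVertex, ← List.prod_toFinset _ hv]
  rw [Fintype.sum_option, add_mul, Finset.sum_mul, mul_add, Finset.mul_sum]
  congr 1
  · rw [mul_assoc, ← Finset.prod_const, ← Finset.prod_mul_distrib]
    simp only [cornerGF, sectorGF_mul, vertexFactor, map_neg]
    ring
  · refine Finset.sum_congr rfl fun c _ => ?_
    rw [mul_assoc, ← Finset.prod_const, ← Finset.prod_mul_distrib, ← mul_assoc, ← map_mul]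
    have hc : (N₁ + N₂) * share N₁ N₂ c = channels N₁ N₂ c := by
      have : N₁ + N₂ ≠ 0 := by positivity
      rw [share]; field_simp
    rw [hc]
    congr 1
    refine Finset.prod_congr rfl fun z _ => ?_
    rw [cornerGF, untiedCorner, ite_mul, zero_mul, untiedGF_mul h₁ h₂]

/-- The generating function of the graftings on a base structure of genus one, up to a factor that
depends on the number of edges only, is the sum over the marks of the reduced factors. -/
theorem gf_grafting_mul (h₁ : 0 < N₁) (h₂ : 0 < N₂) (h : B.EdgeNumbering s u)
    (hg : B.twoGenus = 2) {V : List (List (Fin (2 * m)))}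
    (hV' : B.vertices = (V.map List.toFinset).toFinset) (hnd : (V.map List.toFinset).Nodup)
    (hnd' : ∀ v ∈ V, v.Nodup) :
    gf (Grafting.leaves (B := B)) (fun G => G.weight N₁ N₂) * PowerSeries.C (N₁ + N₂) *
        ((1 - treeProd N₁ N₂) * (1 + treeProd N₁ N₂)) ^ m =
      reducedSum (treeGF N₁ N₂) (fun a => PowerSeries.C (share N₁ N₂ a))
        (fun a => PowerSeries.C (share N₁ N₂ a)⁻¹) (markChange N₁ N₂) s u V := by
  have hV := B.twoGenus_eq_two_iff.1 hg
  have hN : PowerSeries.C (N₁ + N₂) ≠ 0 := by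
    rw [Ne, map_eq_zero_iff _ PowerSeries.C_injective]
    positivity
  refine mul_left_cancel₀ (pow_ne_zero m (one_sub_treeProd_ne h₁ h₂)) ?_
  refine mul_left_cancel₀ (pow_ne_zero B.vertices.card hN) ?_
  have key : gf (Grafting.leaves (B := B)) (fun G => G.weight N₁ N₂) *
      ((PowerSeries.C (N₁ + N₂) * (1 + treeProd N₁ N₂)) ^ m * (1 - treeProd N₁ N₂) ^ (2 * m)) =
      (PowerSeries.C (N₁ + N₂)) ^ B.vertices.card * ((1 - treeProd N₁ N₂) ^ m *
      reducedSum (treeGF N₁ N₂) (fun a => PowerSeries.C (share N₁ N₂ a))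
        (fun a => PowerSeries.C (share N₁ N₂ a)⁻¹) (markChange N₁ N₂) s u V) := by
    rw [gf_grafting B h₁ h₂, h.sum_marks, reducedSum, Finset.sum_mul, ← mul_assoc, Finset.mul_sum]
    refine Finset.sum_congr rfl fun g _ => ?_
    have hE : (∏ e : B.Edge, edgeGF N₁ N₂ (B.unitaryEdge e.1) (markOf s u g (e.1, false))
        (markOf s u g (e.1, true))) * (PowerSeries.C (N₁ + N₂) * (1 + treeProd N₁ N₂)) ^ m =
        (1 - treeProd N₁ N₂) ^ m *
          ∏ i, reducedEdge (markChange N₁ N₂) (u i) (g i false) (g i true) := by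
      rw [h.prod_edges fun z => edgeGF N₁ N₂ (B.unitaryEdge z) (markOf s u g (z, false))
        (markOf s u g (z, true))]
      have hm : ∀ x : PowerSeries ℝ, x ^ m = ∏ _i : Fin m, x := fun x => by simp
      rw [hm, hm, ← Finset.prod_mul_distrib, ← Finset.prod_mul_distrib]
      refine Finset.prod_congr rfl fun i _ => ?_
      rw [h.unitaryEdge, markOf_first, markOf_first, reducedEdge, ← edgeGF_mul h₁ h₂]
      ring
    have hVert : (∏ v ∈ B.vertices, ∑ κ, PowerSeries.C (vertexFactor N₁ N₂ κ) *
        ∏ z ∈ v, cornerGF N₁ N₂ (markOf s u g (z, true))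
          (markOf s u g (finRotate (2 * m) z, false)) κ) * (1 - treeProd N₁ N₂) ^ (2 * m) =
        PowerSeries.C (N₁ + N₂) ^ B.vertices.card * (V.map fun v =>
          reducedVertex (treeGF N₁ N₂) (fun a => PowerSeries.C (share N₁ N₂ a))
            (fun a => PowerSeries.C (share N₁ N₂ a)⁻¹) (markOf s u g) v).prod := by
      have hcard : (1 - treeProd N₁ N₂) ^ (2 * m) =
          ∏ v ∈ B.vertices, (1 - treeProd N₁ N₂) ^ v.card := by
        rw [Finset.prod_pow_eq_pow_sum]
        exact congrArg _ B.sum_card_vertices.symm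
      rw [hcard, ← Finset.prod_mul_distrib]
      have hlen : B.vertices.card = V.length := by
        rw [hV', List.toFinset_card_of_nodup hnd, List.length_map]
      have hC : PowerSeries.C (N₁ + N₂) ^ V.length =
          (V.map fun _ => PowerSeries.C (N₁ + N₂)).prod := by simp
      rw [hlen, hV', List.prod_toFinset _ hnd, List.map_map, hC, ← List.prod_map_mul]
      exact congrArg List.prod (List.map_congr_left fun v hv => vertex_mul h₁ h₂ _ (hnd' v hv))
    linear_combination (∏ v ∈ B.vertices, ∑ κ, PowerSeries.C (vertexFactor N₁ N₂ κ) *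
        ∏ z ∈ v, cornerGF N₁ N₂ (markOf s u g (z, true))
          (markOf s u g (finRotate (2 * m) z, false)) κ) * (1 - treeProd N₁ N₂) ^ (2 * m) * hE +
      (1 - treeProd N₁ N₂) ^ m *
          (∏ i, reducedEdge (markChange N₁ N₂) (u i) (g i false) (g i true)) * hVert
  rw [← key]
  have hm : PowerSeries.C (N₁ + N₂) ^ m =
      PowerSeries.C (N₁ + N₂) ^ B.vertices.card * PowerSeries.C (N₁ + N₂) := by
    rw [← pow_succ, hV]
  have h2 : (1 - treeProd N₁ N₂) ^ (2 * m) =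
      (1 - treeProd N₁ N₂) ^ m * (1 - treeProd N₁ N₂) ^ m := by rw [two_mul, pow_add]
  rw [mul_pow _ _ m, mul_pow _ _ m, hm, h2]
  ring

end GenusOne

/-! ### Evaluation for the base structures of genus one -/

/-- A sum over functions on `Bool` as an iterated sum. -/
lemma sum_bool_fun {M : Type*} [AddCommMonoid M] (F : (Bool → Bool) → M) :
    ∑ g, F g = ∑ a, ∑ b, F fun c => cond c b a := by
  rw [← Fintype.sum_prod_type' (f := fun a b => F fun c => cond c b a)]
  refine Fintype.sum_equiv (Equiv.boolArrowEquivProd Bool) _ _ fun g => congrArg F ?_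
  funext c
  cases c <;> rfl

/-- A sum over functions on `Fin (n + 1)` splits off the first value. -/
lemma sum_fin_fun {M α : Type*} [AddCommMonoid M] [Fintype α] {n : ℕ}
    (F : (Fin (n + 1) → α) → M) : ∑ g, F g = ∑ a, ∑ g, F (Matrix.vecCons a g) := by
  rw [← Fintype.sum_prod_type' (f := fun a g => F (Matrix.vecCons a g))]
  exact (Fintype.sum_equiv (Fin.consEquiv fun _ => α) _ _ fun g => rfl).symm

/-- First and second sides of the edges of the base structures with two edges. -/
def sidesTwo : Fin 5 → Fin 2 → Fin (2 * 2) × Fin (2 * 2) := ![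
  ![(0, 2), (1, 3)], ![(0, 1), (2, 3)], ![(0, 3), (1, 2)], ![(0, 2), (1, 3)], ![(0, 2), (1, 3)]]

/-- Position of the sides among the edges, inverse to `sidesTwo`. -/
def edgesTwo : Fin 5 → Fin (2 * 2) → Fin 2 × Bool := ![
  ![(0, false), (1, false), (0, true), (1, true)],
  ![(0, false), (0, true), (1, false), (1, true)],
  ![(0, false), (1, false), (1, true), (0, true)],
  ![(0, false), (1, false), (0, true), (1, true)],
  ![(0, false), (1, false), (0, true), (1, true)]]

/-- Which edges are unitary. -/
def unitaryTwo : Fin 5 → Fin 2 → Bool := ![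
  ![true, true], ![false, false], ![false, false], ![true, false], ![false, true]]

/-- The correspondence between the pairs of an edge and a choice of its first (`false`) or second
(`true`) side, and the sides, for the base structures with two edges. -/
def numberingTwo (i : Fin 5) : Fin 2 × Bool ≃ Fin (2 * 2) where
  toFun x := cond x.2 (sidesTwo i x.1).2 (sidesTwo i x.1).1
  invFun := edgesTwo i
  left_inv := by unfold Function.LeftInverse; revert i; decide
  right_inv := by unfold Function.RightInverse Function.LeftInverse; revert i; decide

lemma edgeNumberingTwo (i : Fin 5) :
    (BaseStructure.genusOneTwo i).EdgeNumbering (numberingTwo i) (unitaryTwo i) where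
  lt := by revert i; decide
  ε_first := by revert i; decide

/-- First and second sides of the edges of the base structures with three edges. -/
def sidesThree : Fin 7 → Fin 3 → Fin (2 * 3) × Fin (2 * 3) := ![
  ![(0, 3), (1, 4), (2, 5)], ![(0, 2), (1, 4), (3, 5)], ![(0, 3), (1, 5), (2, 4)],
  ![(0, 4), (1, 3), (2, 5)], ![(0, 1), (2, 5), (3, 4)], ![(0, 3), (1, 2), (4, 5)],
  ![(0, 5), (1, 4), (2, 3)]]

/-- Position of the sides among the edges, inverse to `sidesThree`. -/
def edgesThree : Fin 7 → Fin (2 * 3) → Fin 3 × Bool := ![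
  ![(0, false), (1, false), (2, false), (0, true), (1, true), (2, true)],
  ![(0, false), (1, false), (0, true), (2, false), (1, true), (2, true)],
  ![(0, false), (1, false), (2, false), (0, true), (2, true), (1, true)],
  ![(0, false), (1, false), (2, false), (1, true), (0, true), (2, true)],
  ![(0, false), (0, true), (1, false), (2, false), (2, true), (1, true)],
  ![(0, false), (1, false), (1, true), (0, true), (2, false), (2, true)],
  ![(0, false), (1, false), (2, false), (2, true), (1, true), (0, true)]]

/-- Which edges are unitary. -/
def unitaryThree : Fin 7 → Fin 3 → Bool := ![
  ![true, true, true], ![false, true, false], ![true, false, false], ![false, false, true],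
  ![false, true, false], ![true, false, false], ![false, true, false]]

/-- The corners around the two vertices. -/
def verticesThree : Fin 7 → List (List (Fin (2 * 3))) := ![
  [[0, 2, 4], [1, 3, 5]], [[0, 2, 4], [1, 3, 5]], [[0, 2, 4], [1, 3, 5]], [[0, 2, 4], [1, 3, 5]],
  [[0, 1, 5], [2, 3, 4]], [[0, 1, 2], [3, 4, 5]], [[0, 4, 5], [1, 2, 3]]]

/-- The analogue of `numberingTwo` for the base structures with three edges. -/
def numberingThree (i : Fin 7) : Fin 3 × Bool ≃ Fin (2 * 3) where
  toFun x := cond x.2 (sidesThree i x.1).2 (sidesThree i x.1).1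
  invFun := edgesThree i
  left_inv := by unfold Function.LeftInverse; revert i; decide
  right_inv := by unfold Function.RightInverse Function.LeftInverse; revert i; decide

lemma edgeNumberingThree (i : Fin 7) :
    (BaseStructure.genusOneThree i).EdgeNumbering (numberingThree i) (unitaryThree i) where
  lt := by revert i; decide
  ε_first := by revert i; decide

lemma verticesThree_eq (i : Fin 7) : (BaseStructure.genusOneThree i).vertices =
    ((verticesThree i).map List.toFinset).toFinset := by
  rw [BaseStructure.vertices_genusOneThree]
  revert i; decide

section Evaluation

variable {K : Type*} [Field K]

/-- The relations between the tree generating functions `f`, the shares `p` of the channels and the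
weights `q` of changes of marks, in terms of which the reduced sums are rational functions; `p'` is
the inverse of `p`. By `p_mul` everything is a rational function of `f true` and `f false`. -/
structure TreeRelations (f p p' : Bool → K) (q : Bool → Bool → K) : Prop where
  add_ne : f true + f false ≠ 0
  one_sub_ne : 1 - f true * f false ≠ 0
  p_ne : ∀ a, p a ≠ 0
  p_mul : ∀ a, p a * ((f true + f false) * (1 - f true * f false)) = f a * (1 - f (!a) ^ 2)
  p'_mul : ∀ a, p' a * p a = 1
  q_true : ∀ a, q true a = p' a * p (!a) * f a ^ 2
  q_false : ∀ a, q false a = -(f true * f false)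

/-- Numerators of the generating functions of the base structures with two edges, over the common
denominator `ξ (h - 1) (h + 1) ^ 2`. -/
def numeratorTwo {R : Type*} [CommRing R] (h ξ : R) : Fin 5 → R := ![
  -2 * (h ^ 2 * ξ - 2 * h ^ 2 + h * ξ - 2 * h - 2 * ξ) * h,
  2 * ξ * h - 2 * ξ * h ^ 2, 2 * ξ * h - 2 * ξ * h ^ 2,
  2 * ξ * h + 2 * h ^ 2 - 2 * ξ * h ^ 2, 2 * ξ * h + 2 * h ^ 2 - 2 * ξ * h ^ 2]

/-- Numerators of the generating functions of the base structures with three edges, over the common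
denominator `ξ (h - 1) (h + 1) ^ 3`. -/
def numeratorThree {R : Type*} [CommRing R] (h ξ : R) : Fin 7 → R := ![
  (2 * h ^ 3 * ξ - 5 * h ^ 3 + 4 * h ^ 2 * ξ - 10 * h ^ 2 - 6 * h - 6 * ξ) * h,
  -4 * ξ * h - 3 * h ^ 2 + 2 * ξ * h ^ 2 - 2 * h ^ 3 + 2 * ξ * h ^ 3,
  -4 * ξ * h - 3 * h ^ 2 + 2 * ξ * h ^ 2 - 2 * h ^ 3 + 2 * ξ * h ^ 3,
  -4 * ξ * h - 3 * h ^ 2 + 2 * ξ * h ^ 2 - 2 * h ^ 3 + 2 * ξ * h ^ 3,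
  -2 * ξ * h - h ^ 2 + 2 * ξ * h ^ 2, -2 * ξ * h - h ^ 2 + 2 * ξ * h ^ 2,
  -2 * ξ * h - h ^ 2 + 2 * ξ * h ^ 2]

lemma finRotate_four : ∀ z, finRotate (2 * 2) z = ![1, 2, 3, 0] z := by decide

lemma finRotate_six : ∀ z, finRotate (2 * 3) z = ![1, 2, 3, 4, 5, 0] z := by decide

variable {f p p' : Bool → K} {q : Bool → Bool → K}

namespace TreeRelations

lemma p_eq (h : TreeRelations f p p' q) (a : Bool) :
    p a = f a * (1 - f (!a) ^ 2) / ((f true + f false) * (1 - f true * f false)) :=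
  eq_div_of_mul_eq (mul_ne_zero h.add_ne h.one_sub_ne) (h.p_mul a)

lemma p'_eq (h : TreeRelations f p p' q) (a : Bool) : p' a = (p a)⁻¹ :=
  eq_inv_of_mul_eq_one_left (h.p'_mul a)

lemma f_ne (h : TreeRelations f p p' q) (a : Bool) : f a ≠ 0 := fun h0 =>
  h.p_ne a (by rw [h.p_eq, h0, zero_mul, zero_div])

lemma one_sub_sq_ne (h : TreeRelations f p p' q) (a : Bool) : 1 - f a ^ 2 ≠ 0 := fun h0 =>
  h.p_ne (!a) (by rw [h.p_eq, Bool.not_not, h0, mul_zero, zero_div])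

end TreeRelations

set_option maxHeartbeats 4000000 in
/-- The sum over the sixteen choices of marks, with `p` eliminated in favour of `f`. -/
lemma reducedSum_two (h : TreeRelations f p p' q) (i : Fin 5) :
    reducedSum f p p' q (numberingTwo i) (unitaryTwo i) [[0, 1, 2, 3]] *
      (p true * p false * (f true * f false - 1)) =
    (1 - f true * f false) ^ 2 * numeratorTwo (f true * f false) (p true * p false) i := by
  have h1 := h.add_ne
  have h2 := h.one_sub_ne
  have hx' := h.p_eq true
  have hy' := h.p_eq false
  rw [Bool.not_true] at hx'
  rw [Bool.not_false] at hy'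
  have hx0 := h.f_ne true
  have hy0 := h.f_ne false
  have hx1 := h.one_sub_sq_ne true
  have hy1 := h.one_sub_sq_ne false
  fin_cases i <;>
  simp only [Fin.zero_eta, Fin.mk_one, Fin.reduceFinMk, reducedSum, sum_fin_fun, sum_bool_fun,
    Fintype.sum_unique, Fin.prod_univ_two, reducedVertex, List.map_cons, List.map_nil,
    List.prod_cons, List.prod_nil, finRotate_four, markOf, numberingTwo,
    Equiv.coe_fn_symm_mk, edgesTwo, unitaryTwo, Matrix.cons_val_zero, Matrix.cons_val_one,
    Matrix.cons_val, Fintype.sum_bool, cond_true, cond_false, Bool.not_true, Bool.not_false,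
    reducedEdge, reducedCorner, untiedCorner, if_true, if_false, Bool.true_eq_false,
    Bool.false_eq_true, Bool.true_xor, Bool.false_xor, and_true, true_and, and_false, false_and,
    mul_zero, zero_mul, one_mul, mul_one, add_zero, zero_add, h.q_false, h.q_true, h.p'_eq,
    numeratorTwo]
  all_goals rw [hx', hy']
  all_goals field_simp
  all_goals ring

set_option maxHeartbeats 4000000 in
/-- The sum over the sixty-four choices of marks, with `p` eliminated in favour of `f`. -/
lemma reducedSum_three (h : TreeRelations f p p' q) (i : Fin 7) :
    reducedSum f p p' q (numberingThree i) (unitaryThree i) (verticesThree i) *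
      (p true * p false * (f true * f false - 1)) =
    (1 - f true * f false) ^ 3 * numeratorThree (f true * f false) (p true * p false) i := by
  have h1 := h.add_ne
  have h2 := h.one_sub_ne
  have hx' := h.p_eq true
  have hy' := h.p_eq false
  rw [Bool.not_true] at hx'
  rw [Bool.not_false] at hy'
  have hx0 := h.f_ne true
  have hy0 := h.f_ne false
  have hx1 := h.one_sub_sq_ne true
  have hy1 := h.one_sub_sq_ne false
  fin_cases i <;>
  simp only [Fin.zero_eta, Fin.mk_one, Fin.reduceFinMk, reducedSum, sum_fin_fun, sum_bool_fun,
    Fintype.sum_unique, Fin.prod_univ_three, reducedVertex, List.map_cons, List.map_nil,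
    List.prod_cons, List.prod_nil, finRotate_six, verticesThree, markOf, numberingThree,
    Equiv.coe_fn_symm_mk, edgesThree, unitaryThree, Matrix.cons_val_zero, Matrix.cons_val_one,
    Matrix.cons_val, Fintype.sum_bool, cond_true, cond_false, Bool.not_true, Bool.not_false,
    reducedEdge, reducedCorner, untiedCorner, if_true, if_false, Bool.true_eq_false,
    Bool.false_eq_true, Bool.true_xor, Bool.false_xor, and_true, true_and, and_false, false_and,
    mul_zero, zero_mul, one_mul, mul_one, add_zero, zero_add, h.q_false, h.q_true, h.p'_eq,
    numeratorThree]
  all_goals rw [hx', hy']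
  all_goals field_simp
  all_goals first | ring1 | (field_simp; ring1)

end Evaluation

section

variable {N₁ N₂ : ℝ}

lemma map_reducedSum {R S : Type*} [CommRing R] [CommRing S] (φ : R →+* S) (f p p' : Bool → R)
    (q : Bool → Bool → R) {m : ℕ} (s : Fin m × Bool ≃ Fin (2 * m)) (u : Fin m → Bool)
    (V : List (List (Fin (2 * m)))) :
    φ (reducedSum f p p' q s u V) = reducedSum (fun a => φ (f a)) (fun a => φ (p a))
      (fun a => φ (p' a)) (fun b a => φ (q b a)) s u V := by
  simp only [reducedSum, reducedVertex, reducedEdge, reducedCorner, untiedCorner, map_sum, map_mul,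
    map_prod, map_list_prod, List.map_map, Function.comp_def, map_add, map_neg, apply_ite φ,
    map_one, map_zero]

lemma map_numeratorTwo {R S : Type*} [CommRing R] [CommRing S] (φ : R →+* S) (h ξ : R)
    (i : Fin 5) : φ (numeratorTwo h ξ i) = numeratorTwo (φ h) (φ ξ) i := by
  have h2 : φ 2 = 2 := map_ofNat φ 2
  fin_cases i <;> simp [numeratorTwo, h2]

lemma map_numeratorThree {R S : Type*} [CommRing R] [CommRing S] (φ : R →+* S) (h ξ : R)
    (i : Fin 7) : φ (numeratorThree h ξ i) = numeratorThree (φ h) (φ ξ) i := by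
  have h2 : φ 2 = 2 := map_ofNat φ 2
  have h3 : φ 3 = 3 := map_ofNat φ 3
  have h4 : φ 4 = 4 := map_ofNat φ 4
  have h5 : φ 5 = 5 := map_ofNat φ 5
  have h6 : φ 6 = 6 := map_ofNat φ 6
  have h10 : φ 10 = 10 := map_ofNat φ 10
  fin_cases i <;> simp [numeratorThree, h2, h3, h4, h5, h6, h10]

/-- The product of the two equations `treeGF_eq`. -/
lemma treeProd_quadratic (h₁ : 0 < N₁) (h₂ : 0 < N₂) :
    PowerSeries.X ^ 2 * PowerSeries.C (share N₁ N₂ true * share N₁ N₂ false) *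
      (1 - treeProd N₁ N₂) ^ 2 = treeProd N₁ N₂ * (1 - PowerSeries.X ^ 2) := by
  have h1 := treeGF_eq h₁ h₂ true
  have h2 := treeGF_eq h₁ h₂ false
  have h3 := congrArg (PowerSeries.C (R := ℝ)) (share_add_share h₁ h₂ true)
  have h4 : treeGF N₁ N₂ true * treeGF N₁ N₂ false = treeProd N₁ N₂ := rfl
  rw [map_add, map_one, Bool.not_true] at h3
  rw [map_mul]
  generalize treeProd N₁ N₂ = h at *
  generalize treeGF N₁ N₂ true = x at *
  generalize treeGF N₁ N₂ false = y at *
  linear_combination -y * h1 - PowerSeries.X * (h + PowerSeries.C (share N₁ N₂ true) * (1 - h)) * h2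
    + h4 - PowerSeries.X ^ 2 * h * (1 - h) * h3

/-- The relations hold in every field that contains the power series. -/
lemma treeRelations (h₁ : 0 < N₁) (h₂ : 0 < N₂) {K : Type*} [Field K]
    (φ : PowerSeries ℝ →+* K) (hφ : Function.Injective φ) :
    TreeRelations (fun a => φ (treeGF N₁ N₂ a)) (fun a => φ (PowerSeries.C (share N₁ N₂ a)))
      (fun a => φ (PowerSeries.C (share N₁ N₂ a)⁻¹)) (fun u a => φ (markChange N₁ N₂ u a)) where
  add_ne := by
    rw [← map_add, map_ne_zero_iff φ hφ, ← Bool.not_true, treeGF_add_treeGF h₁ h₂]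
    exact mul_ne_zero PowerSeries.X_ne_zero (one_add_treeProd_ne h₁ h₂)
  one_sub_ne := by
    rw [← map_mul, ← map_one φ, ← map_sub, map_ne_zero_iff φ hφ]
    exact one_sub_treeProd_ne h₁ h₂
  p_ne a := by
    rw [map_ne_zero_iff φ hφ, map_ne_zero_iff _ PowerSeries.C_injective]
    exact (share_pos h₁ h₂ a).ne'
  p_mul a := by
    have h1 := treeGF_eq h₁ h₂ a
    have h2 := treeGF_add_treeGF h₁ h₂ a
    have h3 := treeGF_mul_treeGF_not (N₁ := N₁) (N₂ := N₂) a
    have h4 : treeGF N₁ N₂ true * treeGF N₁ N₂ false = treeProd N₁ N₂ := rfl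
    have h5 : treeGF N₁ N₂ true + treeGF N₁ N₂ false = treeGF N₁ N₂ a + treeGF N₁ N₂ (!a) := by
      cases a
      · exact add_comm _ _
      · rfl
    rw [← map_add, ← map_mul, ← map_one φ, ← map_sub, ← map_mul, ← map_mul, ← map_pow, ← map_sub,
      ← map_mul, h4, h5]
    congr 1
    generalize treeProd N₁ N₂ = h at *
    generalize treeGF N₁ N₂ a = x at *
    generalize treeGF N₁ N₂ (!a) = y at *
    -- `x (1 + h) = X (1 + h) (h + p (1 - h)) = (x + y) (h + p (1 - h))`
    linear_combination -(1 + h) * h1 + (h + PowerSeries.C (share N₁ N₂ a) * (1 - h)) * h2 + y * h3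
  p'_mul a := by
    rw [← map_mul, ← map_mul, inv_mul_cancel₀ (share_pos h₁ h₂ a).ne', map_one, map_one]
  q_true a := by
    rw [markChange, if_pos rfl, div_eq_inv_mul, map_mul, map_mul, map_mul, map_pow]
  q_false a := by
    simp [markChange, treeProd]

/-- The generating function of the graftings on a base structure of genus one with edge numbering
is determined by an evaluation of the reduced sum in fields. -/
lemma gf_grafting_of_reducedSum (h₁ : 0 < N₁) (h₂ : 0 < N₂) {m : ℕ} {B : BaseStructure m}
    {s : Fin m × Bool ≃ Fin (2 * m)} {u : Fin m → Bool} (h : B.EdgeNumbering s u)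
    (hg : B.twoGenus = 2) {V : List (List (Fin (2 * m)))}
    (hV : B.vertices = (V.map List.toFinset).toFinset) (hnd : (V.map List.toFinset).Nodup)
    (hnd' : ∀ v ∈ V, v.Nodup) {num : PowerSeries ℝ}
    (hsum : reducedSum (treeGF N₁ N₂) (fun a => PowerSeries.C (share N₁ N₂ a))
        (fun a => PowerSeries.C (share N₁ N₂ a)⁻¹) (markChange N₁ N₂) s u V *
      (PowerSeries.C (share N₁ N₂ true * share N₁ N₂ false) * (treeProd N₁ N₂ - 1)) =
        (1 - treeProd N₁ N₂) ^ m * num) :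
    PowerSeries.C (N₁ + N₂) * gf (Grafting.leaves (B := B)) (fun G => G.weight N₁ N₂) *
      (PowerSeries.C (share N₁ N₂ true * share N₁ N₂ false) * (treeProd N₁ N₂ - 1) *
        (treeProd N₁ N₂ + 1) ^ m) = num := by
  have key := gf_grafting_mul h₁ h₂ h hg hV hnd hnd'
  refine mul_left_cancel₀ (pow_ne_zero m (one_sub_treeProd_ne h₁ h₂)) ?_
  rw [← hsum, ← key, mul_pow, add_comm (treeProd N₁ N₂) 1]
  ring

lemma gf_genusOneTwo (h₁ : 0 < N₁) (h₂ : 0 < N₂) (i : Fin 5) :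
    PowerSeries.C (N₁ + N₂) * gf (Grafting.leaves (B := BaseStructure.genusOneTwo i))
      (fun G => G.weight N₁ N₂) *
      (PowerSeries.C (share N₁ N₂ true * share N₁ N₂ false) * (treeProd N₁ N₂ - 1) *
        (treeProd N₁ N₂ + 1) ^ 2) =
      numeratorTwo (treeProd N₁ N₂) (PowerSeries.C (share N₁ N₂ true * share N₁ N₂ false)) i := by
  refine gf_grafting_of_reducedSum h₁ h₂ (edgeNumberingTwo i)
    (BaseStructure.twoGenus_genusOneTwo i) (V := [[0, 1, 2, 3]])
    (BaseStructure.vertices_genusOneTwo i) (by decide) (by decide) ?_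
  have hφ := FaithfulSMul.algebraMap_injective (PowerSeries ℝ) (FractionRing (PowerSeries ℝ))
  refine hφ ?_
  have := reducedSum_two (treeRelations h₁ h₂ _ hφ) i
  simpa only [map_mul, map_reducedSum, map_pow, map_sub, map_one, treeProd, map_numeratorTwo]
    using this

lemma gf_genusOneThree (h₁ : 0 < N₁) (h₂ : 0 < N₂) (i : Fin 7) :
    PowerSeries.C (N₁ + N₂) * gf (Grafting.leaves (B := BaseStructure.genusOneThree i))
      (fun G => G.weight N₁ N₂) *
      (PowerSeries.C (share N₁ N₂ true * share N₁ N₂ false) * (treeProd N₁ N₂ - 1) *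
        (treeProd N₁ N₂ + 1) ^ 3) =
      numeratorThree (treeProd N₁ N₂) (PowerSeries.C (share N₁ N₂ true * share N₁ N₂ false)) i := by
  refine gf_grafting_of_reducedSum h₁ h₂ (edgeNumberingThree i)
    (BaseStructure.twoGenus_genusOneThree i) (verticesThree_eq i) (by revert i; decide)
    (by revert i; decide) ?_
  have hφ := FaithfulSMul.algebraMap_injective (PowerSeries ℝ) (FractionRing (PowerSeries ℝ))
  refine hφ ?_
  have := reducedSum_three (treeRelations h₁ h₂ _ hφ) i
  simpa only [map_mul, map_reducedSum, map_pow, map_sub, map_one, treeProd, map_numeratorThree]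
    using this

end

/-! ### From the marks of single leaves to powers of `s` -/

section

open PowerSeries

/-- Two solutions `h ≠ h'` would satisfy `σ ξ (h + h') + σ - 2 σ ξ = 1`, which fails at degree
zero. -/
lemma eq_of_quadratic {σ h h' : PowerSeries ℝ} {ξ : ℝ} (hσ : constantCoeff σ = 0)
    (e : σ * C ξ * h ^ 2 + (σ - 2 * σ * C ξ - 1) * h + σ * C ξ = 0)
    (e' : σ * C ξ * h' ^ 2 + (σ - 2 * σ * C ξ - 1) * h' + σ * C ξ = 0) : h = h' := by
  have key : (h - h') * (σ * C ξ * (h + h') + σ - 2 * σ * C ξ - 1) = 0 := by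
    linear_combination e - e'
  rcases mul_eq_zero.1 key with h1 | h1
  · exact sub_eq_zero.1 h1
  · have := congrArg constantCoeff h1
    simp [hσ] at this

variable {N₁ N₂ ξ : ℝ}

lemma treeProd_equation (h₁ : 0 < N₁) (h₂ : 0 < N₂)
    (hξ : ξ = share N₁ N₂ true * share N₁ N₂ false) :
    X ^ 2 * C ξ * treeProd N₁ N₂ ^ 2 + (X ^ 2 - 2 * X ^ 2 * C ξ - 1) * treeProd N₁ N₂ +
      X ^ 2 * C ξ = 0 := by
  subst hξ
  linear_combination treeProd_quadratic h₁ h₂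

/-- The quadratic equation is invariant under the change of the sign of `X`, hence so is its unique
solution. -/
lemma coeff_treeProd_of_odd (h₁ : 0 < N₁) (h₂ : 0 < N₂) {n : ℕ} (hn : ¬ 2 ∣ n) :
    coeff n (treeProd N₁ N₂) = 0 := by
  have e := treeProd_equation h₁ h₂ rfl
  have e' := congrArg (rescale (-1 : ℝ)) e
  have hC (r : ℝ) : rescale (-1 : ℝ) (C r) = C r := by
    ext n
    rw [coeff_rescale, coeff_C]
    split_ifs with h <;> simp [h]
  have h2 : rescale (-1 : ℝ) 2 = 2 := map_ofNat _ 2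
  have hX : rescale (-1 : ℝ) (X ^ 2) = X ^ 2 := by
    rw [map_pow, rescale_neg_one_X, neg_sq]
  simp only [map_add, map_mul (rescale (-1 : ℝ)), map_sub, hX,
    map_pow (rescale (-1 : ℝ)) (treeProd N₁ N₂), map_one, map_zero, h2, hC] at e'
  have h := eq_of_quadratic (σ := X ^ 2) (ξ := share N₁ N₂ true * share N₁ N₂ false)
    (h := treeProd N₁ N₂) (h' := rescale (-1 : ℝ) (treeProd N₁ N₂)) (by simp) e e'
  have := congrArg (coeff n) h
  rw [coeff_rescale, (Nat.not_even_iff_odd.1 (mt even_iff_two_dvd.1 hn)).neg_one_pow] at this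
  linarith

lemma exists_isTreeSeries (h₁ : 0 < N₁) (h₂ : 0 < N₂)
    (hξ : ξ = share N₁ N₂ true * share N₁ N₂ false) :
    ∃ h : PowerSeries ℝ, IsTreeSeries ξ h := by
  have hh : expand 2 two_ne_zero (mk fun n => coeff (2 * n) (treeProd N₁ N₂)) =
      treeProd N₁ N₂ := by
    ext n
    rw [coeff_expand]
    split_ifs with hn
    · rw [coeff_mk, Nat.mul_div_cancel' hn]
    · rw [coeff_treeProd_of_odd h₁ h₂ hn]
  have hinj : Function.Injective (expand (R := ℝ) 2 two_ne_zero) := fun f g hfg => by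
    ext n
    rw [← coeff_expand_mul 2 two_ne_zero f, hfg, coeff_expand_mul]
  refine ⟨mk fun n => coeff (2 * n) (treeProd N₁ N₂), ?_, hinj ?_⟩
  · rw [← constantCoeff_expand 2 two_ne_zero, hh, constantCoeff_treeProd h₁ h₂]
  · simp only [map_add, map_mul, map_sub, map_pow, map_one, map_zero, map_ofNat, expand_X,
      expand_C, hh]
    exact treeProd_equation h₁ h₂ hξ

lemma IsTreeSeries.expand_eq {h : PowerSeries ℝ} (hh : IsTreeSeries ξ h) (h₁ : 0 < N₁)
    (h₂ : 0 < N₂) (hξ : ξ = share N₁ N₂ true * share N₁ N₂ false) :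
    expand 2 two_ne_zero h = treeProd N₁ N₂ := by
  have e := congrArg (expand 2 two_ne_zero) hh.2
  simp only [map_add, map_mul, map_sub, map_pow, map_one, map_zero, map_ofNat, expand_X,
    expand_C] at e
  exact eq_of_quadratic (σ := X ^ 2) (by simp) e (treeProd_equation h₁ h₂ hξ)

lemma IsTreeSeries.unique {h h' : PowerSeries ℝ} (hh : IsTreeSeries ξ h)
    (hh' : IsTreeSeries ξ h') : h = h' :=
  eq_of_quadratic (σ := X) (by simp) hh.2 hh'.2

/-- If the generating function of the graftings on `B` by the number of leaves satisfies a linear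
equation with coefficients in `ℝ[h]`, so does the one of the contributions. -/
lemma mk_contribution {num den : PowerSeries ℝ} {m : ℕ} {B : BaseStructure m}
    (hden : constantCoeff den ≠ 0)
    (e : C (N₁ + N₂) * gf (Grafting.leaves (B := B)) (fun G => G.weight N₁ N₂) *
      expand 2 two_ne_zero den = expand 2 two_ne_zero num) :
    mk (fun n => (N₁ + N₂) * contribution N₁ N₂ B n) = num * den⁻¹ := by
  have h1 : expand 2 two_ne_zero den * expand 2 two_ne_zero den⁻¹ = 1 := by
    rw [← map_mul, PowerSeries.mul_inv_cancel _ hden, map_one]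
  have h2 : C (N₁ + N₂) * gf (Grafting.leaves (B := B)) (fun G => G.weight N₁ N₂) =
      expand 2 two_ne_zero (num * den⁻¹) := by
    rw [map_mul, ← e, mul_assoc _ (expand _ _ den), h1, mul_one]
  ext n
  rw [← coeff_expand_mul 2 two_ne_zero (num * den⁻¹), ← h2, coeff_mk, coeff_C_mul]
  congr 1
  rw [gf, coeff_mk]
  rfl

lemma constantCoeff_denominator {h : PowerSeries ℝ} (h₁ : 0 < N₁) (h₂ : 0 < N₂)
    (hξ : ξ = share N₁ N₂ true * share N₁ N₂ false) (hh : IsTreeSeries ξ h) (k : ℕ) :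
    constantCoeff (C ξ * (h - 1) * (h + 1) ^ k) ≠ 0 := by
  have := mul_pos (share_pos h₁ h₂ true) (share_pos h₁ h₂ false)
  rw [← hξ] at this
  simp [hh.1, this.ne']

lemma mk_contribution_genusOneTwo {h : PowerSeries ℝ} (h₁ : 0 < N₁) (h₂ : 0 < N₂)
    (hξ : ξ = share N₁ N₂ true * share N₁ N₂ false) (hh : IsTreeSeries ξ h) (i : Fin 5) :
    mk (fun n => (N₁ + N₂) * contribution N₁ N₂ (BaseStructure.genusOneTwo i) n) =
      numeratorTwo h (C ξ) i * (C ξ * (h - 1) * (h + 1) ^ 2)⁻¹ := by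
  refine mk_contribution (constantCoeff_denominator h₁ h₂ hξ hh 2) ?_
  have := map_numeratorTwo (expand (R := ℝ) 2 two_ne_zero).toRingHom h (C ξ) i
  simp only [AlgHom.toRingHom_eq_coe, RingHom.coe_coe] at this
  rw [this]
  simp only [map_mul, map_sub, map_pow, map_add, map_one, hh.expand_eq h₁ h₂ hξ, expand_C]
  rw [hξ]
  rw [← map_add C]
  exact gf_genusOneTwo h₁ h₂ i

lemma mk_contribution_genusOneThree {h : PowerSeries ℝ} (h₁ : 0 < N₁) (h₂ : 0 < N₂)
    (hξ : ξ = share N₁ N₂ true * share N₁ N₂ false) (hh : IsTreeSeries ξ h) (i : Fin 7) :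
    mk (fun n => (N₁ + N₂) * contribution N₁ N₂ (BaseStructure.genusOneThree i) n) =
      numeratorThree h (C ξ) i * (C ξ * (h - 1) * (h + 1) ^ 3)⁻¹ := by
  refine mk_contribution (constantCoeff_denominator h₁ h₂ hξ hh 3) ?_
  have := map_numeratorThree (expand (R := ℝ) 2 two_ne_zero).toRingHom h (C ξ) i
  simp only [AlgHom.toRingHom_eq_coe, RingHom.coe_coe] at this
  rw [this]
  simp only [map_mul, map_sub, map_pow, map_add, map_one, hh.expand_eq h₁ h₂ hξ, expand_C]
  rw [hξ]
  rw [← map_add C]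
  exact gf_genusOneThree h₁ h₂ i

end

/-! ### The integrated generating functions -/

section

open PowerSeries

lemma range_genusOne : Set.range (Sum.elim
    (fun i => (⟨2, BaseStructure.genusOneTwo i⟩ : Σ m, BaseStructure m))
    (fun i => ⟨3, BaseStructure.genusOneThree i⟩)) = {B | B.2.twoGenus = 2} := by
  ext ⟨m, B⟩
  simp only [Set.mem_range, Sum.exists, Sum.elim_inl, Sum.elim_inr, Set.mem_ofPred_eq]
  constructor
  · rintro (⟨i, hi⟩ | ⟨i, hi⟩) <;> cases hi
    · exact BaseStructure.twoGenus_genusOneTwo i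
    · exact BaseStructure.twoGenus_genusOneThree i
  · intro hB
    rcases BaseStructure.edges_of_twoGenus B hB with rfl | rfl
    · obtain ⟨i, hi⟩ := BaseStructure.setOf_twoGenus_two.subset hB
      exact Or.inl ⟨i, by rw [hi]⟩
    · obtain ⟨i, hi⟩ := BaseStructure.setOf_twoGenus_three.subset hB
      exact Or.inr ⟨i, by rw [hi]⟩

lemma genusOne_injective : Function.Injective (Sum.elim
    (fun i => (⟨2, BaseStructure.genusOneTwo i⟩ : Σ m, BaseStructure m))
    (fun i => ⟨3, BaseStructure.genusOneThree i⟩)) := by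
  refine Function.Injective.sumElim (fun i j h => ?_) (fun i j h => ?_) (fun i j h => ?_)
  · exact BaseStructure.genusOneTwo_injective (eq_of_heq (Sigma.mk.inj h).2)
  · exact BaseStructure.genusOneThree_injective (eq_of_heq (Sigma.mk.inj h).2)
  · exact absurd (congrArg Sigma.fst h) (show ¬(2 = 3) by decide)

variable {N₁ N₂ ξ : ℝ}

open Classical in
/-- In genus one the sum over all base structures has twelve terms, with factors `1 / (2 m)`. -/
lemma integratedTerm_two (P : ∀ m, BaseStructure m → Prop) (n : ℕ) :
    integratedTerm N₁ N₂ P 2 n =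
      1 / 4 * ∑ i, (if P 2 (BaseStructure.genusOneTwo i) then
        contribution N₁ N₂ (BaseStructure.genusOneTwo i) n else 0) +
      1 / 6 * ∑ i, (if P 3 (BaseStructure.genusOneThree i) then
        contribution N₁ N₂ (BaseStructure.genusOneThree i) n else 0) := by
  have h1 : integratedTerm N₁ N₂ P 2 n = ∑ᶠ (B : Σ m, BaseStructure m)
      (_ : B ∈ {B : Σ m, BaseStructure m | B.2.twoGenus = 2}),
      if P B.1 B.2 then 1 / (2 * (B.1 : ℝ)) * contribution N₁ N₂ B.2 n else 0 := by
    refine finsum_congr fun B => ?_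
    rw [finsum_eq_if, finsum_eq_if, ← ite_and]
    rfl
  rw [h1, ← range_genusOne, finsum_mem_range genusOne_injective, finsum_eq_sum_of_fintype,
    Fintype.sum_sum_type, Finset.mul_sum, Finset.mul_sum]
  congr 1 <;>
  · refine Finset.sum_congr rfl fun i _ => ?_
    rw [mul_ite, mul_zero]
    congr 2
    norm_num

variable {h : PowerSeries ℝ}

/-- The two kinds of terms of the integrated generating function, on the common denominator
`12 ξ (h - 1) (h + 1) ^ 3`. -/
lemma integrated_combination (hξ : ξ ≠ 0) (h0 : constantCoeff h = 0) {a b p q : PowerSeries ℝ}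
    (e : 3 * (h + 1) * a + 2 * b = 2 * p - 2 * C ξ * (h - 1) * q) :
    C (1 / 4) * (a * (C ξ * (h - 1) * (h + 1) ^ 2)⁻¹) +
      C (1 / 6) * (b * (C ξ * (h - 1) * (h + 1) ^ 3)⁻¹) =
    p * (6 * C ξ * (h - 1) * (1 + h) ^ 3)⁻¹ - q * (6 * (1 + h) ^ 3)⁻¹ := by
  have h6 : (6 : PowerSeries ℝ) = C 6 := (map_ofNat C 6).symm
  have i1 := PowerSeries.inv_mul_cancel (C ξ * (h - 1) * (h + 1) ^ 2) (by simp [h0, hξ])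
  have i2 := PowerSeries.inv_mul_cancel (C ξ * (h - 1) * (h + 1) ^ 3) (by simp [h0, hξ])
  have i3 := PowerSeries.inv_mul_cancel (6 * C ξ * (h - 1) * (1 + h) ^ 3) (by simp [h6, h0, hξ])
  have i4 := PowerSeries.inv_mul_cancel (6 * (1 + h) ^ 3) (by simp [h6, h0])
  have c4 : C (1 / 4 : ℝ) * 4 = 1 := by
    rw [← map_ofNat C 4, ← map_mul, ← map_one C]
    norm_num
  have c6 : C (1 / 6 : ℝ) * 6 = 1 := by
    rw [← map_ofNat C 6, ← map_mul, ← map_one C]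
    norm_num
  have hD : 12 * C ξ * (h - 1) * (h + 1) ^ 3 ≠ 0 := fun hD => by
    have := congrArg constantCoeff hD
    rw [show (12 : PowerSeries ℝ) = C 12 from (map_ofNat C 12).symm] at this
    simp [h0, hξ] at this
  refine mul_right_cancel₀ hD ?_
  generalize (C ξ * (h - 1) * (h + 1) ^ 2)⁻¹ = j1 at *
  generalize (C ξ * (h - 1) * (h + 1) ^ 3)⁻¹ = j2 at *
  generalize (6 * C ξ * (h - 1) * (1 + h) ^ 3)⁻¹ = j3 at *
  generalize (6 * (1 + h) ^ 3)⁻¹ = j4 at *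
  linear_combination e + C (1 / 4) * a * 12 * (h + 1) * i1 + a * 3 * (h + 1) * c4 +
    C (1 / 6) * b * 12 * i2 + 2 * b * c6 - 2 * p * i3 + 2 * C ξ * (h - 1) * q * i4

lemma share_mul_share_ne (h₁ : 0 < N₁) (h₂ : 0 < N₂)
    (hξ : ξ = share N₁ N₂ true * share N₁ N₂ false) : ξ ≠ 0 := by
  rw [hξ]
  exact (mul_pos (share_pos h₁ h₂ true) (share_pos h₁ h₂ false)).ne'

lemma mk_integratedTerm_unitary (h₁ : 0 < N₁) (h₂ : 0 < N₂)
    (hξ : ξ = share N₁ N₂ true * share N₁ N₂ false) (hh : IsTreeSeries ξ h) :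
    mk (fun n => (N₁ + N₂) * integratedTerm N₁ N₂ (fun _ B => B.IsUnitary) 2 n) =
      h ^ 3 * (h + 2) * (6 * C ξ * (h - 1) * (1 + h) ^ 3)⁻¹
        - h ^ 2 * (h + 3) * (6 * (1 + h) ^ 3)⁻¹ := by
  have e : mk (fun n => (N₁ + N₂) * integratedTerm N₁ N₂ (fun _ B => B.IsUnitary) 2 n) =
      C (1 / 4) * mk (fun n => (N₁ + N₂) * contribution N₁ N₂ (BaseStructure.genusOneTwo 0) n) +
      C (1 / 6) *
        mk (fun n => (N₁ + N₂) * contribution N₁ N₂ (BaseStructure.genusOneThree 0) n) := by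
    ext n
    simp only [integratedTerm_two, BaseStructure.isUnitary_genusOneTwo,
      BaseStructure.isUnitary_genusOneThree, Finset.sum_ite_eq', Finset.mem_univ, if_true, map_add,
      coeff_C_mul, coeff_mk]
    ring
  rw [e, mk_contribution_genusOneTwo h₁ h₂ hξ hh, mk_contribution_genusOneThree h₁ h₂ hξ hh]
  refine integrated_combination (share_mul_share_ne h₁ h₂ hξ) hh.1 ?_
  simp only [numeratorTwo, numeratorThree, Matrix.cons_val_zero]
  ring

lemma mk_integratedTerm (h₁ : 0 < N₁) (h₂ : 0 < N₂)
    (hξ : ξ = share N₁ N₂ true * share N₁ N₂ false) (hh : IsTreeSeries ξ h) :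
    mk (fun n => (N₁ + N₂) * integratedTerm N₁ N₂ (fun _ _ => True) 2 n) =
      h ^ 2 * (h ^ 2 + 2 * h - 6) * (6 * C ξ * (h - 1) * (1 + h) ^ 3)⁻¹
        - h * (h ^ 2 + 9 * h - 6) * (6 * (1 + h) ^ 3)⁻¹ := by
  have e : mk (fun n => (N₁ + N₂) * integratedTerm N₁ N₂ (fun _ _ => True) 2 n) =
      C (1 / 4) *
        ∑ i, mk (fun n => (N₁ + N₂) * contribution N₁ N₂ (BaseStructure.genusOneTwo i) n) +
      C (1 / 6) *
        ∑ i, mk (fun n => (N₁ + N₂) * contribution N₁ N₂ (BaseStructure.genusOneThree i) n) := by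
    ext n
    simp only [integratedTerm_two, if_true, map_add, map_sum, coeff_C_mul, coeff_mk,
      ← Finset.mul_sum]
    ring
  simp only [e, mk_contribution_genusOneTwo h₁ h₂ hξ hh, mk_contribution_genusOneThree h₁ h₂ hξ hh,
    ← Finset.sum_mul]
  refine integrated_combination (share_mul_share_ne h₁ h₂ hξ) hh.1 ?_
  simp only [numeratorTwo, numeratorThree, Fin.sum_univ_five, Fin.sum_univ_seven,
    Matrix.cons_val_zero, Matrix.cons_val_one, Matrix.cons_val]
  ring

end

/-! ### Elimination of `h` -/

section

open PowerSeries

variable {ξ : ℝ} {h : PowerSeries ℝ}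

/-- The square root of `(1 - s) (1 - s + 4 ξ s)`, as a power series. -/
noncomputable def discriminantRoot (ξ : ℝ) (h : PowerSeries ℝ) : PowerSeries ℝ :=
  1 - X + 2 * X * C ξ - 2 * X * C ξ * h

lemma constantCoeff_discriminantRoot : constantCoeff (discriminantRoot ξ h) = 1 := by
  simp [discriminantRoot]

lemma discriminantRoot_sq (hh : IsTreeSeries ξ h) :
    discriminantRoot ξ h ^ 2 = (1 - X) * (1 - X + 4 * C ξ * X) := by
  rw [discriminantRoot]
  linear_combination 4 * X * C ξ * hh.2

/-- Implicit differentiation of the quadratic equation. -/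
lemma mul_derivative_treeSeries (hh : IsTreeSeries ξ h) :
    X * discriminantRoot ξ h * derivative ℝ h = h := by
  have h2 : derivative ℝ (2 : PowerSeries ℝ) = 0 := (derivative ℝ).map_natCast 2
  have e := congrArg (derivative ℝ) hh.2
  simp only [map_add, map_sub, Derivation.leibniz, derivative_pow, derivative_C, derivative_X,
    map_zero, smul_eq_mul, Derivation.map_one_eq_zero, h2] at e
  push_cast at e
  rw [discriminantRoot]
  linear_combination -X * e + hh.2

/-- The quadratic equation parametrizes `s` by `h`: `s = h / (ξ (1 - h)² + h)`. Hence a series `F`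
which is a rational function `a / d` of `h` satisfies `s F' = τ(s) / (R³ (1 - s + 4 ξ s))`, where
`R` is the root of the discriminant, if both sides agree as rational functions of `h`. -/
lemma mul_derivative_of_parametrization (hξ : ξ ≠ 0) (hh : IsTreeSeries ξ h)
    {F a a' d d' τ : PowerSeries ℝ} (hd : constantCoeff d ≠ 0) (e : F * d = a)
    (ha : derivative ℝ a = a' * derivative ℝ h) (hd' : derivative ℝ d = d' * derivative ℝ h)
    (key : h * (a' * d - a * d') * (C ξ ^ 3 * (1 - h ^ 2) ^ 2 * (1 + h) ^ 2) =
      τ * (C ξ * (1 - h) ^ 2 + h) ^ 3 * d ^ 2) :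
    X * derivative ℝ F * (discriminantRoot ξ h ^ 3 * (1 - X + 4 * C ξ * X)) = τ := by
  set Q := C ξ * (1 - h) ^ 2 + h with hQ
  have hXQ : X * Q = h := by linear_combination hh.2
  have hR : discriminantRoot ξ h * Q = C ξ * (1 - h ^ 2) := by
    rw [discriminantRoot]
    linear_combination (-1 + 2 * C ξ - 2 * C ξ * h) * hXQ + hQ
  have hc : (1 - X + 4 * C ξ * X) * Q = C ξ * (1 + h) ^ 2 := by
    linear_combination (-1 + 4 * C ξ) * hXQ + hQ
  have e' := congrArg (derivative ℝ) e
  rw [Derivation.leibniz, ha, hd', smul_eq_mul, smul_eq_mul] at e'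
  have e1 : X * derivative ℝ F * discriminantRoot ξ h * d ^ 2 = h * (a' * d - a * d') := by
    linear_combination X * discriminantRoot ξ h * d * e' +
      (a' * d - a * d') * mul_derivative_treeSeries hh -
      X * discriminantRoot ξ h * derivative ℝ h * d' * e
  have hne : Q ^ 3 * d ^ 2 ≠ 0 := by
    refine mul_ne_zero (pow_ne_zero _ fun h0 => ?_) (pow_ne_zero _ fun h0 => ?_)
    · have := congrArg constantCoeff h0
      simp [hQ, hh.1, hξ] at this
    · simp [h0] at hd
  refine mul_right_cancel₀ hne ?_
  calc _ = X * derivative ℝ F * discriminantRoot ξ h * d ^ 2 *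
        ((discriminantRoot ξ h * Q) ^ 2 * ((1 - X + 4 * C ξ * X) * Q)) := by ring
    _ = h * (a' * d - a * d') * (C ξ ^ 3 * (1 - h ^ 2) ^ 2 * (1 + h) ^ 2) := by
        rw [e1, hR, hc]; ring
    _ = _ := by rw [key]; ring

lemma mul_integrated_denominator (hξ : ξ ≠ 0) (h0 : constantCoeff h = 0) (p q : PowerSeries ℝ) :
    (p * (6 * C ξ * (h - 1) * (1 + h) ^ 3)⁻¹ - q * (6 * (1 + h) ^ 3)⁻¹) *
      (6 * C ξ * (h - 1) * (1 + h) ^ 3) = p - C ξ * (h - 1) * q := by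
  have h6 : (6 : PowerSeries ℝ) = C 6 := (map_ofNat C 6).symm
  have i3 := PowerSeries.inv_mul_cancel (6 * C ξ * (h - 1) * (1 + h) ^ 3) (by simp [h6, h0, hξ])
  have i4 := PowerSeries.inv_mul_cancel (6 * (1 + h) ^ 3) (by simp [h6, h0])
  generalize (6 * C ξ * (h - 1) * (1 + h) ^ 3)⁻¹ = j3 at *
  generalize (6 * (1 + h) ^ 3)⁻¹ = j4 at *
  linear_combination p * i3 - C ξ * (h - 1) * q * i4

lemma derivative_integrated_denominator :
    derivative ℝ (6 * C ξ * (h - 1) * (1 + h) ^ 3) =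
      6 * C ξ * ((1 + h) ^ 3 + 3 * (h - 1) * (1 + h) ^ 2) * derivative ℝ h := by
  have h6 : derivative ℝ (6 : PowerSeries ℝ) = 0 := (derivative ℝ).map_natCast 6
  simp only [map_add, map_sub, Derivation.leibniz, derivative_pow, derivative_C,
    smul_eq_mul, Derivation.map_one_eq_zero, h6]
  push_cast
  ring

lemma mul_derivative_unitary (hξ : ξ ≠ 0) (hh : IsTreeSeries ξ h) :
    X * derivative ℝ (h ^ 3 * (h + 2) * (6 * C ξ * (h - 1) * (1 + h) ^ 3)⁻¹
        - h ^ 2 * (h + 3) * (6 * (1 + h) ^ 3)⁻¹) *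
      (discriminantRoot ξ h ^ 3 * (1 - X + 4 * C ξ * X)) = -(C ξ ^ 2 * X ^ 2) := by
  have h6 : (6 : PowerSeries ℝ) = C 6 := (map_ofNat C 6).symm
  have h2 : derivative ℝ (2 : PowerSeries ℝ) = 0 := (derivative ℝ).map_natCast 2
  have h3 : derivative ℝ (3 : PowerSeries ℝ) = 0 := (derivative ℝ).map_natCast 3
  have hXQ : X * (C ξ * (1 - h) ^ 2 + h) = h := by linear_combination hh.2
  refine mul_derivative_of_parametrization hξ hh (by simp [h6, hh.1, hξ])
    (mul_integrated_denominator hξ hh.1 _ _)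
    (a' := 4 * h ^ 3 + 6 * h ^ 2 - C ξ * (h ^ 2 * (h + 3) + (h - 1) * (3 * h ^ 2 + 6 * h))) ?_
    derivative_integrated_denominator ?_
  · simp only [map_add, map_sub, Derivation.leibniz, derivative_pow, derivative_C,
      smul_eq_mul, Derivation.map_one_eq_zero, h2, h3]
    push_cast
    ring
  · rw [show -(C ξ ^ 2 * X ^ 2) * (C ξ * (1 - h) ^ 2 + h) ^ 3 =
      -(C ξ ^ 2 * (X * (C ξ * (1 - h) ^ 2 + h)) ^ 2 * (C ξ * (1 - h) ^ 2 + h)) by ring, hXQ]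
    ring

lemma mul_derivative_all (hξ : ξ ≠ 0) (hh : IsTreeSeries ξ h) :
    X * derivative ℝ (h ^ 2 * (h ^ 2 + 2 * h - 6) * (6 * C ξ * (h - 1) * (1 + h) ^ 3)⁻¹
        - h * (h ^ 2 + 9 * h - 6) * (6 * (1 + h) ^ 3)⁻¹) *
      (discriminantRoot ξ h ^ 3 * (1 - X + 4 * C ξ * X)) =
      C ξ * X * (C ξ * X * (4 * X - 3) + 1 - X ^ 2) := by
  have h6 : (6 : PowerSeries ℝ) = C 6 := (map_ofNat C 6).symm
  have h2 : derivative ℝ (2 : PowerSeries ℝ) = 0 := (derivative ℝ).map_natCast 2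
  have h6' : derivative ℝ (6 : PowerSeries ℝ) = 0 := (derivative ℝ).map_natCast 6
  have h9 : derivative ℝ (9 : PowerSeries ℝ) = 0 := (derivative ℝ).map_natCast 9
  have hXQ : X * (C ξ * (1 - h) ^ 2 + h) = h := by linear_combination hh.2
  refine mul_derivative_of_parametrization hξ hh (by simp [h6, hh.1, hξ])
    (mul_integrated_denominator hξ hh.1 _ _)
    (a' := 4 * h ^ 3 + 6 * h ^ 2 - 12 * h -
      C ξ * (h * (h ^ 2 + 9 * h - 6) + (h - 1) * (3 * h ^ 2 + 18 * h - 6))) ?_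
    derivative_integrated_denominator ?_
  · simp only [map_add, map_sub, Derivation.leibniz, derivative_pow, derivative_C,
      smul_eq_mul, Derivation.map_one_eq_zero, h2, h6', h9]
    push_cast
    ring
  · rw [show C ξ * X * (C ξ * X * (4 * X - 3) + 1 - X ^ 2) * (C ξ * (1 - h) ^ 2 + h) ^ 3 =
      C ξ * (X * (C ξ * (1 - h) ^ 2 + h)) * (C ξ * (X * (C ξ * (1 - h) ^ 2 + h)) *
        (4 * (X * (C ξ * (1 - h) ^ 2 + h)) - 3 * (C ξ * (1 - h) ^ 2 + h)) +
        (C ξ * (1 - h) ^ 2 + h) ^ 2 - (X * (C ξ * (1 - h) ^ 2 + h)) ^ 2) by ring, hXQ]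
    ring

end

/-! ### Evaluation of the power series -/

section

open PowerSeries hiding binomialSeries

/-- The power series `f` converges absolutely at the real number `s`, with sum `v`. -/
def EvaluatesTo (s : ℝ) (f : PowerSeries ℝ) (v : ℝ) : Prop :=
  HasSum (fun n => coeff n f * s ^ n) v

namespace EvaluatesTo

variable {s v w : ℝ} {f g : PowerSeries ℝ}

lemma add (hf : EvaluatesTo s f v) (hg : EvaluatesTo s g w) : EvaluatesTo s (f + g) (v + w) := by
  have := HasSum.add hf hg
  simpa only [EvaluatesTo, map_add, add_mul] using this

lemma sub (hf : EvaluatesTo s f v) (hg : EvaluatesTo s g w) : EvaluatesTo s (f - g) (v - w) := by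
  have := HasSum.sub hf hg
  simpa only [EvaluatesTo, map_sub, sub_mul] using this

lemma neg (hf : EvaluatesTo s f v) : EvaluatesTo s (-f) (-v) := by
  have := HasSum.neg hf
  simpa only [EvaluatesTo, map_neg, neg_mul] using this

/-- Cauchy's product theorem. -/
lemma mul (hf : EvaluatesTo s f v) (hg : EvaluatesTo s g w) : EvaluatesTo s (f * g) (v * w) := by
  have h1 := Summable.norm (HasSum.summable hf)
  have h2 := Summable.norm (HasSum.summable hg)
  have h3 : (fun n => coeff n (f * g) * s ^ n) = fun n =>
      ∑ kl ∈ Finset.HasAntidiagonal.antidiagonal n,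
        (coeff kl.1 f * s ^ kl.1) * (coeff kl.2 g * s ^ kl.2) := by
    funext n
    rw [coeff_mul, Finset.sum_mul]
    refine Finset.sum_congr rfl fun kl hkl => ?_
    rw [← Finset.HasAntidiagonal.mem_antidiagonal.1 hkl]
    ring
  rw [EvaluatesTo, h3, ← HasSum.tsum_eq hf, ← HasSum.tsum_eq hg,
    tsum_mul_tsum_eq_tsum_sum_antidiagonal_of_summable_norm h1 h2]
  exact (summable_norm_sum_mul_antidiagonal_of_summable_norm h1 h2).of_norm.hasSum

lemma C (a : ℝ) : EvaluatesTo s (C a) a := by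
  have := hasSum_single (f := fun n => coeff n (PowerSeries.C a) * s ^ n) 0 fun n hn => by
    simp [coeff_C, hn]
  simpa [EvaluatesTo] using this

lemma one : EvaluatesTo s 1 1 := by
  simpa using C (s := s) 1

lemma X : EvaluatesTo s X s := by
  have := hasSum_single (f := fun n => coeff n (PowerSeries.X : PowerSeries ℝ) * s ^ n) 1
    fun n hn => by simp [coeff_X, hn]
  simpa [EvaluatesTo] using this

lemma rescale_binomialSeries (c r : ℝ) (hs : |c * s| < 1) :
    EvaluatesTo s (rescale c (PowerSeries.binomialSeries ℝ r)) ((1 + c * s) ^ r) := by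
  have := Real.one_add_rpow_hasFPowerSeriesOnBall_zero (a := r)
  have h2 := this.hasSum (y := c * s) (by
    rwa [Metric.mem_eball, edist_zero_right, ← ofReal_norm, Real.norm_eq_abs,
      ENNReal.ofReal_lt_one])
  rw [zero_add] at h2
  have h3 : (fun n => coeff n (rescale c (PowerSeries.binomialSeries ℝ r)) * s ^ n) =
      fun n => binomialSeries ℝ r n fun _ => c * s := by
    funext n
    rw [coeff_rescale, binomialSeries_coeff, binomialSeries_apply, List.ofFn_const,
      List.prod_replicate, mul_pow, smul_eq_mul, smul_eq_mul]
    ring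
  rw [EvaluatesTo, h3]
  exact h2

end EvaluatesTo

variable {ξ : ℝ} {h : PowerSeries ℝ}

lemma rescale_binomialSeries_sq_mul (c : ℝ) (k : ℕ) :
    rescale c (PowerSeries.binomialSeries ℝ (-(k / 2 : ℝ))) ^ 2 *
      (1 + PowerSeries.C c * PowerSeries.X) ^ k = 1 := by
  have h1 : PowerSeries.binomialSeries ℝ (-(k / 2 : ℝ)) ^ 2 * (1 + PowerSeries.X) ^ k = 1 := by
    rw [← binomialSeries_nat (R := ℝ), sq, ← binomialSeries_add, ← binomialSeries_add,
      ← binomialSeries_zero (R := ℝ)]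
    congr 1
    ring
  have h2 := congrArg (rescale c) h1
  rw [map_mul, map_pow, map_pow, map_add, map_one, rescale_X] at h2
  exact h2

/-- `R⁻³ (1 - s + 4 ξ s)⁻¹` is the product of the binomial series of `(1 - s)^(-3/2)` and
`(1 - s + 4 ξ s)^(-5/2)`. -/
lemma binomialSeries_mul_discriminantRoot (hh : IsTreeSeries ξ h) :
    rescale (-1) (PowerSeries.binomialSeries ℝ (-(3 / 2 : ℝ))) *
        rescale (4 * ξ - 1) (PowerSeries.binomialSeries ℝ (-(5 / 2 : ℝ))) *
      (discriminantRoot ξ h ^ 3 *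
        (1 - PowerSeries.X + 4 * PowerSeries.C ξ * PowerSeries.X)) = 1 := by
  have h1 := rescale_binomialSeries_sq_mul (-1) 3
  have h2 := rescale_binomialSeries_sq_mul (4 * ξ - 1) 5
  have h3 := discriminantRoot_sq hh
  push_cast at h1 h2
  rw [map_neg, map_one] at h1
  rw [map_sub, map_mul, map_ofNat, map_one] at h2
  have h4 : constantCoeff (rescale (-1) (PowerSeries.binomialSeries ℝ (-(3 / 2 : ℝ))) *
        rescale (4 * ξ - 1) (PowerSeries.binomialSeries ℝ (-(5 / 2 : ℝ))) *
      (discriminantRoot ξ h ^ 3 *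
        (1 - PowerSeries.X + 4 * PowerSeries.C ξ * PowerSeries.X))) = 1 := by
    simp only [map_mul, map_pow, map_add, map_sub, map_one, constantCoeff_discriminantRoot,
      ← coeff_zero_eq_constantCoeff_apply (rescale _ _), coeff_rescale]
    simp
  generalize rescale (-1) (PowerSeries.binomialSeries ℝ (-(3 / 2 : ℝ))) = a at *
  generalize rescale (4 * ξ - 1) (PowerSeries.binomialSeries ℝ (-(5 / 2 : ℝ))) = b at *
  have h5 : (a * b * (discriminantRoot ξ h ^ 3 *
      (1 - PowerSeries.X + 4 * PowerSeries.C ξ * PowerSeries.X))) ^ 2 = 1 := by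
    calc _ = a ^ 2 * b ^ 2 * (discriminantRoot ξ h ^ 2) ^ 3 *
          (1 - PowerSeries.X + 4 * PowerSeries.C ξ * PowerSeries.X) ^ 2 := by ring
      _ = (a ^ 2 * (1 + -1 * PowerSeries.X) ^ 3) *
          (b ^ 2 * (1 + (4 * PowerSeries.C ξ - 1) * PowerSeries.X) ^ 5) := by rw [h3]; ring
      _ = 1 := by rw [h1, h2, one_mul]
  rcases mul_self_eq_one_iff.1 ((sq _).symm.trans h5) with h6 | h6
  · exact h6
  · rw [h6] at h4
    norm_num at h4

lemma evaluatesTo_of_mul_discriminantRoot (hξ : 0 < ξ) (hξ' : ξ ≤ 1 / 4) (hh : IsTreeSeries ξ h)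
    {s v : ℝ} (hs : |s| < 1) {T τ : PowerSeries ℝ} (hτ : EvaluatesTo s τ v)
    (e : T * (discriminantRoot ξ h ^ 3 *
      (1 - PowerSeries.X + 4 * PowerSeries.C ξ * PowerSeries.X)) = τ) :
    EvaluatesTo s T (v / ((1 - s) ^ (3 / 2 : ℝ) * (1 - s + 4 * ξ * s) ^ (5 / 2 : ℝ))) := by
  obtain ⟨hs1, hs2⟩ := abs_lt.1 hs
  have hc : |(4 * ξ - 1) * s| < 1 := by
    rw [abs_mul]
    refine lt_of_le_of_lt (mul_le_of_le_one_left (abs_nonneg s) ?_) hs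
    rw [abs_le]
    constructor <;> linarith
  have h1 := (EvaluatesTo.rescale_binomialSeries (-1) (-(3 / 2)) (s := s) (by simpa using hs)).mul
    (EvaluatesTo.rescale_binomialSeries (4 * ξ - 1) (-(5 / 2)) hc)
  have h2 : T = τ * (rescale (-1) (PowerSeries.binomialSeries ℝ (-(3 / 2 : ℝ))) *
        rescale (4 * ξ - 1) (PowerSeries.binomialSeries ℝ (-(5 / 2 : ℝ)))) := by
    rw [← e, mul_assoc T, mul_comm (discriminantRoot ξ h ^ 3 * _),
      binomialSeries_mul_discriminantRoot hh, mul_one]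
  rw [h2]
  have h3 : 0 ≤ 1 + -1 * s := by linarith
  have h4 : 0 ≤ 1 + (4 * ξ - 1) * s := by linarith [(abs_lt.1 hc).1]
  convert hτ.mul h1 using 1
  rw [Real.rpow_neg h3, Real.rpow_neg h4, ← mul_inv, div_eq_mul_inv]
  congr 4 <;> ring

/-- The summation index is shifted by one, since `X * F'` has no constant term. -/
lemma hasSum_of_evaluatesTo {f : ℕ → ℝ} {N s v : ℝ} (hN : N ≠ 0)
    (hf : EvaluatesTo s (PowerSeries.X * derivative ℝ (mk fun n => N * f n)) v) :
    HasSum (fun n : ℕ => s ^ (n + 1) * ((n + 1 : ℕ) * f (n + 1))) (N⁻¹ * v) := by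
  have h1 := ((hasSum_nat_add_iff' 1).2 hf).mul_left N⁻¹
  simp only [Finset.range_one, Finset.sum_singleton, coeff_zero_X_mul, zero_mul, sub_zero,
    coeff_succ_X_mul, coeff_derivative, coeff_mk] at h1
  refine h1.congr_fun fun n => ?_
  push_cast
  field_simp

end
end Semiclassical

theorem mainTheorem1 (N₁ N₂ : ℕ) (hN₁ : 0 < N₁) (hN₂ : 0 < N₂) (N ξ : ℝ)
    (hN : N = (N₁ : ℝ) + (N₂ : ℝ)) (hξ : ξ = (N₁ : ℝ) * (N₂ : ℝ) / N ^ 2) :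
    -- the base structures of genus 1
    ((∀ (m : ℕ) (B : BaseStructure m), B.twoGenus = 2 → m = 2 ∨ m = 3) ∧
      {B : BaseStructure 2 | B.twoGenus = 2}.ncard = 5 ∧
      {B : BaseStructure 3 | B.twoGenus = 2}.ncard = 7 ∧
      {B : BaseStructure 2 | B.twoGenus = 2 ∧ B.IsUnitary} = {unitaryBaseTwo} ∧
      {B : BaseStructure 3 | B.twoGenus = 2 ∧ B.IsUnitary} = {unitaryBaseThree}) ∧
    -- finitely many diagrams contribute to each moment
    (∀ (m : ℕ) (B : BaseStructure m) (n : ℕ), {G : Grafting B | G.leaves = 2 * n}.Finite) ∧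
    -- contributions of the two unitary base structures, and integrated generating functions
    (∃! h : PowerSeries ℝ, IsTreeSeries ξ h) ∧
    (∀ h : PowerSeries ℝ, IsTreeSeries ξ h →
      PowerSeries.mk (fun n => N * contribution N₁ N₂ unitaryBaseThree n) =
        (2 * h ^ 3 * PowerSeries.C ξ - 5 * h ^ 3 + 4 * h ^ 2 * PowerSeries.C ξ - 10 * h ^ 2
          - 6 * h - 6 * PowerSeries.C ξ) * h
          * (PowerSeries.C ξ * (h - 1) * (h + 1) ^ 3)⁻¹ ∧
      PowerSeries.mk (fun n => N * contribution N₁ N₂ unitaryBaseTwo n) =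
        -2 * (h ^ 2 * PowerSeries.C ξ - 2 * h ^ 2 + h * PowerSeries.C ξ - 2 * h
          - 2 * PowerSeries.C ξ) * h
          * (PowerSeries.C ξ * (h - 1) * (h + 1) ^ 2)⁻¹ ∧
      PowerSeries.mk (fun n => N * integratedTerm N₁ N₂ (fun _ B => B.IsUnitary) 2 n) =
        h ^ 3 * (h + 2) * (6 * PowerSeries.C ξ * (h - 1) * (1 + h) ^ 3)⁻¹
          - h ^ 2 * (h + 3) * (6 * (1 + h) ^ 3)⁻¹ ∧
      PowerSeries.mk (fun n => N * integratedTerm N₁ N₂ (fun _ _ => True) 2 n) =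
        h ^ 2 * (h ^ 2 + 2 * h - 6) * (6 * PowerSeries.C ξ * (h - 1) * (1 + h) ^ 3)⁻¹
          - h * (h ^ 2 + 9 * h - 6) * (6 * (1 + h) ^ 3)⁻¹) ∧
    -- the terms of order `N⁻¹` of the moment generating function
    (∀ s : ℝ, |s| < 1 →
      HasSum (fun n : ℕ => s ^ (n + 1) * momentTermU N₁ N₂ 2 (n + 1))
        (N⁻¹ * (-(ξ ^ 2 * s ^ 2) /
          ((1 - s) ^ (3 / 2 : ℝ) * (1 - s + 4 * ξ * s) ^ (5 / 2 : ℝ)))) ∧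
      HasSum (fun n : ℕ => s ^ (n + 1) * momentTermO N₁ N₂ 2 (n + 1))
        (N⁻¹ * (ξ * s * (ξ * s * (4 * s - 3) + 1 - s ^ 2) /
          ((1 - s) ^ (3 / 2 : ℝ) * (1 - s + 4 * ξ * s) ^ (5 / 2 : ℝ))))) := by
  have h₁ : (0 : ℝ) < N₁ := Nat.cast_pos.2 hN₁
  have h₂ : (0 : ℝ) < N₂ := Nat.cast_pos.2 hN₂
  have hN0 : N ≠ 0 := by rw [hN]; positivity
  have hshare : ξ = share N₁ N₂ true * share N₁ N₂ false := by
    rw [hξ, share, share, channels, channels, if_pos rfl, if_neg Bool.false_ne_true, ← hN]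
    field_simp
  have hpos : 0 < ξ := by rw [hξ, hN]; positivity
  have hle : ξ ≤ 1 / 4 := by
    rw [hξ, hN, div_le_div_iff₀ (by positivity) (by norm_num)]
    nlinarith [sq_nonneg ((N₁ : ℝ) - N₂)]
  obtain ⟨h, hh⟩ := exists_isTreeSeries h₁ h₂ hshare
  refine ⟨⟨fun m B hB => B.edges_of_twoGenus hB, BaseStructure.ncard_twoGenus_two,
    BaseStructure.ncard_twoGenus_three, BaseStructure.setOf_unitary_two,
    BaseStructure.setOf_unitary_three⟩, fun m B n => finiteFibers_grafting B (2 * n),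
    ⟨h, hh, fun h' hh' => hh'.unique hh⟩, fun h hh => ?_, fun s hs => ?_⟩
  · rw [hN]
    refine ⟨?_, ?_, mk_integratedTerm_unitary h₁ h₂ hshare hh, mk_integratedTerm h₁ h₂ hshare hh⟩
    · rw [← BaseStructure.genusOneThree_zero]
      exact mk_contribution_genusOneThree h₁ h₂ hshare hh 0
    · rw [← BaseStructure.genusOneTwo_zero]
      exact mk_contribution_genusOneTwo h₁ h₂ hshare hh 0
  · have eU := mul_derivative_unitary hpos.ne' hh
    have eO := mul_derivative_all hpos.ne' hh
    rw [← mk_integratedTerm_unitary h₁ h₂ hshare hh, ← hN] at eU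
    rw [← mk_integratedTerm h₁ h₂ hshare hh, ← hN] at eO
    have hX2 : EvaluatesTo s (PowerSeries.X ^ 2) (s ^ 2) := by
      simpa only [sq] using EvaluatesTo.X.mul EvaluatesTo.X
    refine ⟨hasSum_of_evaluatesTo hN0 (evaluatesTo_of_mul_discriminantRoot hpos hle hh hs ?_ eU),
      hasSum_of_evaluatesTo hN0 (evaluatesTo_of_mul_discriminantRoot hpos hle hh hs ?_ eO)⟩
    · rw [← map_pow]
      exact ((EvaluatesTo.C _).mul hX2).neg
    · rw [← map_ofNat PowerSeries.C 4, ← map_ofNat PowerSeries.C 3]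
      exact ((EvaluatesTo.C _).mul .X).mul (((((EvaluatesTo.C _).mul .X).mul
        (((EvaluatesTo.C _).mul .X).sub (.C _))).add .one).sub hX2)
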